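/- Let $V=\mathbb R^n$ with a scalar product $\langle\cdot,\cdot\rangle$, let $A\in\mathrm{Hom}(V)$, and let $B:[0,\infty)\to\mathrm{Hom}(V)$ be continuous and bounded. Assume that the characteristic polynomial of $A$ has no (complex) root with real part $1$, and that the system $y'=(A/x+B(x))y$ is exponentially dichotomic on $[a,\infty)$ for some $a>0$. Let $g:[0,\infty)\to V$ be continuous with $g(x)\to0$ as $x\to+\infty$. Consider the problem $$y'=\Big(\frac Ax+B(x)\Big)y+g(x)\ (x>0),\qquad y\in C^1([0,\infty),V),\quad y(+0)=0,\quad y(+\infty)=0. \tag{1}$$ (I) Problem (1) has a solution if and only if $\int_0^\infty\langle g(x),\eta(x)\rangle\,dx=0$ for every solution $\eta$ on $(0,\infty)$ of the adjoint system $\eta'=-(A^*/x+B^*(x))\eta$ with $\int_0^\infty\|\eta(x)\|\,dx<\infty$. (II) Fix $x_0>0$ and let $Y(x)=Y(x;x_0)$, $x>0$, be the evolution operator of the homogeneous system, $Y(x_0)=E$. Let $\mathbb V_+$ be the space of those $v$ for which $\|Y(x)v\|=O(x^{1+\alpha})$ on $(0,x_0]$ for some $\alpha>0$, let $\mathbb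 U_-$ be the space of those $v$ for which $\|Y(x)v\|=O(e^{-\gamma x})$ on $[x_0,\infty)$ for some $\gamma>0$, and let $\mathbb V_-^0$ be a complement of $\mathbb V_+$ in the space $\mathbb W=\mathbb V_+\oplus\mathbb V_-^0$ of values at $x_0$ of the solutions of the homogeneous system that are of class $C^1$ on $[0,\infty)$. Let $V=\mathbb L_1\oplus\dots\oplus\mathbb L_6$ with $\mathbb L_1=\mathbb U_-\cap\mathbb V_+$, $\mathbb L_1\oplus\mathbb L_2=\mathbb U_-\cap\mathbb W$, $\mathbb L_1\oplus\mathbb L_2\oplus\mathbb L_3=\mathbb U_-$, $\mathbb L_1\oplus\mathbb L_4=\mathbb V_+$, $\mathbb L_1\oplus\mathbb L_2\oplus\mathbb L_4\oplus\mathbb L_5=\mathbb W$, $\mathbb L_5\subset\mathbb V_-^0$, let $P_1,\dots,P_6$ be the corresponding projectors, and suppose that the scalar product is such that $P_j^*=P_j$ for all $j$. Put $\Pi=P_5+P_6$ and, for $x,s>0$, $G=G_1+G_2$ with $$G_1(x,s)=\begin{cases}Y(x)P_1Y^{-1}(s),&x_0\le s\le x,\\-Y(x)P_1Y^{-1}(s),&x<s<x_0,\\0&\text{otherwise},\end{cases}\qquad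 G_2(x,s)=\begin{cases}Y(x)(P_2+P_3)Y^{-1}(s),&s\le x,\\-Y(x)(P_4+P_5+P_6)Y^{-1}(s),&x<s.\end{cases}$$ Let $F:[0,\infty)\to\mathrm{Hom}(V)$ be continuous and bounded with $F(+\infty)=0$ and $\int_0^\infty\Pi Y^{-1}(x)F(x)\,dx=\Pi$. For instance, there is $\kappa_0$ such that for all $\kappa>\kappa_0$ and all $\beta>0$ for which every root of the characteristic polynomial of $A$ has real part greater than $-\beta$, the function $$F(x)=\frac{\kappa^{1+\beta}x^\beta}{\Gamma(1+\beta)e^{\kappa x}}\,Y(x)\Pi$$ (equal to $0$ at $x=0$) has these properties. Put $N(x)=-\int_0^\infty G(x,t)F(t)\,dt$, $$M(s)=-\Big[\int_0^\infty P_1Y^*(x)Y(x)P_1\,dx\Big|_{\mathbb L_1}\Big]^{-1}\int_0^\infty P_1Y^*(x)\big(G(x,s)+N(x)\Pi Y^{-1}(s)\big)\,dx,$$ $$\mathfrak G(x,s)=G(x,s)+Y(x)P_1M(s)+N(x)\Pi Y^{-1}(s),\qquad x,s>0.$$ Then $\mathfrak G$ is a generalized Green function of (1), that is: 1. $\big(\frac{\partial}{\partial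 x}-\frac Ax-B(x)\big)\mathfrak G(x,s)=-F(x)\Pi Y^{-1}(s)$ for $x,s>0$, $x\ne s$; 2. $\mathfrak G(x+0,x)-\mathfrak G(x-0,x)=E$ for $x>0$; 3. $\int_0^\infty P_1Y^*(x)\mathfrak G(x,s)\,dx=0$ for $s>0$, the integral being absolutely convergent; 4. $\mathfrak G(+0,s)=\mathfrak G(+\infty,s)=0$ for $s>0$; 5. $\sup_{x>0}\int_0^\infty\|\mathfrak G(x,s)h(s)\|\,ds<\infty$ for every continuous $h:[0,\infty)\to V$ with $h(+\infty)=0$ and $\int_0^\infty\Pi Y^{-1}(s)h(s)\,ds=0$. If the orthogonality condition of (I) holds, then the solutions of (1) are exactly the functions with $y(0)=0$ and $$y(x)=Y(x)v+\int_0^\infty\mathfrak G(x,s)g(s)\,ds,\qquad x>0,$$ with $v\in\mathbb L_1$ arbitrary, the integral being absolutely convergent for every $x>0$; and the two components are mutually orthogonal: $\int_0^\infty\big\langle Y(x)v,\int_0^\infty\mathfrak G(x,s)g(s)\,ds\big\rangle\,dx=0$ for every $v\in\mathbb L_1$, the outer integral being absolutely convergent. -/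

import Mathlib

open Set Filter Topology MeasureTheory
open scoped InnerProductSpace

noncomputable section

namespace SingularODE

variable {V : Type*} [NormedAddCommGroup V] [InnerProductSpace ℝ V]

/-- The coefficient operator `A / x + B(x)`. -/
def coeff (A : V →L[ℝ] V) (B : ℝ → V →L[ℝ] V) (x : ℝ) : V →L[ℝ] V :=
  x⁻¹ • A + B x

/-- `y` solves `y' = (A / x + B(x)) y + g(x)` on `(0, ∞)`. -/
def IsSolution (A : V →L[ℝ] V) (B : ℝ → V →L[ℝ] V) (g : ℝ → V) (y : ℝ → V) : Prop :=
  ∀ x : ℝ, 0 < x → HasDerivAt y (coeff A B x (y x) + g x) x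

/-- `y` solves the boundary value problem
`y' = (A / x + B(x)) y + g(x)`, `y ∈ C¹[0, ∞)`, `y(+0) = 0`, `y(+∞) = 0`.
Only the values of `y` on `[0, ∞)` matter. -/
structure IsBVPSolution (A : V →L[ℝ] V) (B : ℝ → V →L[ℝ] V) (g : ℝ → V) (y : ℝ → V) :
    Prop where
  contDiffOn : ContDiffOn ℝ 1 y (Ici 0)
  isSolution : IsSolution A B g y
  tendsto_zero : Tendsto y (𝓝[>] 0) (𝓝 0)
  tendsto_atTop : Tendsto y atTop (𝓝 0)

/-- `η` solves the adjoint system `η' = -(A* / x + B*(x)) η` on `(0, ∞)`. -/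
def IsAdjointSolution [CompleteSpace V] (A : V →L[ℝ] V) (B : ℝ → V →L[ℝ] V) (η : ℝ → V) :
    Prop :=
  ∀ x : ℝ, 0 < x →
    HasDerivAt η (-((x⁻¹ • ContinuousLinearMap.adjoint A
      + ContinuousLinearMap.adjoint (B x)) (η x))) x

/-- `z` is a (complex) root of the characteristic polynomial of the real operator `A`. -/
def IsCharRoot (A : V →L[ℝ] V) [FiniteDimensional ℝ V] (z : ℂ) : Prop :=
  (((A : V →ₗ[ℝ] V).charpoly).map (algebraMap ℝ ℂ)).IsRoot z

/-- `Y` is a fundamental operator of `y' = (A / x + B(x)) y` on `(0, ∞)`, normalized at `x₀`. -/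
def IsEvolution (A : V →L[ℝ] V) (B : ℝ → V →L[ℝ] V) (x₀ : ℝ) (Y : ℝ → V →L[ℝ] V) : Prop :=
  Y x₀ = 1 ∧ ∀ x : ℝ, 0 < x → HasDerivAt Y (coeff A B x ∘L Y x) x

/-- The evolution operator `Y(x; x₀)`: the solution of the operator equation
`Y' = (A / x + B(x)) Y`, `Y(x₀) = E` on `(0, ∞)`. For `x₀ > 0` and `B` continuous on `[0, ∞)`
it exists and is unique on `(0, ∞)` by the linear theory; values for `x ≤ 0` are irrelevant. -/
def evol (A : V →L[ℝ] V) (B : ℝ → V →L[ℝ] V) (x₀ : ℝ) : ℝ → V →L[ℝ] V :=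
  Classical.epsilon (IsEvolution A B x₀)

/-- `Y⁻¹(s; x₀)`. -/
def evolInv (A : V →L[ℝ] V) (B : ℝ → V →L[ℝ] V) (x₀ s : ℝ) : V →L[ℝ] V :=
  Ring.inverse (evol A B x₀ s)

/-- The homogeneous system is exponentially dichotomic on `[a, ∞)`. -/
def IsExpDichotomic (A : V →L[ℝ] V) (B : ℝ → V →L[ℝ] V) (a : ℝ) : Prop :=
  ∃ (P : V →L[ℝ] V) (γ C : ℝ), P ∘L P = P ∧ 0 < γ ∧
    (∀ s x : ℝ, a ≤ s → s ≤ x →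
      ‖evol A B a x ∘L P ∘L evolInv A B a s‖ ≤ C * Real.exp (-γ * (x - s))) ∧
    (∀ s x : ℝ, a ≤ x → x ≤ s →
      ‖evol A B a x ∘L (1 - P) ∘L evolInv A B a s‖ ≤ C * Real.exp (-γ * (s - x)))

/-- `𝕍₊`: initial values at `x₀` of the homogeneous solutions that are
`O(x^(1+α))` on `(0, x₀]` for some `α > 0`. -/
def Vplus (A : V →L[ℝ] V) (B : ℝ → V →L[ℝ] V) (x₀ : ℝ) : Submodule ℝ V where
  carrier := {v | ∃ α c : ℝ, 0 < α ∧ ∀ x : ℝ, 0 < x → x ≤ x₀ →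
    ‖evol A B x₀ x v‖ ≤ c * (x / x₀) ^ (1 + α)}
  zero_mem' := ⟨1, 0, one_pos, fun x _ _ => by simp⟩
  add_mem' := by
    rintro u v ⟨α, c, hα, hu⟩ ⟨α', c', hα', hv⟩
    refine ⟨min α α', |c| + |c'|, lt_min hα hα', fun x hx hxx => ?_⟩
    have hx₀ : 0 < x₀ := hx.trans_le hxx
    have hq : 0 < x / x₀ := div_pos hx hx₀
    have hq1 : x / x₀ ≤ 1 := (div_le_one hx₀).2 hxx
    have e1 : (x / x₀) ^ (1 + α) ≤ (x / x₀) ^ (1 + min α α') :=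
      Real.rpow_le_rpow_of_exponent_ge hq hq1 (by gcongr; exact min_le_left _ _)
    have e2 : (x / x₀) ^ (1 + α') ≤ (x / x₀) ^ (1 + min α α') :=
      Real.rpow_le_rpow_of_exponent_ge hq hq1 (by gcongr; exact min_le_right _ _)
    rw [map_add, add_mul]
    refine (norm_add_le _ _).trans (add_le_add ?_ ?_)
    · refine (hu x hx hxx).trans ?_
      exact mul_le_mul (le_abs_self c) e1 (by positivity) (abs_nonneg _)
    · refine (hv x hx hxx).trans ?_
      exact mul_le_mul (le_abs_self c') e2 (by positivity) (abs_nonneg _)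
  smul_mem' := by
    rintro r v ⟨α, c, hα, hv⟩
    refine ⟨α, |r| * c, hα, fun x hx hxx => ?_⟩
    rw [map_smul, norm_smul, Real.norm_eq_abs, mul_assoc]
    exact mul_le_mul_of_nonneg_left (hv x hx hxx) (abs_nonneg _)

/-- `𝕌₋`: initial values at `x₀` of the homogeneous solutions that decay exponentially on
`[x₀, ∞)` (under exponential dichotomy: that are bounded there). -/
def Uminus (A : V →L[ℝ] V) (B : ℝ → V →L[ℝ] V) (x₀ : ℝ) : Submodule ℝ V where
  carrier := {v | ∃ γ c : ℝ, 0 < γ ∧ ∀ x : ℝ, x₀ ≤ x →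
    ‖evol A B x₀ x v‖ ≤ c * Real.exp (-γ * (x - x₀))}
  zero_mem' := ⟨1, 0, one_pos, fun x _ => by simp⟩
  add_mem' := by
    rintro u v ⟨γ, c, hγ, hu⟩ ⟨γ', c', hγ', hv⟩
    refine ⟨min γ γ', |c| + |c'|, lt_min hγ hγ', fun x hx => ?_⟩
    have hd : 0 ≤ x - x₀ := sub_nonneg.2 hx
    have e1 : Real.exp (-γ * (x - x₀)) ≤ Real.exp (-(min γ γ') * (x - x₀)) := by
      gcongr; exact min_le_left _ _
    have e2 : Real.exp (-γ' * (x - x₀)) ≤ Real.exp (-(min γ γ') * (x - x₀)) := by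
      gcongr; exact min_le_right _ _
    rw [map_add, add_mul]
    refine (norm_add_le _ _).trans (add_le_add ?_ ?_)
    · refine (hu x hx).trans ?_
      exact mul_le_mul (le_abs_self c) e1 (by positivity) (abs_nonneg _)
    · refine (hv x hx).trans ?_
      exact mul_le_mul (le_abs_self c') e2 (by positivity) (abs_nonneg _)
  smul_mem' := by
    rintro r v ⟨γ, c, hγ, hv⟩
    refine ⟨γ, |r| * c, hγ, fun x hx => ?_⟩
    rw [map_smul, norm_smul, Real.norm_eq_abs, mul_assoc]
    exact mul_le_mul_of_nonneg_left (hv x hx) (abs_nonneg _)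

/-- Initial values at `x₀` of the homogeneous solutions of class `C¹[0, ∞)`. -/
def C1Space (A : V →L[ℝ] V) (B : ℝ → V →L[ℝ] V) (x₀ : ℝ) : Submodule ℝ V where
  carrier := {v | ∃ y : ℝ → V, ContDiffOn ℝ 1 y (Ici 0) ∧ IsSolution A B 0 y ∧ y x₀ = v}
  zero_mem' := ⟨0, contDiffOn_const, fun x _ => by
    simp [hasDerivAt_zero], rfl⟩
  add_mem' := by
    rintro _ _ ⟨y, hy, hys, rfl⟩ ⟨z, hz, hzs, rfl⟩
    refine ⟨y + z, hy.add hz, fun x hx => ?_, rfl⟩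
    have := (hys x hx).add (hzs x hx)
    simpa [map_add] using this
  smul_mem' := by
    rintro r _ ⟨y, hy, hys, rfl⟩
    refine ⟨r • y, hy.const_smul r, fun x hx => ?_, rfl⟩
    have := (hys x hx).const_smul r
    simpa using this

/-- The range of a continuous linear operator, as a subspace. -/
abbrev rg (T : V →L[ℝ] V) : Submodule ℝ V := LinearMap.range (T : V →ₗ[ℝ] V)

/-- A decomposition `ℝⁿ = 𝕃₁ ⊕ ⋯ ⊕ 𝕃₆` with its projectors. Here `P 0, …, P 5` stand for
`P₁, …, P₆`, and `𝕃ⱼ` is the range of `Pⱼ`; `V0` stands for `𝕍₋⁰`. As the projectors are mutually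
disjunctive, all the sums of ranges below are direct. The last field says that the scalar product
is one for which the projectors are self-adjoint. -/
structure Splitting [CompleteSpace V] (A : V →L[ℝ] V) (B : ℝ → V →L[ℝ] V) (x₀ : ℝ) where
  /-- `𝕍₋⁰` -/
  V0 : Submodule ℝ V
  /-- the projectors -/
  P : Fin 6 → V →L[ℝ] V
  idem : ∀ i, P i ∘L P i = P i
  disj : ∀ i j, i ≠ j → P i ∘L P j = 0
  sum_eq : ∑ i, P i = 1
  V0_inf : V0 ⊓ Vplus A B x₀ = ⊥
  V0_sup : Vplus A B x₀ ⊔ V0 = C1Space A B x₀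
  L1_eq : rg (P 0) = Uminus A B x₀ ⊓ Vplus A B x₀
  L12_eq : rg (P 0) ⊔ rg (P 1) = Uminus A B x₀ ⊓ (Vplus A B x₀ ⊔ V0)
  L123_eq : rg (P 0) ⊔ rg (P 1) ⊔ rg (P 2) = Uminus A B x₀
  L14_eq : rg (P 0) ⊔ rg (P 3) = Vplus A B x₀
  L1245_eq : rg (P 0) ⊔ rg (P 1) ⊔ rg (P 3) ⊔ rg (P 4) = Vplus A B x₀ ⊔ V0
  L5_le : rg (P 4) ≤ V0
  selfAdj : ∀ i, IsSelfAdjoint (P i)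

namespace Splitting

variable [CompleteSpace V] {A : V →L[ℝ] V} {B : ℝ → V →L[ℝ] V} {x₀ : ℝ}

/-- `𝕃₁`. -/
def L1 (D : Splitting A B x₀) : Submodule ℝ V := rg (D.P 0)

/-- `Π = P₅ + P₆`. -/
def Pi56 (D : Splitting A B x₀) : V →L[ℝ] V := D.P 4 + D.P 5

/-- `Y(x; x₀) T Y⁻¹(s; x₀)`. -/
def conj (_D : Splitting A B x₀) (T : V →L[ℝ] V) (x s : ℝ) : V →L[ℝ] V :=
  evol A B x₀ x ∘L T ∘L evolInv A B x₀ s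

open scoped Classical in
/-- `G₁(x, s)`, for `x, s > 0`. -/
def G₁ (D : Splitting A B x₀) (x s : ℝ) : V →L[ℝ] V :=
  if x₀ ≤ s ∧ s ≤ x then D.conj (D.P 0) x s
  else if x < s ∧ s < x₀ then -D.conj (D.P 0) x s
  else 0

open scoped Classical in
/-- `G₂(x, s)`, for `x, s > 0`. -/
def G₂ (D : Splitting A B x₀) (x s : ℝ) : V →L[ℝ] V :=
  if s ≤ x then D.conj (D.P 1 + D.P 2) x s
  else -D.conj (D.P 3 + D.P 4 + D.P 5) x s

/-- `G(x, s) = G₁(x, s) + G₂(x, s)`. -/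
def G (D : Splitting A B x₀) (x s : ℝ) : V →L[ℝ] V := D.G₁ x s + D.G₂ x s

/-- Admissible weights `F(·; x₀)`: continuous, bounded on `[0, ∞)`, vanishing at infinity and
biorthonormal, i.e. `∫₀^∞ Π Y⁻¹(x; x₀) F(x; x₀) dx = Π`. -/
structure IsAdmissible (D : Splitting A B x₀) (F : ℝ → V →L[ℝ] V) : Prop where
  continuousOn : ContinuousOn F (Ici 0)
  bounded : ∃ C : ℝ, ∀ x : ℝ, 0 ≤ x → ‖F x‖ ≤ C
  tendsto_atTop : Tendsto F atTop (𝓝 0)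
  biorth : ∫ x in Ioi (0 : ℝ), D.Pi56 ∘L evolInv A B x₀ x ∘L F x = D.Pi56

/-- The explicit weight `κ^(1+β) x^β / (Γ(1+β) e^(κ x)) Y(x; x₀) Π`. -/
def expWeight (D : Splitting A B x₀) (κ β : ℝ) (x : ℝ) : V →L[ℝ] V :=
  (κ ^ (1 + β) * x ^ β / (Real.Gamma (1 + β) * Real.exp (κ * x))) •
    (evol A B x₀ x ∘L D.Pi56)

/-- `N(x; x₀) = -∫₀^∞ G(x, t) F(t; x₀) dt`. -/
def N (D : Splitting A B x₀) (F : ℝ → V →L[ℝ] V) (x : ℝ) : V →L[ℝ] V :=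
  -∫ t in Ioi (0 : ℝ), D.G x t ∘L F t

/-- `∫₀^∞ P₁ Y*(x; x₀) Y(x; x₀) P₁ dx`. -/
def gram (D : Splitting A B x₀) : V →L[ℝ] V :=
  ∫ x in Ioi (0 : ℝ), D.P 0 ∘L ContinuousLinearMap.adjoint (evol A B x₀ x) ∘L
    evol A B x₀ x ∘L D.P 0

/-- `M(s; x₀)`. The operator `gram` maps `𝕃₁ = im P₁` into itself and vanishes on `ker P₁`, so
`gram + (E - P₁)` is block-diagonal and its inverse is `[gram|𝕃₁]⁻¹` on `𝕃₁`; it is only applied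
to an operator with values in `𝕃₁`. -/
def M (D : Splitting A B x₀) (F : ℝ → V →L[ℝ] V) (s : ℝ) : V →L[ℝ] V :=
  -(Ring.inverse (D.gram + (1 - D.P 0)) ∘L
    ∫ x in Ioi (0 : ℝ), D.P 0 ∘L ContinuousLinearMap.adjoint (evol A B x₀ x) ∘L
      (D.G x s + D.N F x ∘L D.Pi56 ∘L evolInv A B x₀ s))

/-- The function `𝔊(x, s) = G(x, s) + Y(x; x₀) P₁ M(s; x₀) + N(x; x₀) Π Y⁻¹(s; x₀)`. -/
def green (D : Splitting A B x₀) (F : ℝ → V →L[ℝ] V) (x s : ℝ) : V →L[ℝ] V :=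
  D.G x s + evol A B x₀ x ∘L D.P 0 ∘L D.M F s + D.N F x ∘L D.Pi56 ∘L evolInv A B x₀ s

/-- The five characteristic properties of a generalized Green function. -/
structure IsGeneralizedGreen (D : Splitting A B x₀) (F : ℝ → V →L[ℝ] V)
    (K : ℝ → ℝ → V →L[ℝ] V) : Prop where
  /-- `(d/dx - (A / x + B(x))) K(x, s) = -F(x; x₀) Π Y⁻¹(s; x₀)` for `x ≠ s` -/
  ode : ∀ s x : ℝ, 0 < s → 0 < x → x ≠ s →
    HasDerivAt (fun t => K t s)
      (coeff A B x ∘L K x s - F x ∘L D.Pi56 ∘L evolInv A B x₀ s) x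
  /-- `K(x+0, x) - K(x-0, x) = E` -/
  jump : ∀ x : ℝ, 0 < x → ∃ R L : V →L[ℝ] V,
    Tendsto (fun t => K t x) (𝓝[>] x) (𝓝 R) ∧
    Tendsto (fun t => K t x) (𝓝[<] x) (𝓝 L) ∧ R - L = 1
  /-- `∫₀^∞ P₁ Y*(x; x₀) K(x, s) dx = 0` -/
  orth : ∀ s : ℝ, 0 < s →
    IntegrableOn
      (fun x => D.P 0 ∘L ContinuousLinearMap.adjoint (evol A B x₀ x) ∘L K x s) (Ioi 0) ∧
    ∫ x in Ioi (0 : ℝ),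
      D.P 0 ∘L ContinuousLinearMap.adjoint (evol A B x₀ x) ∘L K x s = 0
  /-- `K(+0, s) = 0` -/
  tendsto_zero : ∀ s : ℝ, 0 < s → Tendsto (fun x => K x s) (𝓝[>] 0) (𝓝 0)
  /-- `K(+∞, s) = 0` -/
  tendsto_atTop : ∀ s : ℝ, 0 < s → Tendsto (fun x => K x s) atTop (𝓝 0)
  /-- `sup_x ∫₀^∞ ‖K(x, s) g(s)‖ ds < ∞` whenever `∫₀^∞ Π Y⁻¹(s; x₀) g(s) ds = 0` -/
  bounded : ∀ g : ℝ → V, ContinuousOn g (Ici 0) → Tendsto g atTop (𝓝 0) →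
    ∫ s in Ioi (0 : ℝ), D.Pi56 (evolInv A B x₀ s (g s)) = 0 →
    ∃ C : ℝ, ∀ x : ℝ, 0 < x →
      IntegrableOn (fun s => K x s (g s)) (Ioi 0) ∧
      ∫ s in Ioi (0 : ℝ), ‖K x s (g s)‖ ≤ C

end Splitting

end SingularODE

end

set_option linter.unusedSectionVars false

/-! Everything rests on two dichotomies of the homogeneous system. Near zero, the substitution x =
e^t turns it into y' = (A + e^t B) y, a perturbation of y' = A y that is exponentially small at t =
-∞, and a transformation tending to E conjugates one to the other (`exists_conjugation`). As A has
no characteristic root on Re z = 1, its spectral projection yields a dichotomy on (0, x₀] with rates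
x^(1+α) and x^(1-α) (`exists_zeroDichotomy`). At infinity the dichotomy is given and is only moved
to x₀ (`exists_inftyDichotomy`). The range of a dichotomy projection is fixed by the growth of
solutions (𝕍₊ at zero, 𝕌₋ at infinity), and any projection with the same range serves as well. So
every commuting pair P, Q of projections onto 𝕍₊ and 𝕌₋ is a dichotomy pair (`exists_twoSided`).

Such a pair gives the kernel `kern`, which behaves well at infinity; at zero it is wrong by the
defect Y(x)(1-Q)(1-P)Y⁻¹(s). Adding the defect gives `kern₀`, which for small x is dominated by a
weight ρ(s/x), with integral proportional to x, and a smaller tail. Hence ∫ kern₀ g is O(x). A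
solution that is O(x) at zero is automatically C¹ up to zero, because 1 - A is invertible
(`ZeroDichotomy.contDiffOn_solution`). So if g annihilates the defect, ∫ kern g solves the problem,
and all solutions differ from it by Y(x)v with v in im PQ (`TwoSided.isBVPSolution_iff`).

For (I): the defect is built from integrable adjoint solutions, so orthogonality kills it, which
gives sufficiency. Conversely ⟨y, η⟩' = ⟨g, η⟩. The boundary value at infinity vanishes by
integrability; the one at zero vanishes because |⟨y, η⟩| ≤ c x ‖η‖ with η integrable, while 1/x is
not.

For (II): with P = P₁+P₄ and Q = P₁+P₂+P₃ one has G = `kern`, and the defect is YΠY⁻¹.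
Biorthonormality of F gives N = YΠ + O(x) at zero, so the term NΠY⁻¹ supplies the missing defect
there and still vanishes at infinity; the corrected kernel `preGreen` is bounded in L¹(ds) uniformly
in x. The term Y P₁ M subtracts the component along the solutions from 𝕃₁: M solves the normal
equations of the Gram operator, which is positive definite on 𝕃₁. Applied to an admissible g, the
N-term integrates to zero and the M-term is a homogeneous solution from 𝕃₁; Fubini turns the
orthogonality of the kernel into that of the two components. -/

namespace SingularODE

/-! ### Global solvability of linear equations by a weighted contraction. -/

section LinearODE

open scoped BoundedContinuousFunction

variable {E : Type*} [NormedAddCommGroup E] [NormedSpace ℝ E] [CompleteSpace E]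

/-- Banach's fixed point theorem for functions measured in the weighted norm `sup ‖y t‖ / w t`. -/
theorem exists_fixedPoint_weighted {w : ℝ → ℝ} (hw : Continuous w) (hwpos : ∀ t, 0 < w t)
    (Φ : (ℝ → E) → ℝ → E) (hcont : ∀ y, Continuous y → (∃ C, ∀ t, ‖y t‖ ≤ C * w t) → Continuous (Φ y))
    (h0 : ∃ C, ∀ t, ‖Φ 0 t‖ ≤ C * w t)
    (hlip : ∀ y z, Continuous y → Continuous z → (∃ C, ∀ t, ‖y t‖ ≤ C * w t) →
      (∃ C, ∀ t, ‖z t‖ ≤ C * w t) → ∀ M, (∀ t, ‖y t - z t‖ ≤ M * w t) → ∀ t, ‖Φ y t - Φ z t‖ ≤ M / 2 * w t) :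
    ∃ y : ℝ → E, Continuous y ∧ (∃ C, ∀ t, ‖y t‖ ≤ C * w t) ∧ Φ y = y := by
  obtain ⟨C₀, hC₀⟩ := h0
  have hy : ∀ R : ℝ →ᵇ E, Continuous (fun t => w t • R t) := fun R => hw.smul R.continuous
  have hbd : ∀ R : ℝ →ᵇ E, ∀ t, ‖w t • R t‖ ≤ ‖R‖ * w t := fun R t => by
    rw [norm_smul, Real.norm_of_nonneg (hwpos t).le, mul_comm]
    exact mul_le_mul_of_nonneg_right (R.norm_coe_le_norm t) (hwpos t).le
  have hΦbd : ∀ R : ℝ →ᵇ E, ∀ t, ‖(w t)⁻¹ • Φ (fun s => w s • R s) t‖ ≤ C₀ + ‖R‖ / 2 := by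
    intro R t
    have h1 := hlip _ 0 (hy R) continuous_const ⟨_, hbd R⟩ ⟨0, by simp⟩ ‖R‖ (fun t => by simpa using hbd R t) t
    have h2 := hC₀ t
    have h3 : ‖Φ (fun s => w s • R s) t‖ ≤ (C₀ + ‖R‖ / 2) * w t := by
      calc _ = ‖(Φ (fun s => w s • R s) t - Φ 0 t) + Φ 0 t‖ := by simp
        _ ≤ _ := norm_add_le _ _
        _ ≤ _ := by linarith
    rw [norm_smul, norm_inv, Real.norm_of_nonneg (hwpos t).le, inv_mul_le_iff₀ (hwpos t)]
    linarith
  -- Dividing by w identifies the weighted space with bounded continuous functions; Ψ is Φ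
  -- transported there, and it halves distances.
  let Ψ : (ℝ →ᵇ E) → (ℝ →ᵇ E) := fun R =>
    BoundedContinuousFunction.ofNormedAddCommGroup
      (fun t => (w t)⁻¹ • Φ (fun s => w s • R s) t)
      ((hw.inv₀ fun t => (hwpos t).ne').smul (hcont _ (hy R) ⟨_, hbd R⟩)) (C₀ + ‖R‖ / 2) (hΦbd R)
  have hΨ : ContractingWith (1 / 2) Ψ := by
    refine ⟨by norm_num, LipschitzWith.of_dist_le_mul fun R S => ?_⟩
    have hd : (((1 / 2 : NNReal) : ℝ)) = 1 / 2 := by norm_num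
    rw [hd]
    refine (BoundedContinuousFunction.dist_le (by positivity)).2 fun t => ?_
    have h1 := hlip _ _ (hy R) (hy S) ⟨_, hbd R⟩ ⟨_, hbd S⟩ (dist R S) (fun t => by
      rw [← smul_sub, norm_smul, Real.norm_of_nonneg (hwpos t).le, mul_comm, ← dist_eq_norm]
      exact mul_le_mul_of_nonneg_right (BoundedContinuousFunction.dist_coe_le_dist t)
        (hwpos t).le) t
    change dist ((w t)⁻¹ • Φ (fun s => w s • R s) t) ((w t)⁻¹ • Φ (fun s => w s • S s) t) ≤ _
    rw [dist_eq_norm, ← smul_sub, norm_smul, norm_inv, Real.norm_of_nonneg (hwpos t).le,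
      inv_mul_le_iff₀ (hwpos t)]
    linarith
  obtain ⟨R, hR⟩ : ∃ R, Ψ R = R := ⟨_, hΨ.fixedPoint_isFixedPt⟩
  refine ⟨fun t => w t • R t, hy R, ⟨‖R‖, hbd R⟩, ?_⟩
  funext t
  have : (w t)⁻¹ • Φ (fun s => w s • R s) t = R t := congrArg (fun S : ℝ →ᵇ E => S t) hR
  rw [← this, smul_inv_smul₀ (ne_of_gt (hwpos t))]

/-- A linear differential equation with continuous coefficients has global solutions. -/
theorem exists_linear_solution (L : ℝ → E →L[ℝ] E) (hL : Continuous L) (t₀ : ℝ) (e₀ : E) :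
    ∃ y : ℝ → E, y t₀ = e₀ ∧ ∀ t, HasDerivAt y (L t (y t)) t := by
  -- The factor 2 makes the integral operator a 1/2-contraction for the weight cosh φ: ∫ ‖L‖ cosh φ
  -- = sinh φ / 2. Using cosh instead of exp covers both sides of t₀ with one differentiable weight.
  set φ : ℝ → ℝ := fun t => ∫ s in t₀..t, 2 * ‖L s‖ with hφ
  have hφd : ∀ t, HasDerivAt φ (2 * ‖L t‖) t := fun t =>
    (continuous_const.mul hL.norm).integral_hasStrictDerivAt t₀ t |>.hasDerivAt
  have hφc : Continuous φ := continuous_iff_continuousAt.2 fun t => (hφd t).continuousAt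
  have hwint : ∀ t, ∫ s in t₀..t, ‖L s‖ * Real.cosh (φ s) = Real.sinh (φ t) / 2 := by
    intro t
    rw [intervalIntegral.integral_eq_sub_of_hasDerivAt (f := fun t => Real.sinh (φ t) / 2)]
    · simp [hφ]
    · intro s _
      have := ((Real.hasDerivAt_sinh (φ s)).comp s (hφd s)).div_const 2
      refine this.congr_deriv ?_
      ring
    · exact (hL.norm.mul (Real.continuous_cosh.comp hφc)).intervalIntegrable _ _
  have hcosh : ∀ t, |Real.sinh (φ t)| ≤ Real.cosh (φ t) := fun t => by
    rw [abs_le]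
    constructor
    · rw [neg_le, ← Real.sinh_neg, ← Real.cosh_neg]; exact (Real.sinh_lt_cosh _).le
    · exact (Real.sinh_lt_cosh _).le
  obtain ⟨y, hyc, -, hy⟩ := exists_fixedPoint_weighted (w := fun t => Real.cosh (φ t))
    (Real.continuous_cosh.comp hφc) (fun t => Real.cosh_pos _)
    (fun y t => e₀ + ∫ s in t₀..t, L s (y s)) (fun y hy _ => by
      have : Continuous fun s => L s (y s) := hL.clm_apply hy
      exact continuous_const.add
        (continuous_iff_continuousAt.2 fun t =>
          (this.integral_hasStrictDerivAt t₀ t).hasDerivAt.continuousAt))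
    ⟨‖e₀‖, fun t => by
      simpa using le_mul_of_one_le_right (norm_nonneg _) (Real.one_le_cosh (φ t))⟩
    (by
      intro y z hy hz _ _ M hM t
      have hy' : Continuous fun s => L s (y s) := hL.clm_apply hy
      have hz' : Continuous fun s => L s (z s) := hL.clm_apply hz
      have hM0 : 0 ≤ M := by
        have := (norm_nonneg _).trans (hM t)
        exact nonneg_of_mul_nonneg_left this (Real.cosh_pos _)
      rw [add_sub_add_left_eq_sub, ← intervalIntegral.integral_sub
        (hy'.intervalIntegrable _ _) (hz'.intervalIntegrable _ _)]
      have h := intervalIntegral.norm_integral_le_abs_of_norm_le (a := t₀) (b := t) (μ := volume)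
        (f := fun s => L s (y s) - L s (z s)) (g := fun s => M * (‖L s‖ * Real.cosh (φ s)))
        (ae_of_all _ fun s => by
          rw [← map_sub]
          refine ((L s).le_opNorm _).trans ?_
          calc _ ≤ ‖L s‖ * (M * Real.cosh (φ s)) := by gcongr; exact hM s
            _ = _ := by ring)
        ((continuous_const.mul (hL.norm.mul
          (Real.continuous_cosh.comp hφc))).intervalIntegrable _ _)
      refine h.trans ?_
      rw [intervalIntegral.integral_const_mul, hwint, abs_mul, abs_of_nonneg hM0, abs_div]
      have := hcosh t
      calc _ ≤ M * (Real.cosh (φ t) / |2|) := by gcongr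
        _ = _ := by rw [abs_of_pos (by norm_num : (0 : ℝ) < 2)]; ring)
  refine ⟨y, by rw [← hy]; simp, fun t => ?_⟩
  have hy' : Continuous fun s => L s (y s) := hL.clm_apply hyc
  have := (hy'.integral_hasStrictDerivAt t₀ t).hasDerivAt.const_add e₀
  rw [← hy]
  convert this using 2
  rw [hy]

end LinearODE

/-! ### Growth of exp (tA) from the roots of an annihilating polynomial, and spectral projections.
-/

section ExpBounds

open Polynomial

/-- A solution of `f' = z f + h` grows at most like `h` if `h` grows faster than `exp (z t)`. -/
theorem norm_le_exp_of_deriv_eq {f h : ℝ → ℂ} {z : ℂ} {μ C : ℝ} (hz : z.re < μ)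
    (hf : ∀ t, HasDerivAt f (z * f t + h t) t)
    (hh : ∀ t, 0 ≤ t → ‖h t‖ ≤ C * Real.exp (μ * t)) :
    ∃ C', ∀ t, 0 ≤ t → ‖f t‖ ≤ C' * Real.exp (μ * t) := by
  set δ := μ - z.re with hδ
  have hδ0 : 0 < δ := sub_pos.2 hz
  have hC : 0 ≤ C := by simpa using (norm_nonneg _).trans (hh 0 le_rfl)
  have hnorm : ∀ t : ℝ, ‖Complex.exp (-z * t)‖ = Real.exp (-z.re * t) := fun t => by
    rw [Complex.norm_exp]; simp
  set u : ℝ → ℂ := fun t => Complex.exp (-z * t) * f t with hu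
  have hud : ∀ t : ℝ, HasDerivAt u (Complex.exp (-z * (t : ℝ)) * h t) t := fun t => by
    have h1 : HasDerivAt (fun t : ℝ => Complex.exp (-z * t)) (Complex.exp (-z * t) * -z) t := by
      have := ((hasDerivAt_id (t : ℂ)).const_mul (-z)).cexp.comp_ofReal
      simpa using this
    refine (h1.mul (hf t)).congr_deriv ?_
    ring
  -- This is a barrier for u = e^(-zt) f, whose derivative e^(-zt) h is at most C e^(δt).
  have hB : ∀ t : ℝ, HasDerivAt (fun t => ‖f 0‖ + C / δ * Real.exp (δ * t))
      (C * Real.exp (δ * t)) t := fun t => by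
    have := ((((hasDerivAt_id t).const_mul δ).exp).const_mul (C / δ)).const_add ‖f 0‖
    refine this.congr_deriv ?_
    simp only [id, mul_one]
    field_simp
  refine ⟨‖f 0‖ + C / δ, fun t ht => ?_⟩
  have key := image_norm_le_of_norm_deriv_right_le_deriv_boundary (f := u) (a := 0) (b := t)
    (fun s _ => (hud s).continuousAt.continuousWithinAt)
    (fun s _ => (hud s).hasDerivWithinAt) (B := fun t => ‖f 0‖ + C / δ * Real.exp (δ * t))
    (by simp only [hu, mul_zero, Complex.ofReal_zero, Complex.exp_zero, one_mul, Real.exp_zero,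
          mul_one]
        have : 0 ≤ C / δ := by positivity
        linarith) hB
    (fun s hs => by
      rw [norm_mul, hnorm]
      calc _ ≤ Real.exp (-z.re * s) * (C * Real.exp (μ * s)) :=
            mul_le_mul_of_nonneg_left (hh s hs.1) (Real.exp_pos _).le
        _ = C * (Real.exp (-z.re * s) * Real.exp (μ * s)) := by ring
        _ = _ := by rw [← Real.exp_add]; congr 2; rw [hδ]; ring)
    (right_mem_Icc.2 ht)
  have hfu : ‖f t‖ = Real.exp (z.re * t) * ‖u t‖ := by
    rw [hu, norm_mul, hnorm, ← mul_assoc, ← Real.exp_add]; simp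
  rw [hfu]
  calc _ ≤ Real.exp (z.re * t) * (‖f 0‖ * Real.exp (δ * t) + C / δ * Real.exp (δ * t)) := by
        gcongr
        refine key.trans ?_
        gcongr
        exact le_mul_of_one_le_right (norm_nonneg _) (Real.one_le_exp (by positivity))
    _ = (‖f 0‖ + C / δ) * (Real.exp (z.re * t) * Real.exp (δ * t)) := by ring
    _ = _ := by rw [← Real.exp_add]; congr 2; rw [hδ]; ring

/-- If multiplication by `X` acts on the family `Λ` as differentiation, an exponential bound for
`Λ t (∏ (X - z) * r)` entails one for `Λ t r`. -/
theorem exp_bound_of_prod {Λ : ℝ → ℂ[X] →ₗ[ℂ] ℂ}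
    (hΛ : ∀ q t, HasDerivAt (fun t => Λ t q) (Λ t (X * q)) t) {μ : ℝ} (m : Multiset ℂ)
    (hm : ∀ z ∈ m, z.re < μ) (r : ℂ[X])
    (h : ∃ C, ∀ t, 0 ≤ t → ‖Λ t ((m.map fun z => X - Polynomial.C z).prod * r)‖ ≤
      C * Real.exp (μ * t)) :
    ∃ C, ∀ t, 0 ≤ t → ‖Λ t r‖ ≤ C * Real.exp (μ * t) := by
  induction m using Multiset.induction_on with
  | empty => simpa using h
  | cons z m ih =>
    refine ih (fun w hw => hm w (Multiset.mem_cons_of_mem hw)) ?_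
    obtain ⟨C, hC⟩ := h
    -- Peeling off the factor X - z: since X s = z s + (X - z) s, the function Λ t s satisfies f' =
    -- z f + h with h already bounded.
    set s := (m.map fun z => X - Polynomial.C z).prod * r with hs
    refine norm_le_exp_of_deriv_eq (z := z) (C := C)
      (h := fun t => Λ t (((z ::ₘ m).map fun z => X - Polynomial.C z).prod * r))
      (hm z (Multiset.mem_cons_self z m)) (fun t => ?_) hC
    refine (hΛ s t).congr_deriv ?_
    have : ((z ::ₘ m).map fun z => X - Polynomial.C z).prod * r = X * s - z • s := by
      rw [Multiset.map_cons, Multiset.prod_cons, mul_assoc, ← hs, sub_mul, Polynomial.smul_eq_C_mul]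
    rw [this, map_sub, map_smul, smul_eq_mul]
    ring

variable {𝔸 : Type*} [NormedRing 𝔸] [NormedAlgebra ℝ 𝔸] [FiniteDimensional ℝ 𝔸]

/-- Exponential growth bound in terms of the roots of an annihilating polynomial. -/
theorem norm_exp_mul_le [CompleteSpace 𝔸] {A P : 𝔸} {p : ℝ[X]} {μ : ℝ} (hp : p ≠ 0)
    (hpA : aeval A p * P = 0) (hroots : ∀ z : ℂ, aeval z p = 0 → z.re < μ) :
    ∃ K, ∀ t : ℝ, 0 ≤ t → ‖NormedSpace.exp (t • A) * P‖ ≤ K * Real.exp (μ * t) := by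
  have hscalar : ∀ l : 𝔸 →L[ℝ] ℝ, ∃ K, ∀ t : ℝ, 0 ≤ t →
      ‖l (NormedSpace.exp (t • A) * P)‖ ≤ K * Real.exp (μ * t) := by
    intro l
    -- Λ t sends X^k to l (e^(tA) A^k P). Multiplication by X is then d/dt, and complex roots can be
    -- used without complexifying the algebra.
    set Λ : ℝ → ℂ[X] →ₗ[ℂ] ℂ := fun t => Polynomial.lsum fun k =>
      LinearMap.mulRight ℂ ((l (NormedSpace.exp (t • A) * (A ^ k * P)) : ℝ) : ℂ) with hΛ
    have hmono : ∀ t k a, Λ t (monomial k a) =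
        a * ((l (NormedSpace.exp (t • A) * (A ^ k * P)) : ℝ) : ℂ) := fun t k a => by
      rw [hΛ]; simp [Polynomial.lsum_apply, Polynomial.sum_monomial_index]
    have hd : ∀ q t, HasDerivAt (fun t => Λ t q) (Λ t (X * q)) t := by
      intro q t
      induction q using Polynomial.induction_on' with
      | add q r hq hr => simp only [mul_add, map_add]; exact hq.add hr
      | monomial k a =>
        rw [Polynomial.X_mul_monomial, hmono]
        simp only [hmono]
        have h1 := (hasDerivAt_exp_smul_const A t).mul_const (A ^ k * P)
        have h2 := (l.hasFDerivAt.comp_hasDerivAt t h1).ofReal_comp.const_mul a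
        refine h2.congr_deriv ?_
        rw [mul_assoc, ← mul_assoc A, ← pow_succ']
    have hreal : ∀ (q : ℝ[X]) t, Λ t (q.map (algebraMap ℝ ℂ)) =
        ((l (NormedSpace.exp (t • A) * (aeval A q * P)) : ℝ) : ℂ) := by
      intro q t
      induction q using Polynomial.induction_on' with
      | add q r hq hr =>
        rw [Polynomial.map_add, map_add, hq, hr]; simp [add_mul, mul_add]
      | monomial k a =>
        rw [Polynomial.map_monomial, hmono, Polynomial.aeval_monomial, mul_assoc,
          ← Algebra.smul_def (R := ℝ) (A := 𝔸), mul_smul_comm, map_smul]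
        simp
    have hmap : p.map (algebraMap ℝ ℂ) ≠ 0 := (Polynomial.map_ne_zero_iff
      (algebraMap ℝ ℂ).injective).2 hp
    -- The product over all roots times the leading coefficient is p itself, on which Λ vanishes
    -- because p(A)P = 0; the roots are peeled off down to the constant.
    obtain ⟨K, hK⟩ := exp_bound_of_prod hd (μ := μ) (p.map (algebraMap ℝ ℂ)).roots
      (fun z hz => hroots z (by
        rw [Polynomial.mem_roots hmap, Polynomial.IsRoot.def, Polynomial.eval_map_algebraMap] at hz
        exact hz))
      (Polynomial.C (p.map (algebraMap ℝ ℂ)).leadingCoeff)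
      ⟨0, fun t _ => by
        rw [mul_comm, ← (IsAlgClosed.splits (p.map (algebraMap ℝ ℂ))).eq_prod_roots, hreal, hpA]
        simp⟩
    set a := (p.map (algebraMap ℝ ℂ)).leadingCoeff with ha
    have ha0 : 0 < ‖a‖ := norm_pos_iff.2 (Polynomial.leadingCoeff_ne_zero.2 hmap)
    refine ⟨K / ‖a‖, fun t ht => ?_⟩
    have := hK t ht
    rw [← Polynomial.monomial_zero_left, hmono, norm_mul, Complex.norm_real, pow_zero, one_mul]
      at this
    rw [div_mul_eq_mul_div, le_div_iff₀ ha0]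
    linarith
  set b := Module.finBasis ℝ 𝔸
  choose K hK using fun i => hscalar (LinearMap.toContinuousLinearMap (b.coord i))
  refine ⟨∑ i, K i * ‖b i‖, fun t ht => ?_⟩
  conv_lhs => rw [← b.sum_repr (NormedSpace.exp (t • A) * P)]
  rw [Finset.sum_mul]
  refine (norm_sum_le _ _).trans (Finset.sum_le_sum fun i _ => ?_)
  rw [norm_smul]
  calc _ ≤ (K i * Real.exp (μ * t)) * ‖b i‖ := by
        gcongr
        exact hK i t ht
    _ = _ := by ring

/-- Time reversal: A becomes -A, and p(X) becomes p(-X), whose roots are the negatives. -/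
theorem norm_exp_mul_le_of_nonpos [CompleteSpace 𝔸] {A P : 𝔸} {p : ℝ[X]} {μ : ℝ} (hp : p ≠ 0)
    (hpA : aeval A p * P = 0) (hroots : ∀ z : ℂ, aeval z p = 0 → μ < z.re) :
    ∃ K, ∀ t : ℝ, t ≤ 0 → ‖NormedSpace.exp (t • A) * P‖ ≤ K * Real.exp (μ * t) := by
  obtain ⟨K, hK⟩ := norm_exp_mul_le (A := -A) (P := P) (p := p.comp (-X)) (μ := -μ)
    (by
      intro h
      apply hp
      have := congrArg (fun q : ℝ[X] => q.comp (-X)) h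
      simpa [Polynomial.comp_assoc] using this)
    (by simpa [Polynomial.aeval_comp] using hpA)
    (fun z hz => by
      have := hroots (-z) (by simpa [Polynomial.aeval_comp] using hz)
      simp at this
      linarith)
  refine ⟨K, fun t ht => ?_⟩
  have := hK (-t) (by linarith)
  simpa using this

/-- A real polynomial without roots on the line `re z = c` splits into a factor with roots to the
right and a factor with roots to the left of this line. -/
theorem exists_factorization_re {χ : ℝ[X]} {c : ℝ} (h0 : χ ≠ 0)
    (hχ : ∀ z : ℂ, aeval z χ = 0 → z.re ≠ c) :
    ∃ p q : ℝ[X], χ = p * q ∧ (∀ z : ℂ, aeval z p = 0 → c < z.re) ∧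
      ∀ z : ℂ, aeval z q = 0 → z.re < c := by
  induction χ using WfDvdMonoid.induction_on_irreducible with
  | zero => exact absurd rfl h0
  | unit u hu =>
    have hne : ∀ z : ℂ, aeval z u ≠ 0 := fun z => (hu.map (aeval z)).ne_zero
    exact ⟨u, 1, (mul_one _).symm, fun z hz => absurd hz (hne z), fun z hz => by simp at hz⟩
  | mul a i ha hi ih =>
    obtain ⟨p, q, rfl, hp, hq⟩ := ih ha fun z hz => hχ z (by simp [hz])
    -- Complex roots of an irreducible real polynomial are conjugate over ℝ, so they share their
    -- real part and lie on one side of the line.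
    have hside : (∀ z : ℂ, aeval z i = 0 → c < z.re) ∨ ∀ z : ℂ, aeval z i = 0 → z.re < c := by
      by_cases hex : ∃ z : ℂ, aeval z i = 0
      · obtain ⟨z, hz⟩ := hex
        have hre : ∀ w : ℂ, aeval w i = 0 → w.re = z.re := by
          intro w hw
          have hconj : IsConjRoot ℝ w z := by
            rw [IsConjRoot, ← minpoly.eq_of_irreducible hi hw, ← minpoly.eq_of_irreducible hi hz]
          have : IsAlgClosure ℝ ℂ := ⟨inferInstance, Algebra.IsAlgebraic.of_finite ℝ ℂ⟩
          have : Normal ℝ ℂ := IsAlgClosure.normal ℝ ℂ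
          obtain ⟨σ, hσ⟩ := isConjRoot_iff_exists_algEquiv.1 hconj
          rcases Complex.real_algHom_eq_id_or_conj σ.toAlgHom with h | h
          · have : σ z = z := congrArg (fun f : ℂ →ₐ[ℝ] ℂ => f z) h
            rw [← hσ, this]
          · have : σ z = (starRingEnd ℂ) z := congrArg (fun f : ℂ →ₐ[ℝ] ℂ => f z) h
            rw [← hσ, this, Complex.conj_re]
        rcases (hχ z (by simp [hz])).lt_or_gt with h | h
        · exact Or.inr fun w hw => by rw [hre w hw]; exact h
        · exact Or.inl fun w hw => by rw [hre w hw]; exact h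
      · exact Or.inl fun z hz => absurd ⟨z, hz⟩ hex
    rcases hside with h | h
    · refine ⟨i * p, q, by ring, fun z hz => ?_, hq⟩
      rw [map_mul, mul_eq_zero] at hz
      exact hz.elim (h z) (hp z)
    · refine ⟨p, i * q, by ring, hp, fun z hz => ?_⟩
      rw [map_mul, mul_eq_zero] at hz
      exact hz.elim (h z) (hq z)

theorem finite_complex_roots {p : ℝ[X]} (hp : p ≠ 0) : {z : ℂ | aeval z p = 0}.Finite := by
  have hmap : p.map (algebraMap ℝ ℂ) ≠ 0 := (Polynomial.map_ne_zero_iff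
      (algebraMap ℝ ℂ).injective).2 hp
  refine (Multiset.finite_toSet (p.map (algebraMap ℝ ℂ)).roots).subset fun z hz => ?_
  change z ∈ (p.map (algebraMap ℝ ℂ)).roots
  rw [Polynomial.mem_roots hmap, Polynomial.IsRoot.def, Polynomial.eval_map_algebraMap]
  exact hz

/-- Spectral splitting of an element of a finite-dimensional algebra along the line `re z = c`. -/
theorem exists_spectral_projection [CompleteSpace 𝔸] {A : 𝔸} {χ : ℝ[X]} {c : ℝ} (h0 : χ ≠ 0)
    (hA : aeval A χ = 0) (hχ : ∀ z : ℂ, aeval z χ = 0 → z.re ≠ c) :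
    ∃ (P : 𝔸) (ε₀ : ℝ), P * P = P ∧ Commute P A ∧ 0 < ε₀ ∧ ∀ ε, 0 < ε → ε < ε₀ → ∃ K,
      (∀ t : ℝ, t ≤ 0 → ‖NormedSpace.exp (t • A) * P‖ ≤ K * Real.exp ((c + ε) * t)) ∧
      (∀ t : ℝ, 0 ≤ t → ‖NormedSpace.exp (t • A) * (1 - P)‖ ≤ K * Real.exp ((c - ε) * t)) := by
  obtain ⟨p, q, hpq, hp, hq⟩ := exists_factorization_re h0 hχ
  have hp0 : p ≠ 0 := fun h => h0 (by rw [hpq, h, zero_mul])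
  have hq0 : q ≠ 0 := fun h => h0 (by rw [hpq, h, mul_zero])
  have hcop : IsCoprime p q := by
    rw [Polynomial.isCoprime_iff_aeval_ne_zero_of_isAlgClosed ℝ ℂ]
    intro z
    by_contra! h
    exact lt_asymm (hp z h.1) (hq z h.2)
  -- From u p + v q = 1, the projection is (v q)(A). It is annihilated by p(A), and its complement
  -- (u p)(A) by q(A), so each part sees only the roots of one factor.
  obtain ⟨u, v, huv⟩ := hcop
  have hpqA : aeval A p * aeval A q = 0 := by rw [← map_mul, ← hpq, hA]
  have hPp : aeval A p * aeval A (v * q) = 0 := by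
    rw [mul_comm v q, map_mul, ← mul_assoc, hpqA, zero_mul]
  have h1P : 1 - aeval A (v * q) = aeval A (u * p) := by
    rw [sub_eq_iff_eq_add, ← map_add, huv, map_one]
  have hPq : aeval A q * (1 - aeval A (v * q)) = 0 := by
    rw [h1P, mul_comm u p, map_mul, ← mul_assoc, ← map_mul, mul_comm q p, map_mul, hpqA, zero_mul]
  -- As there are finitely many roots, every small ε fits between the line and the spectrum on both
  -- sides.
  have hev : ∀ᶠ ε in 𝓝[>] (0 : ℝ), (∀ z ∈ {z : ℂ | aeval z p = 0}, c + ε < z.re) ∧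
      ∀ z ∈ {z : ℂ | aeval z q = 0}, z.re < c - ε := by
    refine Filter.Eventually.and ?_ ?_
    · rw [Filter.eventually_all_finite (finite_complex_roots hp0)]
      intro z hz
      have : ∀ᶠ ε in 𝓝 (0 : ℝ), c + ε < z.re :=
        (continuous_const.add continuous_id).continuousAt.eventually_lt continuousAt_const
          (by simpa using hp z hz)
      exact this.filter_mono nhdsWithin_le_nhds
    · rw [Filter.eventually_all_finite (finite_complex_roots hq0)]
      intro z hz
      have : ∀ᶠ ε in 𝓝 (0 : ℝ), z.re < c - ε :=
        continuousAt_const.eventually_lt (continuous_const.sub continuous_id).continuousAt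
          (by simpa using hq z hz)
      exact this.filter_mono nhdsWithin_le_nhds
  obtain ⟨ε₀, hε₀, hsub⟩ := mem_nhdsGT_iff_exists_Ioo_subset.1 hev
  refine ⟨aeval A (v * q), ε₀, ?_, ?_, hε₀, fun ε hε hεε => ?_⟩
  · have : aeval A (v * q) * (1 - aeval A (v * q)) = 0 := by
      rw [map_mul, mul_assoc, ← map_mul, hPq, mul_zero]
    rwa [mul_sub, mul_one, sub_eq_zero, eq_comm] at this
  · have : Commute (aeval A (v * q)) (aeval A (X : ℝ[X])) := by
      unfold Commute SemiconjBy
      rw [← map_mul, ← map_mul, mul_comm]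
    rwa [Polynomial.aeval_X] at this
  · obtain ⟨h1, h2⟩ := hsub ⟨hε, hεε⟩
    obtain ⟨K₁, hK₁⟩ := norm_exp_mul_le_of_nonpos hp0 hPp h1
    obtain ⟨K₂, hK₂⟩ := norm_exp_mul_le hq0 hPq h2
    refine ⟨max K₁ K₂, fun t ht => (hK₁ t ht).trans ?_, fun t ht => (hK₂ t ht).trans ?_⟩
    · gcongr; exact le_max_left _ _
    · gcongr; exact le_max_right _ _

end ExpBounds

/-! ### The one-parameter group exp (tA). -/

section ExpGroup

variable {𝔸 : Type*} [NormedRing 𝔸] [NormedAlgebra ℝ 𝔸] [CompleteSpace 𝔸]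

theorem exp_smul_mul_exp_smul (A : 𝔸) (s t : ℝ) :
    NormedSpace.exp (s • A) * NormedSpace.exp (t • A) = NormedSpace.exp ((s + t) • A) := by
  let _ := NormedAlgebra.restrictScalars ℚ ℝ 𝔸
  rw [add_smul, NormedSpace.exp_add_of_commute]
  exact ((Commute.refl A).smul_left s).smul_right t

theorem exp_smul_mul_exp_neg_smul (A : 𝔸) (t : ℝ) :
    NormedSpace.exp (t • A) * NormedSpace.exp (-t • A) = 1 := by
  rw [exp_smul_mul_exp_smul, add_neg_cancel, zero_smul, NormedSpace.exp_zero]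

theorem exp_neg_smul_mul_exp_smul (A : 𝔸) (t : ℝ) :
    NormedSpace.exp (-t • A) * NormedSpace.exp (t • A) = 1 := by
  rw [exp_smul_mul_exp_smul, neg_add_cancel, zero_smul, NormedSpace.exp_zero]

theorem continuous_exp_smul (A : 𝔸) : Continuous fun t : ℝ => NormedSpace.exp (t • A) :=
  continuous_iff_continuousAt.2 fun t => (hasDerivAt_exp_smul_const A t).continuousAt

end ExpGroup

/-! ### Hyperbolic constant-coefficient systems in the weight exp (ct), and small perturbations of
them. -/

section Hyperbolic

variable {E : Type*} [NormedAddCommGroup E] [NormedSpace ℝ E] [CompleteSpace E]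

theorem hasDerivAt_integral_Iic {φ : ℝ → E} (hφ : Continuous φ)
    (hInt : ∀ t, IntegrableOn φ (Iic t)) (t : ℝ) :
    HasDerivAt (fun t => ∫ s in Iic t, φ s) (φ t) t := by
  have h : (fun t => ∫ s in Iic t, φ s) = fun t => (∫ s in Iic 0, φ s) + ∫ s in (0 : ℝ)..t, φ s := by
    funext t
    rw [← intervalIntegral.integral_Iic_sub_Iic (hInt 0) (hInt t)]
    abel
  rw [h]
  exact (hφ.integral_hasStrictDerivAt 0 t).hasDerivAt.const_add _

theorem hasDerivAt_integral_Ioi {φ : ℝ → E} (hφ : Continuous φ)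
    (hInt : ∀ t, IntegrableOn φ (Ioi t)) (t : ℝ) :
    HasDerivAt (fun t => ∫ s in Ioi t, φ s) (-φ t) t := by
  have h : (fun t => ∫ s in Ioi t, φ s) = fun t => (∫ s in Ioi 0, φ s) - ∫ s in (0 : ℝ)..t, φ s := by
    funext t
    rw [← intervalIntegral.integral_Ioi_sub_Ioi' (hInt 0) (hInt t)]
    abel
  rw [h]
  exact (hφ.integral_hasStrictDerivAt 0 t).hasDerivAt.const_sub _

variable {𝒜 P : E →L[ℝ] E} {c ε K : ℝ}

/-- The solution of `y' = 𝒜 y + f` that grows no faster than `exp (c t)`. -/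
noncomputable def hyperbolicSolution (𝒜 P : E →L[ℝ] E) (f : ℝ → E) (t : ℝ) : E :=
  NormedSpace.exp (t • 𝒜) ((∫ s in Iic t, NormedSpace.exp (-s • 𝒜) ((1 - P) (f s))) -
    ∫ s in Ioi t, NormedSpace.exp (-s • 𝒜) (P (f s)))

/-- The gap ε is what makes the history integrable: e^((c-ε)(t-s)) e^(cs) = e^((c-ε)t) e^(εs) decays
as s → -∞. The companion for `P` is the mirror image at s → +∞. -/
theorem norm_hyperbolic_left_le
    (h₂ : ∀ t : ℝ, 0 ≤ t → ‖NormedSpace.exp (t • 𝒜) * (1 - P)‖ ≤ K * Real.exp ((c - ε) * t))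
    {f : ℝ → E} {M : ℝ} (hf : ∀ t, ‖f t‖ ≤ M * Real.exp (c * t)) {s t : ℝ} (hst : s ≤ t) :
    ‖NormedSpace.exp (t • 𝒜) (NormedSpace.exp (-s • 𝒜) ((1 - P) (f s)))‖ ≤
      K * M * Real.exp ((c - ε) * t) * Real.exp (ε * s) := by
  have h1 : NormedSpace.exp (t • 𝒜) (NormedSpace.exp (-s • 𝒜) ((1 - P) (f s))) =
      (NormedSpace.exp ((t - s) • 𝒜) * (1 - P)) (f s) := by
    rw [sub_eq_add_neg t s]
    exact congrArg (fun T : E →L[ℝ] E => T ((1 - P) (f s))) (exp_smul_mul_exp_smul 𝒜 t (-s))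
  rw [h1]
  refine (ContinuousLinearMap.le_opNorm _ _).trans ?_
  calc _ ≤ (K * Real.exp ((c - ε) * (t - s))) * (M * Real.exp (c * s)) :=
        mul_le_mul (h₂ _ (sub_nonneg.2 hst)) (hf s) (norm_nonneg _)
          ((norm_nonneg _).trans (h₂ _ (sub_nonneg.2 hst)))
    _ = K * M * (Real.exp ((c - ε) * (t - s)) * Real.exp (c * s)) := by ring
    _ = K * M * (Real.exp ((c - ε) * t) * Real.exp (ε * s)) := by
        rw [← Real.exp_add, ← Real.exp_add]; congr 2; ring
    _ = _ := by ring

theorem norm_hyperbolic_right_le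
    (h₁ : ∀ t : ℝ, t ≤ 0 → ‖NormedSpace.exp (t • 𝒜) * P‖ ≤ K * Real.exp ((c + ε) * t))
    {f : ℝ → E} {M : ℝ} (hf : ∀ t, ‖f t‖ ≤ M * Real.exp (c * t)) {s t : ℝ} (hst : t ≤ s) :
    ‖NormedSpace.exp (t • 𝒜) (NormedSpace.exp (-s • 𝒜) (P (f s)))‖ ≤
      K * M * Real.exp ((c + ε) * t) * Real.exp (-ε * s) := by
  have h1 : NormedSpace.exp (t • 𝒜) (NormedSpace.exp (-s • 𝒜) (P (f s))) =
      (NormedSpace.exp ((t - s) • 𝒜) * P) (f s) := by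
    rw [sub_eq_add_neg t s]
    exact congrArg (fun T : E →L[ℝ] E => T (P (f s))) (exp_smul_mul_exp_smul 𝒜 t (-s))
  rw [h1]
  refine (ContinuousLinearMap.le_opNorm _ _).trans ?_
  calc _ ≤ (K * Real.exp ((c + ε) * (t - s))) * (M * Real.exp (c * s)) :=
        mul_le_mul (h₁ _ (sub_nonpos.2 hst)) (hf s) (norm_nonneg _)
          ((norm_nonneg _).trans (h₁ _ (sub_nonpos.2 hst)))
    _ = K * M * (Real.exp ((c + ε) * (t - s)) * Real.exp (c * s)) := by ring
    _ = K * M * (Real.exp ((c + ε) * t) * Real.exp (-ε * s)) := by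
        rw [← Real.exp_add, ← Real.exp_add]; congr 2; ring
    _ = _ := by ring

theorem continuous_exp_neg_smul_apply (Q : E →L[ℝ] E) {f : ℝ → E} (hfc : Continuous f) :
    Continuous fun s : ℝ => NormedSpace.exp (-s • 𝒜) (Q (f s)) :=
  ((continuous_exp_smul 𝒜).comp continuous_neg).clm_apply (Q.continuous.comp hfc)

theorem exp_neg_smul_apply_exp_smul_apply (t : ℝ) (v : E) :
    NormedSpace.exp (-t • 𝒜) (NormedSpace.exp (t • 𝒜) v) = v := by
  have := congrArg (fun T : E →L[ℝ] E => T v) (exp_neg_smul_mul_exp_smul 𝒜 t)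
  simpa using this

theorem exp_smul_apply_exp_neg_smul_apply (t : ℝ) (v : E) :
    NormedSpace.exp (t • 𝒜) (NormedSpace.exp (-t • 𝒜) v) = v := by
  have := congrArg (fun T : E →L[ℝ] E => T v) (exp_smul_mul_exp_neg_smul 𝒜 t)
  simpa using this

theorem integrableOn_hyperbolic_left (hε : 0 < ε)
    (h₂ : ∀ t : ℝ, 0 ≤ t → ‖NormedSpace.exp (t • 𝒜) * (1 - P)‖ ≤ K * Real.exp ((c - ε) * t))
    {f : ℝ → E} (hfc : Continuous f) {M : ℝ} (hf : ∀ t, ‖f t‖ ≤ M * Real.exp (c * t)) (t : ℝ) :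
    IntegrableOn (fun s : ℝ => NormedSpace.exp (-s • 𝒜) ((1 - P) (f s))) (Iic t) := by
  refine Integrable.mono' (((integrableOn_exp_mul_Iic hε t).const_mul
    (K * M * Real.exp ((c - ε) * t))).const_mul ‖NormedSpace.exp (-t • 𝒜)‖)
    (continuous_exp_neg_smul_apply _ hfc).aestronglyMeasurable ?_
  refine (ae_restrict_iff' measurableSet_Iic).2 (ae_of_all _ fun s hs => ?_)
  -- Inserting e^(-t𝒜) e^(t𝒜) reduces integrability to the kernel bound, at the price of a constant
  -- depending on t.
  rw [← exp_neg_smul_apply_exp_smul_apply (𝒜 := 𝒜) t (NormedSpace.exp (-s • 𝒜) ((1 - P) (f s)))]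
  refine (ContinuousLinearMap.le_opNorm _ _).trans ?_
  gcongr
  exact norm_hyperbolic_left_le h₂ hf hs

theorem integrableOn_hyperbolic_right (hε : 0 < ε)
    (h₁ : ∀ t : ℝ, t ≤ 0 → ‖NormedSpace.exp (t • 𝒜) * P‖ ≤ K * Real.exp ((c + ε) * t))
    {f : ℝ → E} (hfc : Continuous f) {M : ℝ} (hf : ∀ t, ‖f t‖ ≤ M * Real.exp (c * t)) (t : ℝ) :
    IntegrableOn (fun s : ℝ => NormedSpace.exp (-s • 𝒜) (P (f s))) (Ioi t) := by
  refine Integrable.mono' (((integrableOn_exp_mul_Ioi (neg_lt_zero.2 hε) t).const_mul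
    (K * M * Real.exp ((c + ε) * t))).const_mul ‖NormedSpace.exp (-t • 𝒜)‖)
    (continuous_exp_neg_smul_apply _ hfc).aestronglyMeasurable ?_
  refine (ae_restrict_iff' measurableSet_Ioi).2 (ae_of_all _ fun s hs => ?_)
  rw [← exp_neg_smul_apply_exp_smul_apply (𝒜 := 𝒜) t (NormedSpace.exp (-s • 𝒜) (P (f s)))]
  refine (ContinuousLinearMap.le_opNorm _ _).trans ?_
  gcongr
  exact norm_hyperbolic_right_le h₁ hf (le_of_lt hs)

/-- Each of the two integrals contributes K/ε. Having the constant explicit tells how small a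
perturbation must be for the fixed point argument. -/
theorem norm_hyperbolicSolution_le (hε : 0 < ε)
    (h₁ : ∀ t : ℝ, t ≤ 0 → ‖NormedSpace.exp (t • 𝒜) * P‖ ≤ K * Real.exp ((c + ε) * t))
    (h₂ : ∀ t : ℝ, 0 ≤ t → ‖NormedSpace.exp (t • 𝒜) * (1 - P)‖ ≤ K * Real.exp ((c - ε) * t))
    {f : ℝ → E} (hfc : Continuous f) {M : ℝ} (hf : ∀ t, ‖f t‖ ≤ M * Real.exp (c * t)) (t : ℝ) :
    ‖hyperbolicSolution 𝒜 P f t‖ ≤ 2 * K / ε * M * Real.exp (c * t) := by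
  rw [hyperbolicSolution, map_sub,
    ← ContinuousLinearMap.integral_comp_comm _ (integrableOn_hyperbolic_left hε h₂ hfc hf t),
    ← ContinuousLinearMap.integral_comp_comm _ (integrableOn_hyperbolic_right hε h₁ hfc hf t)]
  refine (norm_sub_le _ _).trans ?_
  have e1 := norm_integral_le_of_norm_le ((integrableOn_exp_mul_Iic hε t).const_mul
    (K * M * Real.exp ((c - ε) * t))) ((ae_restrict_iff' measurableSet_Iic).2
      (ae_of_all _ fun s hs => norm_hyperbolic_left_le h₂ hf hs))
  have e2 := norm_integral_le_of_norm_le ((integrableOn_exp_mul_Ioi (neg_lt_zero.2 hε) t).const_mul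
    (K * M * Real.exp ((c + ε) * t))) ((ae_restrict_iff' measurableSet_Ioi).2
      (ae_of_all _ fun s hs => norm_hyperbolic_right_le h₁ hf (le_of_lt hs)))
  rw [integral_const_mul, integral_exp_mul_Iic hε] at e1
  rw [integral_const_mul, integral_exp_mul_Ioi (neg_lt_zero.2 hε)] at e2
  have e3 : K * M * Real.exp ((c - ε) * t) * (Real.exp (ε * t) / ε) =
      K / ε * M * Real.exp (c * t) := by
    have : Real.exp (c * t) = Real.exp ((c - ε) * t) * Real.exp (ε * t) := by
      rw [← Real.exp_add]; congr 1; ring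
    rw [this]; ring
  have e4 : K * M * Real.exp ((c + ε) * t) * (-Real.exp (-ε * t) / -ε) =
      K / ε * M * Real.exp (c * t) := by
    have : Real.exp (c * t) = Real.exp ((c + ε) * t) * Real.exp (-ε * t) := by
      rw [← Real.exp_add]; congr 1; ring
    rw [this, neg_div_neg_eq]; ring
  rw [e3] at e1
  rw [e4] at e2
  calc _ ≤ K / ε * M * Real.exp (c * t) + K / ε * M * Real.exp (c * t) := add_le_add e1 e2
    _ = _ := by ring

theorem hasDerivAt_hyperbolicSolution (hε : 0 < ε)
    (h₁ : ∀ t : ℝ, t ≤ 0 → ‖NormedSpace.exp (t • 𝒜) * P‖ ≤ K * Real.exp ((c + ε) * t))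
    (h₂ : ∀ t : ℝ, 0 ≤ t → ‖NormedSpace.exp (t • 𝒜) * (1 - P)‖ ≤ K * Real.exp ((c - ε) * t))
    {f : ℝ → E} (hfc : Continuous f) {M : ℝ} (hf : ∀ t, ‖f t‖ ≤ M * Real.exp (c * t)) (t : ℝ) :
    HasDerivAt (hyperbolicSolution 𝒜 P f) (𝒜 (hyperbolicSolution 𝒜 P f t) + f t) t := by
  have d1 := hasDerivAt_integral_Iic (continuous_exp_neg_smul_apply (𝒜 := 𝒜) (1 - P) hfc)
    (integrableOn_hyperbolic_left hε h₂ hfc hf) t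
  have d2 := hasDerivAt_integral_Ioi (continuous_exp_neg_smul_apply (𝒜 := 𝒜) P hfc)
    (integrableOn_hyperbolic_right hε h₁ hfc hf) t
  have d3 := (hasDerivAt_exp_smul_const' 𝒜 t).clm_apply (d1.sub d2)
  refine d3.congr_deriv ?_
  have : NormedSpace.exp (-t • 𝒜) ((1 - P) (f t)) - -NormedSpace.exp (-t • 𝒜) (P (f t)) =
      NormedSpace.exp (-t • 𝒜) (f t) := by
    simp
  rw [this, exp_smul_apply_exp_neg_smul_apply]
  rfl

/-- A small perturbation of a hyperbolic system has a solution controlled by `exp (c t)`. -/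
theorem exists_solution_perturbed (hε : 0 < ε)
    (h₁ : ∀ t : ℝ, t ≤ 0 → ‖NormedSpace.exp (t • 𝒜) * P‖ ≤ K * Real.exp ((c + ε) * t))
    (h₂ : ∀ t : ℝ, 0 ≤ t → ‖NormedSpace.exp (t • 𝒜) * (1 - P)‖ ≤ K * Real.exp ((c - ε) * t))
    {β : ℝ → E →L[ℝ] E} (hβ : Continuous β) {b : ℝ} (hb : ∀ t, ‖β t‖ ≤ b)
    (hsmall : 2 * K / ε * b ≤ 1 / 2) {h : ℝ → E} (hh : Continuous h) {C : ℝ}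
    (hC : ∀ t, ‖h t‖ ≤ C * Real.exp (c * t)) :
    ∃ y : ℝ → E, (∃ C', ∀ t, ‖y t‖ ≤ C' * Real.exp (c * t)) ∧
      ∀ t, HasDerivAt y (𝒜 (y t) + (β t (y t) + h t)) t := by
  have hfc : ∀ y : ℝ → E, Continuous y → Continuous fun s => β s (y s) + h s :=
    fun y hy => (hβ.clm_apply hy).add hh
  have hfb : ∀ y : ℝ → E, (∃ C, ∀ t, ‖y t‖ ≤ C * Real.exp (c * t)) →
      ∃ M, ∀ t, ‖β t (y t) + h t‖ ≤ M * Real.exp (c * t) := by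
    rintro y ⟨C', hC'⟩
    refine ⟨b * C' + C, fun t => (norm_add_le _ _).trans ?_⟩
    rw [add_mul, mul_assoc]
    refine add_le_add (((β t).le_opNorm _).trans ?_) (hC t)
    exact mul_le_mul (hb t) (hC' t) (norm_nonneg _) ((norm_nonneg _).trans (hb t))
  obtain ⟨y, hyc, hyb, hy⟩ := exists_fixedPoint_weighted (w := fun t => Real.exp (c * t))
    (by fun_prop) (fun t => Real.exp_pos _)
    (fun y => hyperbolicSolution 𝒜 P fun s => β s (y s) + h s)
    (fun y hy hyb => by
      obtain ⟨M, hM⟩ := hfb y hyb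
      exact continuous_iff_continuousAt.2 fun t =>
        (hasDerivAt_hyperbolicSolution hε h₁ h₂ (hfc y hy) hM t).continuousAt)
    (by
      obtain ⟨M, hM⟩ := hfb 0 ⟨0, by simp⟩
      exact ⟨_, norm_hyperbolicSolution_le hε h₁ h₂ (hfc 0 continuous_const) hM⟩)
    (by
      intro y z hy hz hyb hzb M hM t
      obtain ⟨M₁, hM₁⟩ := hfb y hyb
      obtain ⟨M₂, hM₂⟩ := hfb z hzb
      have hM0 : 0 ≤ M := by
        have := (norm_nonneg _).trans (hM t)
        exact nonneg_of_mul_nonneg_left this (Real.exp_pos _)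
      have hdiff : hyperbolicSolution 𝒜 P (fun s => β s (y s) + h s) t -
          hyperbolicSolution 𝒜 P (fun s => β s (z s) + h s) t =
          hyperbolicSolution 𝒜 P (fun s => β s (y s - z s)) t := by
        simp only [hyperbolicSolution]
        rw [← map_sub, sub_sub_sub_comm,
          ← integral_sub (integrableOn_hyperbolic_left hε h₂ (hfc y hy) hM₁ t)
            (integrableOn_hyperbolic_left hε h₂ (hfc z hz) hM₂ t),
          ← integral_sub (integrableOn_hyperbolic_right hε h₁ (hfc y hy) hM₁ t)
            (integrableOn_hyperbolic_right hε h₁ (hfc z hz) hM₂ t)]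
        simp only [← map_sub, add_sub_add_right_eq_sub]
      rw [hdiff]
      refine (norm_hyperbolicSolution_le hε h₁ h₂ (M := b * M) (hβ.clm_apply (hy.sub hz))
        (fun s => ?_) t).trans ?_
      · refine ((β s).le_opNorm _).trans ?_
        rw [mul_assoc]
        exact mul_le_mul (hb s) (hM s) (norm_nonneg _) ((norm_nonneg _).trans (hb s))
      · have := mul_le_mul_of_nonneg_right hsmall hM0
        refine mul_le_mul_of_nonneg_right ?_ (Real.exp_pos _).le
        linarith)
  obtain ⟨M, hM⟩ := hfb y hyb
  refine ⟨y, hyb, fun t => ?_⟩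
  have := hasDerivAt_hyperbolicSolution hε h₁ h₂ (hfc y hyc) hM t
  rwa [show hyperbolicSolution 𝒜 P (fun s => β s (y s) + h s) = y from hy] at this

end Hyperbolic

/-! ### Conjugating the singular system near zero to y' = A y. -/

section Conjugation

variable {V : Type*} [NormedAddCommGroup V] [NormedSpace ℝ V] [FiniteDimensional ℝ V]

theorem aeval_charpoly_clm (T : V →L[ℝ] V) :
    Polynomial.aeval T (T : V →ₗ[ℝ] V).charpoly = 0 := by
  have h : ∀ p : Polynomial ℝ, ((Polynomial.aeval T p : V →L[ℝ] V) : V →ₗ[ℝ] V) =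
      Polynomial.aeval (T : V →ₗ[ℝ] V) p := by
    intro p
    induction p using Polynomial.induction_on' with
    | add p q hp hq => simp [hp, hq]
    | monomial k a =>
      rw [Polynomial.aeval_monomial, Polynomial.aeval_monomial, ← Algebra.smul_def,
        ← Algebra.smul_def]
      simp
  apply ContinuousLinearMap.coe_injective
  rw [h, LinearMap.aeval_self_charpoly]
  rfl

variable {𝔸 : Type*} [NormedRing 𝔸] [NormedAlgebra ℝ 𝔸] [FiniteDimensional ℝ 𝔸] [CompleteSpace 𝔸]

/-- The system `y' = (A / x + B(x)) y`, in the variable `t = log x`, is conjugate near `t = -∞` to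
`y' = A y` by a transformation tending to the identity. -/
theorem exists_conjugation (A : 𝔸) (B : ℝ → 𝔸) (hBcont : ContinuousOn B (Ici 0))
    (hBbdd : ∃ C : ℝ, ∀ x : ℝ, 0 ≤ x → ‖B x‖ ≤ C) :
    ∃ (τ : ℝ) (T : ℝ → 𝔸), Tendsto T atBot (𝓝 1) ∧
      ∀ t < τ, HasDerivAt T (A * T t - T t * A + Real.exp t • (B (Real.exp t) * T t)) t := by
  obtain ⟨C, hC⟩ := hBbdd
  have hC0 : 0 ≤ C := (norm_nonneg _).trans (hC 0 le_rfl)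
  -- The conjugation solves T' = [A, T] + e^t B T, a linear system with constant part the commutator
  -- with A. With T = 1 + R and [A, 1] = 0, the correction satisfies R' = 𝒜 R + b R + b.
  set 𝒜 : 𝔸 →L[ℝ] 𝔸 :=
    ContinuousLinearMap.mul ℝ 𝔸 A - (ContinuousLinearMap.mul ℝ 𝔸).flip A
    with h𝒜
  have h𝒜apply : ∀ S, 𝒜 S = A * S - S * A := fun S => rfl
  have hχ0 : (𝒜 : 𝔸 →ₗ[ℝ] 𝔸).charpoly ≠ 0 :=
    (LinearMap.charpoly_monic _).ne_zero
  -- The line Re z = c must avoid the spectrum of 𝒜. The condition c > 0 forces R → 0 at -∞, and c <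
  -- 1 keeps the forcing e^t B within O(e^(ct)).
  obtain ⟨c, hc, hcr⟩ := (Ioo_infinite (zero_lt_one (α := ℝ))).exists_notMem_finite
    ((finite_complex_roots hχ0).image Complex.re)
  obtain ⟨P, ε₀, -, -, hε₀, hP⟩ := exists_spectral_projection (A := 𝒜) (c := c) hχ0
    (aeval_charpoly_clm 𝒜) (fun z hz h => hcr ⟨z, hz, h⟩)
  obtain ⟨K, h₁, h₂⟩ := hP (ε₀ / 2) (half_pos hε₀) (half_lt_self hε₀)
  have hK : 0 ≤ K := by simpa using (norm_nonneg _).trans (h₁ 0 le_rfl)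
  set ε := ε₀ / 2
  have hε : 0 < ε := half_pos hε₀
  obtain ⟨τ, hτ⟩ : ∃ τ : ℝ, 2 * K / ε * (C * Real.exp τ) ≤ 1 / 2 := by
    have : Tendsto (fun τ => 2 * K / ε * (C * Real.exp τ)) atBot (𝓝 (2 * K / ε * (C * 0))) :=
      (Real.tendsto_exp_atBot.const_mul C).const_mul _
    rw [mul_zero, mul_zero] at this
    exact ((this.eventually (gt_mem_nhds (by norm_num : (0 : ℝ) < 1 / 2))).exists).imp
      fun τ h => le_of_lt h
  -- The coefficient is frozen beyond τ, where τ is so negative that the perturbation is globally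
  -- small; the true equation holds for t < τ only.
  set b : ℝ → 𝔸 := fun t => Real.exp (min t τ) • B (Real.exp (min t τ)) with hb
  have hmin : Continuous fun t : ℝ => Real.exp (min t τ) := by fun_prop
  have hbc : Continuous b := hmin.smul
    (hBcont.comp_continuous hmin fun t => (Real.exp_pos _).le)
  have hbn : ∀ t, ‖b t‖ ≤ C * Real.exp (min t τ) := fun t => by
    rw [hb, norm_smul, Real.norm_of_nonneg (Real.exp_pos _).le, mul_comm]
    exact mul_le_mul_of_nonneg_right (hC _ (Real.exp_pos _).le) (Real.exp_pos _).le
  obtain ⟨R, ⟨C', hR⟩, hRd⟩ := exists_solution_perturbed (β := fun t =>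
      ContinuousLinearMap.mul ℝ 𝔸 (b t)) (b := C * Real.exp τ) (h := b)
      (C := C * Real.exp ((1 - c) * τ)) hε h₁ h₂
    ((ContinuousLinearMap.mul ℝ 𝔸).continuous.comp hbc)
    (fun t => by
      refine (ContinuousLinearMap.opNorm_mul_apply_le ℝ _ _).trans ((hbn t).trans ?_)
      gcongr
      exact min_le_right _ _)
    hτ hbc
    (fun t => by
      refine (hbn t).trans ?_
      rw [mul_assoc, ← Real.exp_add]
      gcongr
      rcases le_total t τ with h | h
      · rw [min_eq_left h]; nlinarith [hc.2]
      · rw [min_eq_right h]; nlinarith [hc.1])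
  refine ⟨τ, fun t => 1 + R t, ?_, fun t ht => ?_⟩
  · have h0 : Tendsto R atBot (𝓝 0) := by
      refine squeeze_zero_norm hR ?_
      have : Tendsto (fun t => C' * Real.exp (c * t)) atBot (𝓝 (C' * 0)) :=
        (Real.tendsto_exp_atBot.comp (tendsto_id.const_mul_atBot hc.1)).const_mul C'
      simpa using this
    simpa using h0.const_add 1
  · refine ((hRd t).const_add 1).congr_deriv ?_
    have hbt : b t = Real.exp t • B (Real.exp t) := by
      simp only [hb, min_eq_left ht.le]
    rw [h𝒜apply, ContinuousLinearMap.mul_apply', hbt, smul_mul_assoc, mul_add, mul_one, add_mul,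
      one_mul, mul_add, mul_one, smul_add]
    abel

end Conjugation

/-! ### Constancy and boundedness on half-open intervals. -/

section Calculus

variable {E : Type*} [NormedAddCommGroup E] [NormedSpace ℝ E]

theorem eq_of_hasDerivAt_zero {f : ℝ → E} {b : ℝ} (hf : ∀ x, 0 < x → x < b → HasDerivAt f 0 x)
    {x y : ℝ} (hx : 0 < x) (hxb : x < b) (hy : 0 < y) (hyb : y < b) : f x = f y := by
  have := (convex_Ioo (0 : ℝ) b).norm_image_sub_le_of_norm_hasDerivWithin_le (f := f)
    (f' := fun _ => 0) (C := 0) (fun z hz => (hf z hz.1 hz.2).hasDerivWithinAt) (by simp)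
    (x := y) (y := x) ⟨hy, hyb⟩ ⟨hx, hxb⟩
  rw [zero_mul, norm_le_zero_iff, sub_eq_zero] at this
  exact this

theorem exists_bound_Ioc {f : ℝ → E} {l : E} (hf : ContinuousOn f (Ioi 0))
    (hl : Tendsto f (𝓝[>] 0) (𝓝 l)) (b : ℝ) : ∃ K, ∀ x, 0 < x → x ≤ b → ‖f x‖ ≤ K := by
  have h1 : ∀ᶠ x in 𝓝[>] (0 : ℝ), ‖f x‖ < ‖l‖ + 1 :=
    hl.norm.eventually (gt_mem_nhds (lt_add_one _))
  obtain ⟨δ, hδ, hsub⟩ := mem_nhdsGT_iff_exists_Ioo_subset.1 h1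
  have hδ' : 0 < δ := hδ
  obtain ⟨K, hK⟩ := isCompact_Icc.exists_bound_of_continuousOn
    (hf.mono (fun x (hx : x ∈ Icc (δ / 2) b) => lt_of_lt_of_le (by positivity) hx.1))
  refine ⟨max (‖l‖ + 1) K, fun x hx hxb => ?_⟩
  rcases lt_or_ge x δ with h | h
  · exact (le_of_lt (hsub ⟨hx, h⟩)).trans (le_max_left _ _)
  · exact (hK x ⟨by linarith, hxb⟩).trans (le_max_right _ _)

theorem exists_bound_Ici {f : ℝ → E} {l : E} {b : ℝ} (hf : ContinuousOn f (Ici b))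
    (hl : Tendsto f atTop (𝓝 l)) : ∃ K, ∀ x, b ≤ x → ‖f x‖ ≤ K := by
  have h1 : ∀ᶠ x in atTop, ‖f x‖ < ‖l‖ + 1 := hl.norm.eventually (gt_mem_nhds (lt_add_one _))
  obtain ⟨R, hR⟩ := eventually_atTop.1 h1
  obtain ⟨K, hK⟩ := isCompact_Icc.exists_bound_of_continuousOn
    (hf.mono (fun x (hx : x ∈ Icc b R) => hx.1))
  refine ⟨max (‖l‖ + 1) K, fun x hx => ?_⟩
  rcases le_total R x with h | h
  · exact (hR x h).le.trans (le_max_left _ _)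
  · exact (hK x ⟨hx, h⟩).trans (le_max_right _ _)

end Calculus

/-! ### The evolution operator, its inverse, and variation of constants. -/

section Evolution

variable {V : Type*} [NormedAddCommGroup V] [InnerProductSpace ℝ V] [FiniteDimensional ℝ V]
  {A : V →L[ℝ] V} {B : ℝ → V →L[ℝ] V} {x₀ : ℝ}

theorem mul_eq_one_symm {S T : V →L[ℝ] V} (h : S * T = 1) : T * S = 1 := by
  have h1 : (S : V →ₗ[ℝ] V) * (T : V →ₗ[ℝ] V) = 1 :=
    congrArg (fun R : V →L[ℝ] V => (R : V →ₗ[ℝ] V)) h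
  have h2 := mul_eq_one_comm.1 h1
  exact ContinuousLinearMap.coe_injective h2

/-- In the variable t = log x the singularity disappears: the coefficient is continuous on the whole
line, so the global existence theorem applies. -/
theorem continuous_log_coeff (hB : ContinuousOn B (Ici 0)) :
    Continuous fun t : ℝ => A + Real.exp t • B (Real.exp t) :=
  continuous_const.add (Real.continuous_exp.smul
    (hB.comp_continuous Real.continuous_exp fun _ => (Real.exp_pos _).le))

theorem inv_smul_log_coeff {x : ℝ} (hx : 0 < x) :
    x⁻¹ • (A + Real.exp (Real.log x) • B (Real.exp (Real.log x))) = coeff A B x := by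
  rw [Real.exp_log hx, smul_add, inv_smul_smul₀ hx.ne', coeff]

theorem exists_isEvolution (hB : ContinuousOn B (Ici 0)) :
    ∃ Y, IsEvolution A B x₀ Y := by
  obtain ⟨y, hy0, hy⟩ := exists_linear_solution (E := V →L[ℝ] V)
    (fun t => ContinuousLinearMap.mul ℝ (V →L[ℝ] V) (A + Real.exp t • B (Real.exp t)))
    ((ContinuousLinearMap.mul ℝ (V →L[ℝ] V)).continuous.comp (continuous_log_coeff hB))
    (Real.log x₀) 1
  refine ⟨fun x => y (Real.log x), hy0, fun x hx => ?_⟩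
  refine ((hy (Real.log x)).scomp x (Real.hasDerivAt_log hx.ne')).congr_deriv ?_
  rw [ContinuousLinearMap.mul_apply', ← smul_mul_assoc, inv_smul_log_coeff hx]
  rfl

/-- The inverse is obtained from its own equation X' = -X (A/x + B) rather than by inverting Y; then
XY has zero derivative and equals E at x₀. -/
theorem exists_inverse_evolution (hB : ContinuousOn B (Ici 0)) :
    ∃ X : ℝ → V →L[ℝ] V, X x₀ = 1 ∧ ∀ x, 0 < x → HasDerivAt X (-(X x * coeff A B x)) x := by
  obtain ⟨y, hy0, hy⟩ := exists_linear_solution (E := V →L[ℝ] V)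
    (fun t => -(ContinuousLinearMap.mul ℝ (V →L[ℝ] V)).flip (A + Real.exp t • B (Real.exp t)))
    (((ContinuousLinearMap.mul ℝ (V →L[ℝ] V)).flip.continuous.comp
      (continuous_log_coeff hB)).neg) (Real.log x₀) 1
  refine ⟨fun x => y (Real.log x), hy0, fun x hx => ?_⟩
  refine ((hy (Real.log x)).scomp x (Real.hasDerivAt_log hx.ne')).congr_deriv ?_
  rw [neg_apply, ContinuousLinearMap.flip_apply, ContinuousLinearMap.mul_apply',
    smul_neg, ← mul_smul_comm, inv_smul_log_coeff hx]

theorem isEvolution_evol (hB : ContinuousOn B (Ici 0)) : IsEvolution A B x₀ (evol A B x₀) :=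
  Classical.epsilon_spec (exists_isEvolution hB)

theorem evol_self (hB : ContinuousOn B (Ici 0)) : evol A B x₀ x₀ = 1 := (isEvolution_evol hB).1

theorem hasDerivAt_evol (hB : ContinuousOn B (Ici 0)) {x : ℝ} (hx : 0 < x) :
    HasDerivAt (evol A B x₀) (coeff A B x * evol A B x₀ x) x := (isEvolution_evol hB).2 x hx

/-- Existence of the inverse of the evolution operator, together with its equation. -/
theorem evolInv_spec (hB : ContinuousOn B (Ici 0)) (hx₀ : 0 < x₀) {x : ℝ} (hx : 0 < x) :
    evolInv A B x₀ x * evol A B x₀ x = 1 ∧ evol A B x₀ x * evolInv A B x₀ x = 1 ∧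
      HasDerivAt (evolInv A B x₀) (-(evolInv A B x₀ x * coeff A B x)) x := by
  obtain ⟨X, hX0, hX⟩ := exists_inverse_evolution (A := A) (x₀ := x₀) hB
  have hone : ∀ x, 0 < x → X x * evol A B x₀ x = 1 := by
    intro x hx
    have hd : ∀ z, 0 < z → z < max x x₀ + 1 → HasDerivAt (fun z => X z * evol A B x₀ z) 0 z := by
      intro z hz _
      refine ((hX z hz).mul (hasDerivAt_evol hB hz)).congr_deriv ?_
      noncomm_ring
    have := eq_of_hasDerivAt_zero hd hx ((le_max_left _ _).trans_lt (lt_add_one _)) hx₀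
      ((le_max_right _ _).trans_lt (lt_add_one _))
    simpa [hX0, evol_self hB] using this
  have hinv : ∀ x, 0 < x → evolInv A B x₀ x = X x := by
    intro x hx
    exact Ring.inverse_unit ⟨evol A B x₀ x, X x, mul_eq_one_symm (hone x hx), hone x hx⟩
  refine ⟨by rw [hinv x hx]; exact hone x hx, by rw [hinv x hx]; exact mul_eq_one_symm (hone x hx),
    ?_⟩
  rw [hinv x hx]
  refine (hX x hx).congr_of_eventuallyEq ?_
  filter_upwards [lt_mem_nhds hx] with z hz using hinv z hz

theorem evolInv_mul_evol (hB : ContinuousOn B (Ici 0)) (hx₀ : 0 < x₀) {x : ℝ} (hx : 0 < x) :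
    evolInv A B x₀ x * evol A B x₀ x = 1 := (evolInv_spec hB hx₀ hx).1

theorem evol_mul_evolInv (hB : ContinuousOn B (Ici 0)) (hx₀ : 0 < x₀) {x : ℝ} (hx : 0 < x) :
    evol A B x₀ x * evolInv A B x₀ x = 1 := (evolInv_spec hB hx₀ hx).2.1

theorem hasDerivAt_evolInv (hB : ContinuousOn B (Ici 0)) (hx₀ : 0 < x₀) {x : ℝ} (hx : 0 < x) :
    HasDerivAt (evolInv A B x₀) (-(evolInv A B x₀ x * coeff A B x)) x := (evolInv_spec hB hx₀ hx).2.2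

theorem continuousOn_evol (hB : ContinuousOn B (Ici 0)) : ContinuousOn (evol A B x₀) (Ioi 0) :=
  fun _ hx => (hasDerivAt_evol hB hx).continuousAt.continuousWithinAt

theorem continuousOn_evolInv (hB : ContinuousOn B (Ici 0)) (hx₀ : 0 < x₀) :
    ContinuousOn (evolInv A B x₀) (Ioi 0) :=
  fun _ hx => (hasDerivAt_evolInv hB hx₀ hx).continuousAt.continuousWithinAt

/-- Operator solutions of the homogeneous system near zero are `Y(x) C`. -/
theorem evolInv_mul_eq_const (hB : ContinuousOn B (Ici 0)) (hx₀ : 0 < x₀) {Φ : ℝ → V →L[ℝ] V}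
    {b : ℝ} (hΦ : ∀ x, 0 < x → x < b → HasDerivAt Φ (coeff A B x * Φ x) x) {x y : ℝ} (hx : 0 < x)
    (hxb : x < b) (hy : 0 < y) (hyb : y < b) :
    evolInv A B x₀ x * Φ x = evolInv A B x₀ y * Φ y := by
  refine eq_of_hasDerivAt_zero (f := fun x => evolInv A B x₀ x * Φ x) (fun z hz hzb => ?_)
    hx hxb hy hyb
  refine ((hasDerivAt_evolInv hB hx₀ hz).mul (hΦ z hz hzb)).congr_deriv ?_
  noncomm_ring

/-- Lets the dichotomy at infinity, normalized at a, be expressed with base point x₀. -/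
theorem evol_change_base (hB : ContinuousOn B (Ici 0)) (hx₀ : 0 < x₀) {a x : ℝ} (ha : 0 < a)
    (hx : 0 < x) : evol A B a x = evol A B x₀ x * evolInv A B x₀ a := by
  have := evolInv_mul_eq_const (x₀ := x₀) hB hx₀ (Φ := evol A B a) (b := max x a + 1)
    (fun z hz _ => hasDerivAt_evol hB hz) hx ((le_max_left _ _).trans_lt (lt_add_one _)) ha
    ((le_max_right _ _).trans_lt (lt_add_one _))
  rw [evol_self hB, mul_one] at this
  rw [← this, ← mul_assoc, evol_mul_evolInv hB hx₀ hx, one_mul]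

theorem evolInv_change_base (hB : ContinuousOn B (Ici 0)) (hx₀ : 0 < x₀) {a s : ℝ} (ha : 0 < a)
    (hs : 0 < s) : evolInv A B a s = evol A B x₀ a * evolInv A B x₀ s := by
  have h1 := evolInv_mul_evol (A := A) hB ha hs
  rw [evol_change_base hB hx₀ ha hs] at h1
  calc evolInv A B a s = evolInv A B a s * (evol A B x₀ s * (evolInv A B x₀ a * evol A B x₀ a) *
        evolInv A B x₀ s) := by
        rw [evolInv_mul_evol hB hx₀ ha, mul_one, evol_mul_evolInv hB hx₀ hs, mul_one]
    _ = (evolInv A B a s * (evol A B x₀ s * evolInv A B x₀ a)) *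
        (evol A B x₀ a * evolInv A B x₀ s) := by noncomm_ring
    _ = _ := by rw [h1, one_mul]

/-- Variation of constants, in differential form. -/
theorem hasDerivAt_evolInv_apply (hB : ContinuousOn B (Ici 0)) (hx₀ : 0 < x₀) {g y : ℝ → V}
    (hy : IsSolution A B g y) {x : ℝ} (hx : 0 < x) :
    HasDerivAt (fun x => evolInv A B x₀ x (y x)) (evolInv A B x₀ x (g x)) x := by
  refine ((hasDerivAt_evolInv hB hx₀ hx).clm_apply (hy x hx)).congr_deriv ?_
  simp

theorem IsSolution.eq_evol_apply (hB : ContinuousOn B (Ici 0)) (hx₀ : 0 < x₀) {y : ℝ → V}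
    (hy : IsSolution A B 0 y) {x : ℝ} (hx : 0 < x) : y x = evol A B x₀ x (y x₀) := by
  have h := eq_of_hasDerivAt_zero (f := fun x => evolInv A B x₀ x (y x)) (b := max x x₀ + 1)
    (fun z hz _ => by simpa using hasDerivAt_evolInv_apply hB hx₀ hy hz)
    hx ((le_max_left _ _).trans_lt (lt_add_one _)) hx₀ ((le_max_right _ _).trans_lt (lt_add_one _))
  have h1 : evolInv A B x₀ x₀ = 1 := by
    simpa [evol_self hB] using evolInv_mul_evol (A := A) hB hx₀ hx₀
  simp only [h1, one_apply_eq_self] at h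
  rw [← h]
  have := congrArg (fun T : V →L[ℝ] V => T (y x)) (evol_mul_evolInv (A := A) hB hx₀ hx)
  exact this.symm

theorem isSolution_evol_apply (hB : ContinuousOn B (Ici 0)) (v : V) :
    IsSolution A B 0 fun x => evol A B x₀ x v := fun x hx => by
  have := (hasDerivAt_evol (A := A) (x₀ := x₀) hB hx).clm_apply (hasDerivAt_const x v)
  refine this.congr_deriv ?_
  simp

end Evolution

/-! ### Dichotomies at zero and at infinity; change of projection. -/

section Dichotomies

variable {V : Type*} [NormedAddCommGroup V] [InnerProductSpace ℝ V]

/-- Dichotomy on `(0, x₀]` with rates `x ^ (1 + α)` and `x ^ (1 - α)`. -/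
structure ZeroDichotomy (Y X : ℝ → V →L[ℝ] V) (x₀ α K : ℝ) (P : V →L[ℝ] V) : Prop where
  idem : P * P = P
  le_left : ∀ x s : ℝ, 0 < x → x ≤ s → s ≤ x₀ → ‖Y x * P * X s‖ ≤ K * (x / s) ^ (1 + α)
  le_right : ∀ x s : ℝ, 0 < s → s ≤ x → x ≤ x₀ → ‖Y x * (1 - P) * X s‖ ≤ K * (x / s) ^ (1 - α)

/-- Exponential dichotomy on `[x₀, ∞)`. -/
structure InftyDichotomy (Y X : ℝ → V →L[ℝ] V) (x₀ γ K : ℝ) (P : V →L[ℝ] V) : Prop where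
  idem : P * P = P
  le_left : ∀ x s : ℝ, x₀ ≤ s → s ≤ x → ‖Y x * P * X s‖ ≤ K * Real.exp (-γ * (x - s))
  le_right : ∀ x s : ℝ, x₀ ≤ x → x ≤ s → ‖Y x * (1 - P) * X s‖ ≤ K * Real.exp (-γ * (s - x))

theorem mul_eq_of_range_eq {P Q : V →L[ℝ] V} (hP : P * P = P) (h : rg P = rg Q) : P * Q = Q := by
  ext v
  have : Q v ∈ rg P := by rw [h]; exact ⟨v, rfl⟩
  obtain ⟨w, hw⟩ := this
  have hw' : P w = Q v := hw
  change P (Q v) = Q v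
  rw [← hw']
  exact congrArg (fun T : V →L[ℝ] V => T w) hP

/-- Replacing the projection of a dichotomy by another one with the same range. -/
theorem norm_change_projection {Y X : ℝ → V →L[ℝ] V} {b : ℝ} (hYb : Y b = 1) (hXb : X b = 1)
    {P Q : V →L[ℝ] V} (hPQ : P * Q = Q) (hQP : Q * P = P) {p q r K : ℝ} {x s : ℝ}
    (h1 : ‖Y x * Q * X b‖ ≤ K * p) (h2 : ‖Y b * (1 - Q) * X s‖ ≤ K * q) (hpq : p * q ≤ r)
    (hp : 0 ≤ p) (hK : 0 ≤ K) :
    ‖Y x * P * X s - Y x * Q * X s‖ ≤ K * ‖P‖ * K * r := by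
  have e : Y x * P * X s - Y x * Q * X s = (Y x * Q * X b) * P * (Y b * (1 - Q) * X s) := by
    -- With equal ranges QP = P and PQ = Q. The difference then factors through the base point b,
    -- decaying on both sides of it.
    have : P - Q = Q * P * (1 - Q) := by rw [hQP, mul_sub, hPQ, mul_one]
    rw [hYb, hXb, ← sub_mul, ← mul_sub, this]
    noncomm_ring
  rw [e]
  calc _ ≤ ‖Y x * Q * X b‖ * ‖P‖ * ‖Y b * (1 - Q) * X s‖ :=
        (norm_mul_le _ _).trans (mul_le_mul_of_nonneg_right (norm_mul_le _ _) (norm_nonneg _))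
    _ ≤ (K * p) * ‖P‖ * (K * q) := by gcongr
    _ = K * ‖P‖ * K * (p * q) := by ring
    _ ≤ _ := by gcongr

theorem ZeroDichotomy.nonneg {Y X : ℝ → V →L[ℝ] V} {x₀ α K : ℝ} {P : V →L[ℝ] V}
    (h : ZeroDichotomy Y X x₀ α K P) (hx₀ : 0 < x₀) : 0 ≤ K := by
  have := (norm_nonneg _).trans (h.le_left x₀ x₀ hx₀ le_rfl le_rfl)
  simpa [div_self hx₀.ne'] using this

theorem InftyDichotomy.nonneg {Y X : ℝ → V →L[ℝ] V} {x₀ γ K : ℝ} {P : V →L[ℝ] V}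
    (h : InftyDichotomy Y X x₀ γ K P) : 0 ≤ K := by
  have := (norm_nonneg _).trans (h.le_left x₀ x₀ le_rfl le_rfl)
  simpa using this

/-- The difference of the two kernels passes through x₀ and is O((x/x₀)^(1+α) (x₀/s)^(1-α)). Since
x/x₀ ≤ 1 ≤ x₀/s, this is dominated by (x/s)^(1+α) as well as by (x/s)^(1-α). -/
theorem ZeroDichotomy.change {Y X : ℝ → V →L[ℝ] V} {x₀ α K : ℝ} (hx₀ : 0 < x₀) (hα : 0 < α)
    (hY : Y x₀ = 1) (hX : X x₀ = 1) {P Q : V →L[ℝ] V} (h : ZeroDichotomy Y X x₀ α K Q)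
    (hP : P * P = P) (hPQ : rg P = rg Q) : ZeroDichotomy Y X x₀ α (K + K * ‖P‖ * K) P := by
  have hK := h.nonneg hx₀
  have h1 := mul_eq_of_range_eq hP hPQ
  have h2 := mul_eq_of_range_eq h.idem hPQ.symm
  have key : ∀ x s r : ℝ, 0 < x → x ≤ x₀ → 0 < s → s ≤ x₀ →
      (x / x₀) ^ (1 + α) * (x₀ / s) ^ (1 - α) ≤ r →
      ‖Y x * P * X s - Y x * Q * X s‖ ≤ K * ‖P‖ * K * r := fun x s r hx hxx hs hss hr =>
    norm_change_projection hY hX h1 h2 (h.le_left x x₀ hx hxx le_rfl)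
      (h.le_right x₀ s hs hss le_rfl) hr (by positivity) hK
  have hexp : ∀ x s : ℝ, 0 < x → 0 < s → ∀ δ : ℝ,
      (x / s) ^ δ = (x / x₀) ^ δ * (x₀ / s) ^ δ := fun x s hx hs δ => by
    rw [← Real.mul_rpow (by positivity) (by positivity)]
    congr 1
    field_simp
  refine ⟨hP, fun x s hx hxs hs => ?_, fun x s hs hxs hx => ?_⟩
  · have hs0 := hx.trans_le hxs
    have := key x s _ hx (hxs.trans hs) hs0 hs le_rfl
    calc _ = ‖(Y x * P * X s - Y x * Q * X s) + Y x * Q * X s‖ := by rw [sub_add_cancel]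
      _ ≤ K * ‖P‖ * K * (x / s) ^ (1 + α) + K * (x / s) ^ (1 + α) := by
        refine (norm_add_le _ _).trans (add_le_add (key x s _ hx (hxs.trans hs) hs0 hs ?_)
          (h.le_left x s hx hxs hs))
        rw [hexp x s hx hs0]
        gcongr
        · exact (one_le_div hs0).2 hs
        · linarith
      _ = _ := by ring
  · have hx0 := hs.trans_le hxs
    calc _ = ‖Y x * (1 - Q) * X s - (Y x * P * X s - Y x * Q * X s)‖ := by
          congr 1; noncomm_ring
      _ ≤ K * (x / s) ^ (1 - α) + K * ‖P‖ * K * (x / s) ^ (1 - α) := by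
        refine (norm_sub_le _ _).trans (add_le_add (h.le_right x s hs hxs hx)
          (key x s _ hx0 hx hs (hxs.trans hx) ?_))
        rw [hexp x s hx0 hs]
        refine mul_le_mul_of_nonneg_right ?_ (by positivity)
        exact Real.rpow_le_rpow_of_exponent_ge (by positivity) ((div_le_one hx₀).2 hx) (by linarith)
      _ = _ := by ring

/-- Passing through x₀ costs e^(-γ(x-x₀)) e^(-γ(s-x₀)), which is at most e^(-γ|x-s|). -/
theorem InftyDichotomy.change {Y X : ℝ → V →L[ℝ] V} {x₀ γ K : ℝ} (hγ : 0 < γ)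
    (hY : Y x₀ = 1) (hX : X x₀ = 1) {P Q : V →L[ℝ] V} (h : InftyDichotomy Y X x₀ γ K Q)
    (hP : P * P = P) (hPQ : rg P = rg Q) : InftyDichotomy Y X x₀ γ (K + K * ‖P‖ * K) P := by
  have hK := h.nonneg
  have h1 := mul_eq_of_range_eq hP hPQ
  have h2 := mul_eq_of_range_eq h.idem hPQ.symm
  have key : ∀ x s r : ℝ, x₀ ≤ x → x₀ ≤ s →
      Real.exp (-γ * (x - x₀)) * Real.exp (-γ * (s - x₀)) ≤ r →
      ‖Y x * P * X s - Y x * Q * X s‖ ≤ K * ‖P‖ * K * r := fun x s r hx hs hr =>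
    norm_change_projection hY hX h1 h2 (h.le_left x x₀ le_rfl hx)
      (h.le_right x₀ s le_rfl hs) hr (by positivity) hK
  refine ⟨hP, fun x s hs hxs => ?_, fun x s hx hxs => ?_⟩
  · calc _ = ‖(Y x * P * X s - Y x * Q * X s) + Y x * Q * X s‖ := by rw [sub_add_cancel]
      _ ≤ K * ‖P‖ * K * Real.exp (-γ * (x - s)) + K * Real.exp (-γ * (x - s)) := by
        refine (norm_add_le _ _).trans (add_le_add (key x s _ (hs.trans hxs) hs ?_)
          (h.le_left x s hs hxs))
        rw [← Real.exp_add]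
        gcongr
        nlinarith
      _ = _ := by ring
  · calc _ = ‖Y x * (1 - Q) * X s - (Y x * P * X s - Y x * Q * X s)‖ := by
          congr 1; noncomm_ring
      _ ≤ K * Real.exp (-γ * (s - x)) + K * ‖P‖ * K * Real.exp (-γ * (s - x)) := by
        refine (norm_sub_le _ _).trans (add_le_add (h.le_right x s hx hxs)
          (key x s _ hx (hx.trans hxs) ?_))
        rw [← Real.exp_add]
        gcongr
        nlinarith
      _ = _ := by ring

end Dichotomies

/-! ### Existence of both dichotomies, and growth of the evolution operator. -/

section Existence

variable {V : Type*} [NormedAddCommGroup V] [InnerProductSpace ℝ V] [FiniteDimensional ℝ V]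
  {A : V →L[ℝ] V} {B : ℝ → V →L[ℝ] V} {x₀ : ℝ}

theorem evolInv_self (hB : ContinuousOn B (Ici 0)) (hx₀ : 0 < x₀) : evolInv A B x₀ x₀ = 1 := by
  simpa [evol_self hB] using evolInv_mul_evol (A := A) hB hx₀ hx₀

/-- Near zero the evolution operator is comparable with `x ^ A`. -/
theorem exists_evol_eq_conj_exp (hB : ContinuousOn B (Ici 0)) (hBb : ∃ C : ℝ, ∀ x : ℝ, 0 ≤ x → ‖B x‖ ≤ C)
    (hx₀ : 0 < x₀) :
    ∃ (T T' : ℝ → V →L[ℝ] V) (C C' : V →L[ℝ] V) (K : ℝ), C * C' = 1 ∧ C' * C = 1 ∧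
      (∀ x, 0 < x → evol A B x₀ x = T x * NormedSpace.exp (Real.log x • A) * C') ∧
      (∀ x, 0 < x → evolInv A B x₀ x = C * NormedSpace.exp (-Real.log x • A) * T' x) ∧
      (∀ x, 0 < x → x ≤ x₀ → ‖T x‖ ≤ K) ∧ (∀ x, 0 < x → x ≤ x₀ → ‖T' x‖ ≤ K) := by
  obtain ⟨τ, S, hS1, hS⟩ := exists_conjugation A B hB hBb
  set Z : ℝ → V →L[ℝ] V := fun x => NormedSpace.exp (Real.log x • A) with hZ
  set Z' : ℝ → V →L[ℝ] V := fun x => NormedSpace.exp (-Real.log x • A) with hZ'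
  have hZZ' : ∀ x, Z x * Z' x = 1 := fun x => exp_smul_mul_exp_neg_smul A _
  have hZ'Z : ∀ x, Z' x * Z x = 1 := fun x => exp_neg_smul_mul_exp_smul A _
  have hlog0 : Tendsto Real.log (𝓝[>] 0) atBot := Real.tendsto_log_nhdsGT_zero
  have hSlog : Tendsto (fun x => S (Real.log x)) (𝓝[>] 0) (𝓝 1) := hS1.comp hlog0
  -- S(log x) x^A solves the homogeneous equation near zero, so it equals Y(x) C for a constant
  -- operator C.
  have hΦ : ∀ x, 0 < x → x < Real.exp τ →
      HasDerivAt (fun x => S (Real.log x) * Z x) (coeff A B x * (S (Real.log x) * Z x)) x := by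
    intro x hx hxτ
    have hlt : Real.log x < τ := (Real.log_lt_iff_lt_exp hx).2 hxτ
    have d1 := (hS _ hlt).scomp x (Real.hasDerivAt_log hx.ne')
    have d2 := (hasDerivAt_exp_smul_const' A (Real.log x)).scomp x (Real.hasDerivAt_log hx.ne')
    refine (d1.mul d2).congr_deriv ?_
    simp only [Function.comp, Real.exp_log hx, coeff, hZ]
    rw [smul_add, ← mul_smul, inv_mul_cancel₀ hx.ne', one_smul, smul_sub, add_mul, add_mul, sub_mul]
    simp only [smul_mul_assoc, mul_smul_comm, mul_assoc]
    abel
  set x₁ := Real.exp τ / 2 with hx₁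
  have hx₁0 : 0 < x₁ := by positivity
  have hx₁τ : x₁ < Real.exp τ := half_lt_self (Real.exp_pos _)
  set C := evolInv A B x₀ x₁ * (S (Real.log x₁) * Z x₁) with hC
  have hconst : ∀ x, 0 < x → x < Real.exp τ → evolInv A B x₀ x * (S (Real.log x) * Z x) = C :=
    fun x hx hxτ => evolInv_mul_eq_const hB hx₀ hΦ hx hxτ hx₁0 hx₁τ
  have hsmall : ∀ᶠ x in 𝓝[>] (0 : ℝ), 0 < x ∧ x < Real.exp τ :=
    Ioo_mem_nhdsGT (Real.exp_pos τ)
  have hTeq : ∀ x, 0 < x → x < Real.exp τ → evol A B x₀ x * C * Z' x = S (Real.log x) := by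
    intro x hx hxτ
    calc _ = (evol A B x₀ x * evolInv A B x₀ x) * S (Real.log x) * (Z x * Z' x) := by
          rw [← hconst x hx hxτ]; noncomm_ring
      _ = _ := by rw [evol_mul_evolInv hB hx₀ hx, hZZ', one_mul, mul_one]
  -- S tends to the identity, hence is invertible at some point near zero, and so is C.
  obtain ⟨x₂, ⟨hx₂, hx₂τ⟩, hunit⟩ : ∃ x₂, (0 < x₂ ∧ x₂ < Real.exp τ) ∧ IsUnit (S (Real.log x₂)) :=
    (hsmall.and (hSlog.eventually (Units.isOpen.mem_nhds (isUnit_one (M := V →L[ℝ] V))))).exists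
  have hCunit : IsUnit C := by
    rw [← hconst x₂ hx₂ hx₂τ]
    refine IsUnit.mul ?_ (hunit.mul ?_)
    · exact ⟨⟨_, _, evolInv_mul_evol hB hx₀ hx₂, evol_mul_evolInv hB hx₀ hx₂⟩, rfl⟩
    · exact ⟨⟨_, _, hZZ' x₂, hZ'Z x₂⟩, rfl⟩
  obtain ⟨⟨C₁, C', hCC', hC'C⟩, hC₁⟩ := hCunit
  have hC₁' : C₁ = C := hC₁
  rw [hC₁'] at hCC' hC'C
  have hZc : ContinuousOn Z (Ioi 0) := (continuous_exp_smul A).comp_continuousOn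
    (Real.continuousOn_log.mono fun x hx => ne_of_gt hx)
  have hZ'c : ContinuousOn Z' (Ioi 0) := (continuous_exp_smul A).comp_continuousOn
    (Real.continuousOn_log.mono fun x hx => ne_of_gt hx).neg
  -- T extends S(log x) continuously from a neighbourhood of zero to all x > 0, so its limit at zero
  -- and compactness bound it on all of (0, x₀].
  set T : ℝ → V →L[ℝ] V := fun x => evol A B x₀ x * C * Z' x with hT
  set T' : ℝ → V →L[ℝ] V := fun x => Z x * C' * evolInv A B x₀ x with hT'
  have hTT' : ∀ x, 0 < x → T x * T' x = 1 := fun x hx => by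
    calc _ = evol A B x₀ x * (C * ((Z' x * Z x) * C')) * evolInv A B x₀ x := by
          simp only [hT, hT']; noncomm_ring
      _ = 1 := by rw [hZ'Z, one_mul, hCC', mul_one, evol_mul_evolInv hB hx₀ hx]
  have hTlim : Tendsto T (𝓝[>] 0) (𝓝 1) := by
    refine hSlog.congr' ?_
    filter_upwards [hsmall] with x hx using (hTeq x hx.1 hx.2).symm
  have hT'lim : Tendsto T' (𝓝[>] 0) (𝓝 1) := by
    have h1 : Tendsto (fun x => Ring.inverse (T x)) (𝓝[>] 0) (𝓝 (Ring.inverse 1)) :=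
      (NormedRing.inverse_continuousAt (1 : (V →L[ℝ] V)ˣ)).tendsto.comp hTlim
    rw [Ring.inverse_one] at h1
    refine h1.congr' ?_
    filter_upwards [hsmall] with x hx
    exact Ring.inverse_unit ⟨T x, T' x, hTT' x hx.1, mul_eq_one_symm (hTT' x hx.1)⟩
  obtain ⟨K₁, hK₁⟩ := exists_bound_Ioc (((continuousOn_evol hB).mul continuousOn_const).mul hZ'c)
    hTlim x₀
  obtain ⟨K₂, hK₂⟩ := exists_bound_Ioc
    ((hZc.mul continuousOn_const).mul (continuousOn_evolInv hB hx₀)) hT'lim x₀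
  refine ⟨T, T', C, C', max K₁ K₂, hCC', hC'C, fun x hx => ?_, fun x hx => ?_,
    fun x hx hxx => (hK₁ x hx hxx).trans (le_max_left _ _),
    fun x hx hxx => (hK₂ x hx hxx).trans (le_max_right _ _)⟩
  · change _ = evol A B x₀ x * C * Z' x * Z x * C'
    calc _ = evol A B x₀ x * (C * ((Z' x * Z x) * C')) := by rw [hZ'Z, one_mul, hCC', mul_one]
      _ = _ := by noncomm_ring
  · change _ = C * Z' x * (Z x * C' * evolInv A B x₀ x)
    calc _ = (C * ((Z' x * Z x) * C')) * evolInv A B x₀ x := by rw [hZ'Z, one_mul, hCC', one_mul]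
      _ = _ := by noncomm_ring

theorem isCharRoot_iff {z : ℂ} :
    IsCharRoot A z ↔ Polynomial.aeval z (A : V →ₗ[ℝ] V).charpoly = 0 := by
  rw [IsCharRoot, Polynomial.IsRoot.def, Polynomial.eval_map_algebraMap]

theorem charpoly_ne_zero : (A : V →ₗ[ℝ] V).charpoly ≠ 0 := (LinearMap.charpoly_monic _).ne_zero

/-- The spectral projection of A for the line Re z = 1 commutes with x^A. Conjugated by C it turns
Y(x) · Y⁻¹(s) into (x/s)^A up to the bounded factors T and T', and the exponential bounds in log
(x/s) become powers. -/
theorem exists_zeroDichotomy (hB : ContinuousOn B (Ici 0))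
    (hBb : ∃ C : ℝ, ∀ x : ℝ, 0 ≤ x → ‖B x‖ ≤ C) (hA : ∀ z : ℂ, IsCharRoot A z → z.re ≠ 1)
    (hx₀ : 0 < x₀) :
    ∃ α K Q, 0 < α ∧ α < 1 ∧ ZeroDichotomy (evol A B x₀) (evolInv A B x₀) x₀ α K Q := by
  obtain ⟨P, ε₀, hPP, hPA, hε₀, hP⟩ := exists_spectral_projection (A := A) (c := 1)
    charpoly_ne_zero (aeval_charpoly_clm A) (fun z hz => hA z (isCharRoot_iff.2 hz))
  -- Halving the minimum keeps α strictly below both the spectral gap and 1.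
  set α := min ε₀ 1 / 2 with hα
  have hmin : 0 < min ε₀ 1 := lt_min hε₀ one_pos
  have hα0 : 0 < α := half_pos hmin
  have hαε : α < ε₀ := (half_lt_self hmin).trans_le (min_le_left _ _)
  have hα1 : α < 1 := (half_lt_self hmin).trans_le (min_le_right _ _)
  obtain ⟨K₀, h₁, h₂⟩ := hP α hα0 hαε
  obtain ⟨T, T', C, C', K, hCC', hC'C, hY, hX, hT, hT'⟩ :=
    exists_evol_eq_conj_exp (A := A) hB hBb hx₀
  have hK : 0 ≤ K := (norm_nonneg _).trans (hT x₀ hx₀ le_rfl)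
  have hformula : ∀ R : V →L[ℝ] V, Commute R A → ∀ x s, 0 < x → 0 < s →
      evol A B x₀ x * (C * R * C') * evolInv A B x₀ s =
        T x * (NormedSpace.exp ((Real.log x - Real.log s) • A) * R) * T' s := by
    intro R hR x s hx hs
    have hcomm : R * NormedSpace.exp (-Real.log s • A) = NormedSpace.exp (-Real.log s • A) * R := by
      let _ := NormedAlgebra.restrictScalars ℚ ℝ (V →L[ℝ] V)
      exact (hR.smul_right (-Real.log s)).exp_right
    have hadd : NormedSpace.exp ((Real.log x - Real.log s) • A) =
        NormedSpace.exp (Real.log x • A) * NormedSpace.exp (-Real.log s • A) := by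
      rw [sub_eq_add_neg]
      exact (exp_smul_mul_exp_smul A _ _).symm
    rw [hY x hx, hX s hs, hadd]
    calc _ = T x * NormedSpace.exp (Real.log x • A) * (C' * C) *
          R * (C' * C) * NormedSpace.exp (-Real.log s • A) * T' s := by noncomm_ring
      _ = T x * NormedSpace.exp (Real.log x • A) * (R * NormedSpace.exp (-Real.log s • A)) *
          T' s := by rw [hC'C, mul_one, mul_one]; noncomm_ring
      _ = _ := by rw [hcomm]; noncomm_ring
  have hpow : ∀ x s : ℝ, 0 < x → 0 < s → ∀ δ : ℝ,
      Real.exp (δ * (Real.log x - Real.log s)) = (x / s) ^ δ := fun x s hx hs δ => by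
    rw [← Real.log_div hx.ne' hs.ne', Real.rpow_def_of_pos (div_pos hx hs), mul_comm]
  have hbound : ∀ (R : V →L[ℝ] V) (x s r : ℝ), 0 < x → x ≤ x₀ → 0 < s → s ≤ x₀ →
      ‖NormedSpace.exp ((Real.log x - Real.log s) • A) * R‖ ≤ K₀ * r →
      ‖T x * (NormedSpace.exp ((Real.log x - Real.log s) • A) * R) * T' s‖ ≤ K * K₀ * K * r := by
    intro R x s r hx hxx hs hss hr
    calc _ ≤ ‖T x‖ * ‖NormedSpace.exp ((Real.log x - Real.log s) • A) * R‖ * ‖T' s‖ :=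
          (norm_mul_le _ _).trans (mul_le_mul_of_nonneg_right (norm_mul_le _ _) (norm_nonneg _))
      _ ≤ K * (K₀ * r) * K :=
          mul_le_mul (mul_le_mul (hT x hx hxx) hr (norm_nonneg _) hK) (hT' s hs hss)
            (norm_nonneg _) (mul_nonneg hK ((norm_nonneg _).trans hr))
      _ = _ := by ring
  refine ⟨α, K * K₀ * K, C * P * C', hα0, hα1, ?_, fun x s hx hxs hs => ?_,
    fun x s hs hxs hx => ?_⟩
  · calc _ = C * P * (C' * C) * P * C' := by noncomm_ring
      _ = C * (P * P) * C' := by rw [hC'C]; noncomm_ring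
      _ = _ := by rw [hPP]
  · have hs0 := hx.trans_le hxs
    rw [hformula P hPA x s hx hs0]
    refine hbound P x s _ hx (hxs.trans hs) hs0 hs ?_
    rw [← hpow x s hx hs0]
    exact h₁ _ (sub_nonpos.2 (Real.log_le_log hx hxs))
  · have hx0 := hs.trans_le hxs
    have : 1 - C * P * C' = C * (1 - P) * C' := by
      rw [mul_sub, sub_mul, mul_one, hCC']
    rw [this, hformula (1 - P) ((Commute.one_left A).sub_left hPA) x s hx0 hs]
    refine hbound _ x s _ hx0 hx hs (hxs.trans hx) ?_
    rw [← hpow x s hx0 hs]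
    exact h₂ _ (sub_nonneg.2 (Real.log_le_log hs hxs))

/-- Behaviour of the evolution operator at zero in terms of the roots with least real part. -/
theorem tendsto_rpow_smul_evol (hB : ContinuousOn B (Ici 0))
    (hBb : ∃ C : ℝ, ∀ x : ℝ, 0 ≤ x → ‖B x‖ ≤ C) (hx₀ : 0 < x₀) {β : ℝ}
    (hβ : ∀ z : ℂ, IsCharRoot A z → -β < z.re) :
    Tendsto (fun x : ℝ => x ^ β • evol A B x₀ x) (𝓝[>] 0) (𝓝 0) := by
  have hev : ∀ᶠ ε in 𝓝[>] (0 : ℝ), ∀ z ∈ {z : ℂ | Polynomial.aeval z (A : V →ₗ[ℝ] V).charpoly = 0},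
      -β + ε < z.re := by
    rw [Filter.eventually_all_finite (finite_complex_roots charpoly_ne_zero)]
    intro z hz
    have : ∀ᶠ ε in 𝓝 (0 : ℝ), -β + ε < z.re :=
      (continuous_const.add continuous_id).continuousAt.eventually_lt continuousAt_const
        (by simpa using hβ z (isCharRoot_iff.2 hz))
    exact this.filter_mono nhdsWithin_le_nhds
  obtain ⟨ε, hε, hε0⟩ := (hev.and self_mem_nhdsWithin).exists
  have hε0' : 0 < ε := hε0
  obtain ⟨K₀, hK₀⟩ := norm_exp_mul_le_of_nonpos (A := A) (P := 1) (μ := -β + ε) charpoly_ne_zero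
    (by rw [aeval_charpoly_clm, zero_mul]) hε
  obtain ⟨T, T', C, C', K, hCC', hC'C, hY, hX, hT, hT'⟩ :=
    exists_evol_eq_conj_exp (A := A) hB hBb hx₀
  have hK : 0 ≤ K := (norm_nonneg _).trans (hT x₀ hx₀ le_rfl)
  have hlim : Tendsto (fun x : ℝ => K * K₀ * ‖C'‖ * x ^ ε) (𝓝[>] 0) (𝓝 0) := by
    have : Tendsto (fun x : ℝ => x ^ ε) (𝓝[>] 0) (𝓝 (0 ^ ε)) :=
      ((Real.continuousAt_rpow_const 0 ε (Or.inr hε0'.le)).tendsto).mono_left nhdsWithin_le_nhds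
    rw [Real.zero_rpow hε0'.ne'] at this
    simpa using this.const_mul (K * K₀ * ‖C'‖)
  refine squeeze_zero_norm' ?_ hlim
  filter_upwards [Ioo_mem_nhdsGT hx₀, Ioo_mem_nhdsGT one_pos] with x hx hx1
  rw [norm_smul, Real.norm_of_nonneg (Real.rpow_nonneg hx.1.le _), hY x hx.1]
  have h1 := hK₀ (Real.log x) (Real.log_nonpos hx1.1.le hx1.2.le)
  rw [mul_one, mul_comm (-β + ε), ← Real.rpow_def_of_pos hx.1] at h1
  calc _ ≤ x ^ β * (‖T x‖ * ‖NormedSpace.exp (Real.log x • A)‖ * ‖C'‖) := by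
        refine mul_le_mul_of_nonneg_left ?_ (Real.rpow_nonneg hx.1.le _)
        exact (norm_mul_le _ _).trans (mul_le_mul_of_nonneg_right (norm_mul_le _ _) (norm_nonneg _))
    _ ≤ x ^ β * (K * (K₀ * x ^ (-β + ε)) * ‖C'‖) := by
        refine mul_le_mul_of_nonneg_left ?_ (Real.rpow_nonneg hx.1.le _)
        refine mul_le_mul_of_nonneg_right ?_ (norm_nonneg _)
        exact mul_le_mul (hT x hx.1 hx.2.le) h1 (norm_nonneg _) hK
    _ = K * K₀ * ‖C'‖ * (x ^ β * x ^ (-β + ε)) := by ring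
    _ = _ := by rw [← Real.rpow_add hx.1]; congr 2; ring

/-- Exponential growth bound for the evolution operator at infinity. -/
theorem exists_evol_le_exp (hB : ContinuousOn B (Ici 0))
    (hBb : ∃ C : ℝ, ∀ x : ℝ, 0 ≤ x → ‖B x‖ ≤ C) (hx₀ : 0 < x₀) :
    ∃ k, 0 ≤ k ∧ ∀ x, x₀ ≤ x → ‖evol A B x₀ x‖ ≤ Real.exp (k * (x - x₀)) := by
  obtain ⟨C, hC⟩ := hBb
  have hC0 : 0 ≤ C := (norm_nonneg _).trans (hC 0 le_rfl)
  have hcoeff : ∀ x, x₀ ≤ x → ‖coeff A B x‖ ≤ x₀⁻¹ * ‖A‖ + C := by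
    intro x hx
    refine (norm_add_le _ _).trans (add_le_add ?_ (hC x (hx₀.le.trans hx)))
    rw [norm_smul, norm_inv, Real.norm_of_nonneg (hx₀.le.trans hx)]
    gcongr
  refine ⟨x₀⁻¹ * ‖A‖ + C, by positivity, fun x hx => ?_⟩
  have := norm_le_gronwallBound_of_norm_deriv_right_le (f := evol A B x₀)
    (f' := fun x => coeff A B x * evol A B x₀ x) (a := x₀) (b := x) (δ := 1)
    (K := x₀⁻¹ * ‖A‖ + C) (ε := 0)
    ((continuousOn_evol hB).mono fun z hz => hx₀.trans_le hz.1)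
    (fun z hz => (hasDerivAt_evol hB (hx₀.trans_le hz.1)).hasDerivWithinAt)
    (by rw [evol_self hB]; exact ContinuousLinearMap.norm_id_le)
    (fun z hz => by
      rw [add_zero]
      exact (norm_mul_le _ _).trans (mul_le_mul_of_nonneg_right (hcoeff z hz.1) (norm_nonneg _)))
    x (right_mem_Icc.2 hx)
  rwa [gronwallBound_ε0, one_mul] at this

/-- Conjugating the projection by Y(a) moves the base point. If a > x₀, points of [x₀, a] are first
replaced by a, which costs a factor bounded by compactness. -/
theorem exists_inftyDichotomy (hB : ContinuousOn B (Ici 0)) (hx₀ : 0 < x₀)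
    (hD : ∃ a : ℝ, 0 < a ∧ IsExpDichotomic A B a) :
    ∃ γ K Q, 0 < γ ∧ InftyDichotomy (evol A B x₀) (evolInv A B x₀) x₀ γ K Q := by
  obtain ⟨a, ha, P, γ, C, hPP, hγ, h₁, h₂⟩ := hD
  set Y := evol A B x₀ with hY
  set X := evolInv A B x₀ with hX
  have hconj : ∀ (R : V →L[ℝ] V) (x s : ℝ), 0 < x → 0 < s →
      evol A B a x ∘L R ∘L evolInv A B a s = Y x * (X a * R * Y a) * X s := by
    intro R x s hx hs
    rw [evol_change_base hB hx₀ ha hx, evolInv_change_base hB hx₀ ha hs]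
    change Y x * X a * (R * (Y a * X s)) = _
    noncomm_ring
  have hC0 : 0 ≤ C := by
    have := (norm_nonneg _).trans (h₁ a a le_rfl le_rfl)
    simpa using this
  have hYX : ∀ x, 0 < x → Y x * X x = 1 := fun x hx => evol_mul_evolInv hB hx₀ hx
  have hXY : ∀ x, 0 < x → X x * Y x = 1 := fun x hx => evolInv_mul_evol hB hx₀ hx
  have hYc : ContinuousOn Y (Icc x₀ a) := (continuousOn_evol hB).mono fun z hz => hx₀.trans_le hz.1
  have hXc : ContinuousOn X (Icc x₀ a) :=
    (continuousOn_evolInv hB hx₀).mono fun z hz => hx₀.trans_le hz.1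
  obtain ⟨K₁, hK₁⟩ := isCompact_Icc.exists_bound_of_continuousOn (hYc.mul
    (continuousOn_const (c := X a)))
  obtain ⟨K₂, hK₂⟩ := isCompact_Icc.exists_bound_of_continuousOn
    ((continuousOn_const (c := Y a)).mul hXc)
  set K := max 1 (max K₁ K₂) with hK
  have hK0 : 0 ≤ K := zero_le_one.trans (le_max_left _ _)
  have hb₁ : ∀ x, x₀ ≤ x → ‖Y x * X (max x a)‖ ≤ K := by
    intro x hx
    rcases le_total a x with h | h
    · rw [max_eq_left h, hYX x (hx₀.trans_le hx)]
      exact ContinuousLinearMap.norm_id_le.trans (le_max_left _ _)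
    · rw [max_eq_right h]
      exact (hK₁ x ⟨hx, h⟩).trans ((le_max_left _ _).trans (le_max_right _ _))
  have hb₂ : ∀ x, x₀ ≤ x → ‖Y (max x a) * X x‖ ≤ K := by
    intro x hx
    rcases le_total a x with h | h
    · rw [max_eq_left h, hYX x (hx₀.trans_le hx)]
      exact ContinuousLinearMap.norm_id_le.trans (le_max_left _ _)
    · rw [max_eq_right h]
      exact (hK₂ x ⟨hx, h⟩).trans ((le_max_right _ _).trans (le_max_right _ _))
  set Q := X a * P * Y a with hQ
  -- For s ≥ x₀ replacing s by max s a shifts it by at most d, which accounts for the factor e^(γd)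
  -- in the constant.
  set d := max (a - x₀) 0 with hd
  have hd0 : 0 ≤ d := le_max_right _ _
  have hda : a ≤ x₀ + d := by have := le_max_left (a - x₀) 0; linarith
  have hmove : ∀ (R : V →L[ℝ] V) (x s r : ℝ), x₀ ≤ x → x₀ ≤ s →
      ‖Y (max x a) * R * X (max s a)‖ ≤ C * r → ‖Y x * R * X s‖ ≤ K * C * K * r := by
    intro R x s r hx hs hr
    have hx' : 0 < max x a := ha.trans_le (le_max_right _ _)
    have hs' : 0 < max s a := ha.trans_le (le_max_right _ _)
    have e : Y x * R * X s = (Y x * X (max x a)) * (Y (max x a) * R * X (max s a)) *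
        (Y (max s a) * X s) := by
      calc _ = Y x * (X (max x a) * Y (max x a)) * R * (X (max s a) * Y (max s a)) * X s := by
            rw [hXY _ hx', hXY _ hs', mul_one, mul_one]
        _ = _ := by noncomm_ring
    rw [e]
    calc _ ≤ ‖Y x * X (max x a)‖ * ‖Y (max x a) * R * X (max s a)‖ * ‖Y (max s a) * X s‖ :=
          (norm_mul_le _ _).trans (mul_le_mul_of_nonneg_right (norm_mul_le _ _) (norm_nonneg _))
      _ ≤ K * (C * r) * K :=
          mul_le_mul (mul_le_mul (hb₁ x hx) hr (norm_nonneg _) hK0) (hb₂ s hs)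
            (norm_nonneg _) (mul_nonneg hK0 ((norm_nonneg _).trans hr))
      _ = _ := by ring
  refine ⟨γ, K * C * K * Real.exp (γ * d), Q, hγ, ?_, fun x s hs hxs => ?_, fun x s hx hxs => ?_⟩
  · have hPP' : P * P = P := hPP
    calc _ = X a * P * (Y a * X a) * P * Y a := by noncomm_ring
      _ = X a * (P * P) * Y a := by rw [hYX a ha]; noncomm_ring
      _ = _ := by rw [hPP']
  · rw [mul_assoc (K * C * K), ← Real.exp_add]
    refine hmove Q x s _ (hs.trans hxs) hs ?_
    rw [← hconj P _ _ (ha.trans_le (le_max_right _ _)) (ha.trans_le (le_max_right _ _))]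
    refine (h₁ _ _ (le_max_right _ _) (max_le_max_right _ hxs)).trans ?_
    gcongr
    have e1 : x ≤ max x a := le_max_left _ _
    have e2 : max s a ≤ s + d := max_le (by linarith) (by linarith)
    nlinarith
  · have h1Q : 1 - Q = X a * (1 - P) * Y a := by
      rw [mul_sub, sub_mul, mul_one, hXY a ha]
    rw [h1Q, mul_assoc (K * C * K), ← Real.exp_add]
    refine hmove _ x s _ hx (hx.trans hxs) ?_
    rw [← hconj (1 - P) _ _ (ha.trans_le (le_max_right _ _)) (ha.trans_le (le_max_right _ _))]
    refine (h₂ _ _ (le_max_right _ _) (max_le_max_right _ hxs)).trans ?_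
    gcongr
    have e1 : s ≤ max s a := le_max_left _ _
    have e2 : max x a ≤ x + d := max_le (by linarith) (by linarith)
    nlinarith

end Existence

/-! ### Commuting projections onto two given subspaces. -/

section Projections

variable {V : Type*} [NormedAddCommGroup V] [InnerProductSpace ℝ V] [FiniteDimensional ℝ V]

/-- Let I = U ∩ W and let U' be the orthogonal complement of I in U; then U' meets W only in 0. Take
P onto W along a complement containing U', and Q = pr_I P + pr_U' (1 - P). Then PQ = QP = pr_I P.
This provides a dichotomy pair for the solvability criterion, where no splitting is given. -/
theorem exists_commuting_projections (U W : Submodule ℝ V) :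
    ∃ P Q : V →L[ℝ] V, P * P = P ∧ Q * Q = Q ∧ P * Q = Q * P ∧ rg P = W ∧ rg Q = U := by
  set I := U ⊓ W with hI
  set U' := U ⊓ Iᗮ with hU'
  have hdisj : Disjoint U' W := by
    rw [Submodule.disjoint_def]
    intro v hv hvW
    have h1 : v ∈ I := ⟨hv.1, hvW⟩
    exact (Submodule.mem_orthogonal _ _).1 hv.2 v h1 |> inner_self_eq_zero.1
  obtain ⟨W', hW', hcompl⟩ := hdisj.exists_isCompl
  set P : V →L[ℝ] V := LinearMap.toContinuousLinearMap (W.projection W' hcompl.symm) with hP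
  have hPmem : ∀ v, P v ∈ W := fun v => Submodule.projection_apply_mem hcompl.symm v
  have hPself : ∀ v ∈ W, P v = v := fun v hv => Submodule.projection_apply_of_mem_left _ hv
  have hPzero : ∀ v ∈ U', P v = 0 := fun v hv =>
    (Submodule.projection_apply_eq_zero_iff hcompl.symm).2 (hW' hv)
  have hIself : ∀ v ∈ I, I.starProjection v = v := fun v hv =>
    Submodule.starProjection_eq_self_iff.2 hv
  have hU'self : ∀ v ∈ U', U'.starProjection v = v := fun v hv =>
    Submodule.starProjection_eq_self_iff.2 hv
  set Q : V →L[ℝ] V := I.starProjection * P + U'.starProjection * (1 - P) with hQ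
  have hQapply : ∀ v, Q v = I.starProjection (P v) + U'.starProjection (v - P v) := fun v => rfl
  have hQsum : ∀ a ∈ I, ∀ b ∈ U', P (a + b) = a ∧ Q (a + b) = a + b := by
    intro a ha b hb
    have h1 : P (a + b) = a := by rw [map_add, hPself a ha.2, hPzero b hb, add_zero]
    refine ⟨h1, ?_⟩
    rw [hQapply, h1, hIself a ha, add_sub_cancel_left, hU'self b hb]
  have hmemI : ∀ v, I.starProjection v ∈ I := fun v => Submodule.starProjection_apply_mem _ _
  have hmemU' : ∀ v, U'.starProjection v ∈ U' := fun v => Submodule.starProjection_apply_mem _ _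
  refine ⟨P, Q, ?_, ?_, ?_, ?_, ?_⟩
  · ext v
    exact hPself _ (hPmem v)
  · ext v
    exact (hQsum _ (hmemI (P v)) _ (hmemU' (v - P v))).2
  · ext v
    change P (Q v) = Q (P v)
    rw [hQapply (P v), hPself _ (hPmem v), sub_self, map_zero, add_zero]
    exact (hQsum _ (hmemI (P v)) _ (hmemU' (v - P v))).1
  · refine le_antisymm ?_ fun v hv => ⟨v, hPself v hv⟩
    rintro _ ⟨v, rfl⟩
    exact hPmem v
  · refine le_antisymm ?_ fun v hv => ?_
    · rintro _ ⟨v, rfl⟩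
      exact U.add_mem (hmemI (P v)).1 (hmemU' (v - P v)).1
    · have h1 : v - I.starProjection v ∈ U' :=
        ⟨U.sub_mem hv (hmemI v).1, Submodule.sub_starProjection_mem_orthogonal v⟩
      have h2 := (hQsum _ (hmemI v) _ h1).2
      rw [add_sub_cancel] at h2
      exact ⟨v, h2⟩

end Projections

/-! ### Growth of solutions identifies the ranges; two-sided dichotomies. -/

section Core

variable {V : Type*} [NormedAddCommGroup V] [InnerProductSpace ℝ V] [FiniteDimensional ℝ V]
  {A : V →L[ℝ] V} {B : ℝ → V →L[ℝ] V} {x₀ α γ K : ℝ} {P Q : V →L[ℝ] V}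

theorem ZeroDichotomy.mono {Y X : ℝ → V →L[ℝ] V} (h : ZeroDichotomy Y X x₀ α K P) {K' : ℝ}
    (hK : K ≤ K') : ZeroDichotomy Y X x₀ α K' P :=
  ⟨h.idem, fun x s hx hxs hs => (h.le_left x s hx hxs hs).trans
      (mul_le_mul_of_nonneg_right hK (Real.rpow_nonneg (div_pos hx (hx.trans_le hxs)).le _)),
    fun x s hs hxs hx => (h.le_right x s hs hxs hx).trans
      (mul_le_mul_of_nonneg_right hK (Real.rpow_nonneg (div_pos (hs.trans_le hxs) hs).le _))⟩

theorem InftyDichotomy.mono {Y X : ℝ → V →L[ℝ] V} (h : InftyDichotomy Y X x₀ γ K P) {K' : ℝ}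
    (hK : K ≤ K') : InftyDichotomy Y X x₀ γ K' P :=
  ⟨h.idem, fun x s hs hxs => (h.le_left x s hs hxs).trans
      (mul_le_mul_of_nonneg_right hK (Real.exp_pos _).le),
    fun x s hs hxs => (h.le_right x s hs hxs).trans
      (mul_le_mul_of_nonneg_right hK (Real.exp_pos _).le)⟩

/-- Solutions that are `O(x)` at zero start in the range of the projection. -/
theorem ZeroDichotomy.apply_eq_self (hB : ContinuousOn B (Ici 0)) (hx₀ : 0 < x₀) (hα : 0 < α)
    (h : ZeroDichotomy (evol A B x₀) (evolInv A B x₀) x₀ α K P) {v : V}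
    (hv : (fun x => evol A B x₀ x v) =O[𝓝[>] 0] fun x => x) : P v = v := by
  obtain ⟨c, hc⟩ := hv.bound
  have hlim : Tendsto (fun s : ℝ => K * x₀ ^ (1 - α) * c * s ^ α) (𝓝[>] 0) (𝓝 0) := by
    have : Tendsto (fun s : ℝ => s ^ α) (𝓝[>] 0) (𝓝 (0 ^ α)) :=
      ((Real.continuousAt_rpow_const 0 α (Or.inr hα.le)).tendsto).mono_left nhdsWithin_le_nhds
    rw [Real.zero_rpow hα.ne'] at this
    simpa using this.const_mul (K * x₀ ^ (1 - α) * c)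
  have hle : ∀ᶠ s in 𝓝[>] (0 : ℝ), ‖v - P v‖ ≤ K * x₀ ^ (1 - α) * c * s ^ α := by
    filter_upwards [hc, Ioo_mem_nhdsGT hx₀] with s hs hs0
    -- The component (1 - P)v is pulled back from a point s → 0: it is O((x₀/s)^(1-α) s) = O(s^α),
    -- hence zero.
    have e : v - P v = (evol A B x₀ x₀ * (1 - P) * evolInv A B x₀ s) (evol A B x₀ s v) := by
      have := congrArg (fun T : V →L[ℝ] V => T v) (evolInv_mul_evol (A := A) hB hx₀ hs0.1)
      have h2 : evolInv A B x₀ s (evol A B x₀ s v) = v := this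
      rw [evol_self hB, one_mul]
      change v - P v = (1 - P) (evolInv A B x₀ s (evol A B x₀ s v))
      rw [h2]
      rfl
    rw [e]
    refine (ContinuousLinearMap.le_opNorm _ _).trans ?_
    have h1 := h.le_right x₀ s hs0.1 hs0.2.le le_rfl
    rw [Real.norm_of_nonneg hs0.1.le] at hs
    calc _ ≤ (K * (x₀ / s) ^ (1 - α)) * (c * s) :=
          mul_le_mul h1 hs (norm_nonneg _) ((norm_nonneg _).trans h1)
      _ = K * x₀ ^ (1 - α) * c * (s / s ^ (1 - α)) := by
          rw [Real.div_rpow hx₀.le hs0.1.le]; ring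
      _ = _ := by
          congr 1
          rw [div_eq_iff (Real.rpow_pos_of_pos hs0.1 _).ne', ← Real.rpow_add hs0.1]
          simp
  have h0 : ‖v - P v‖ ≤ 0 := ge_of_tendsto hlim hle
  exact (sub_eq_zero.1 (norm_le_zero_iff.1 h0)).symm

theorem ZeroDichotomy.norm_evol_le (hB : ContinuousOn B (Ici 0)) (hx₀ : 0 < x₀)
    (h : ZeroDichotomy (evol A B x₀) (evolInv A B x₀) x₀ α K P) {x : ℝ} (hx : 0 < x)
    (hxx : x ≤ x₀) : ‖evol A B x₀ x * P‖ ≤ K * (x / x₀) ^ (1 + α) := by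
  have := h.le_left x x₀ hx hxx le_rfl
  rwa [evolInv_self hB hx₀, mul_one] at this

theorem ZeroDichotomy.norm_evolInv_le (hB : ContinuousOn B (Ici 0))
    (h : ZeroDichotomy (evol A B x₀) (evolInv A B x₀) x₀ α K P) {s : ℝ} (hs : 0 < s)
    (hss : s ≤ x₀) : ‖(1 - P) * evolInv A B x₀ s‖ ≤ K * (x₀ / s) ^ (1 - α) := by
  have := h.le_right x₀ s hs hss le_rfl
  rwa [evol_self hB, one_mul] at this

/-- The range does not depend on the dichotomy chosen. Therefore any projection known only to have
range 𝕍₊ inherits the estimates. -/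
theorem ZeroDichotomy.range_eq (hB : ContinuousOn B (Ici 0)) (hx₀ : 0 < x₀) (hα : 0 < α)
    (h : ZeroDichotomy (evol A B x₀) (evolInv A B x₀) x₀ α K P) : rg P = Vplus A B x₀ := by
  refine le_antisymm ?_ ?_
  · rintro _ ⟨v, rfl⟩
    refine ⟨α, K * ‖v‖, hα, fun x hx hxx => ?_⟩
    have := ((evol A B x₀ x * P).le_opNorm v).trans
      (mul_le_mul_of_nonneg_right (h.norm_evol_le hB hx₀ hx hxx) (norm_nonneg v))
    calc _ ≤ _ := this
      _ = _ := by ring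
  · rintro v ⟨α', c, hα', hv⟩
    refine ⟨v, h.apply_eq_self hB hx₀ hα (Asymptotics.IsBigO.of_bound (|c| / x₀) ?_)⟩
    filter_upwards [Ioo_mem_nhdsGT hx₀] with x hx
    refine (hv x hx.1 hx.2.le).trans ?_
    have hq : 0 < x / x₀ := div_pos hx.1 hx₀
    have h1 : (x / x₀) ^ (1 + α') ≤ x / x₀ := by
      conv_rhs => rw [← Real.rpow_one (x / x₀)]
      exact Real.rpow_le_rpow_of_exponent_ge hq ((div_le_one hx₀).2 hx.2.le) (by linarith)
    rw [Real.norm_of_nonneg hx.1.le]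
    calc _ ≤ |c| * (x / x₀) := mul_le_mul (le_abs_self c) h1 (by positivity) (abs_nonneg _)
      _ = _ := by ring

/-- Solutions bounded at infinity start in the range of the projection. -/
theorem InftyDichotomy.apply_eq_self (hB : ContinuousOn B (Ici 0)) (hx₀ : 0 < x₀) (hγ : 0 < γ)
    (h : InftyDichotomy (evol A B x₀) (evolInv A B x₀) x₀ γ K P) {v : V} {c : ℝ}
    (hv : ∀ᶠ x in atTop, ‖evol A B x₀ x v‖ ≤ c) : P v = v := by
  have hlim : Tendsto (fun s : ℝ => K * Real.exp (-γ * (s - x₀)) * c) atTop (𝓝 0) := by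
    have h1 : Tendsto (fun s : ℝ => -γ * (s - x₀)) atTop atBot :=
      (tendsto_atTop_add_const_right _ (-x₀) tendsto_id).const_mul_atTop_of_neg (neg_lt_zero.2 hγ)
    have := ((Real.tendsto_exp_atBot.comp h1).const_mul K).mul_const c
    simpa using this
  have hle : ∀ᶠ s in atTop, ‖v - P v‖ ≤ K * Real.exp (-γ * (s - x₀)) * c := by
    filter_upwards [hv, eventually_ge_atTop x₀] with s hs hs0
    have e : v - P v = (evol A B x₀ x₀ * (1 - P) * evolInv A B x₀ s) (evol A B x₀ s v) := by
      have := congrArg (fun T : V →L[ℝ] V => T v)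
        (evolInv_mul_evol (A := A) hB hx₀ (hx₀.trans_le hs0))
      have h2 : evolInv A B x₀ s (evol A B x₀ s v) = v := this
      rw [evol_self hB, one_mul]
      change v - P v = (1 - P) (evolInv A B x₀ s (evol A B x₀ s v))
      rw [h2]
      rfl
    rw [e]
    refine (ContinuousLinearMap.le_opNorm _ _).trans ?_
    have h1 := h.le_right x₀ s le_rfl hs0
    exact mul_le_mul h1 hs (norm_nonneg _) ((norm_nonneg _).trans h1)
  have h0 : ‖v - P v‖ ≤ 0 := ge_of_tendsto hlim hle
  exact (sub_eq_zero.1 (norm_le_zero_iff.1 h0)).symm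

theorem InftyDichotomy.norm_evol_le (hB : ContinuousOn B (Ici 0)) (hx₀ : 0 < x₀)
    (h : InftyDichotomy (evol A B x₀) (evolInv A B x₀) x₀ γ K P) {x : ℝ} (hx : x₀ ≤ x) :
    ‖evol A B x₀ x * P‖ ≤ K * Real.exp (-γ * (x - x₀)) := by
  have := h.le_left x x₀ le_rfl hx
  rwa [evolInv_self hB hx₀, mul_one] at this

theorem InftyDichotomy.norm_evolInv_le (hB : ContinuousOn B (Ici 0))
    (h : InftyDichotomy (evol A B x₀) (evolInv A B x₀) x₀ γ K P) {s : ℝ} (hs : x₀ ≤ s) :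
    ‖(1 - P) * evolInv A B x₀ s‖ ≤ K * Real.exp (-γ * (s - x₀)) := by
  have := h.le_right x₀ s le_rfl hs
  rwa [evol_self hB, one_mul] at this

theorem InftyDichotomy.range_eq (hB : ContinuousOn B (Ici 0)) (hx₀ : 0 < x₀) (hγ : 0 < γ)
    (h : InftyDichotomy (evol A B x₀) (evolInv A B x₀) x₀ γ K P) : rg P = Uminus A B x₀ := by
  refine le_antisymm ?_ ?_
  · rintro _ ⟨v, rfl⟩
    refine ⟨γ, K * ‖v‖, hγ, fun x hx => ?_⟩
    have := ((evol A B x₀ x * P).le_opNorm v).trans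
      (mul_le_mul_of_nonneg_right (h.norm_evol_le hB hx₀ hx) (norm_nonneg v))
    calc _ ≤ _ := this
      _ = _ := by ring
  · rintro v ⟨γ', c, hγ', hv⟩
    refine ⟨v, h.apply_eq_self hB hx₀ hγ (c := |c|) ?_⟩
    filter_upwards [eventually_ge_atTop x₀] with x hx
    refine (hv x hx).trans ?_
    calc _ ≤ |c| * 1 := mul_le_mul (le_abs_self c)
          (Real.exp_le_one_iff.2 (by nlinarith)) (Real.exp_pos _).le (abs_nonneg _)
      _ = _ := mul_one _

/-- A pair of commuting dichotomy projections: `P` at zero and `Q` at infinity. -/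
structure TwoSided (A : V →L[ℝ] V) (B : ℝ → V →L[ℝ] V) (x₀ α γ K : ℝ) (P Q : V →L[ℝ] V) :
    Prop where
  cont : ContinuousOn B (Ici 0)
  pos : 0 < x₀
  alpha_pos : 0 < α
  gamma_pos : 0 < γ
  comm : P * Q = Q * P
  zero : ZeroDichotomy (evol A B x₀) (evolInv A B x₀) x₀ α K P
  infty : InftyDichotomy (evol A B x₀) (evolInv A B x₀) x₀ γ K Q

/-- Some dichotomy exists at each end; by uniqueness of the ranges and change of projection, the
prescribed commuting pair shares its estimates, with a common constant. -/
theorem exists_twoSided (hB : ContinuousOn B (Ici 0))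
    (hBb : ∃ C : ℝ, ∀ x : ℝ, 0 ≤ x → ‖B x‖ ≤ C) (hA : ∀ z : ℂ, IsCharRoot A z → z.re ≠ 1)
    (hD : ∃ a : ℝ, 0 < a ∧ IsExpDichotomic A B a) (hx₀ : 0 < x₀)
    (hP : P * P = P) (hQ : Q * Q = Q) (hPQ : P * Q = Q * P) (hPr : rg P = Vplus A B x₀)
    (hQr : rg Q = Uminus A B x₀) :
    ∃ α γ K, TwoSided A B x₀ α γ K P Q := by
  obtain ⟨α, K₁, P', hα, -, hP'⟩ := exists_zeroDichotomy hB hBb hA hx₀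
  obtain ⟨γ, K₂, Q', hγ, hQ'⟩ := exists_inftyDichotomy hB hx₀ hD
  have h1 := hP'.change hx₀ hα (evol_self hB) (evolInv_self hB hx₀) hP
    (hPr.trans (hP'.range_eq hB hx₀ hα).symm)
  have h2 := hQ'.change hγ (evol_self hB) (evolInv_self hB hx₀) hQ
    (hQr.trans (hQ'.range_eq hB hx₀ hγ).symm)
  exact ⟨α, γ, _, hB, hx₀, hα, hγ, hPQ, h1.mono (le_max_left _ _), h2.mono (le_max_right _ _)⟩

end Core

/-! ### The scale-invariant weight at zero and exponential averages at infinity. -/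

section Weights

/-- The scale-invariant weight `u ^ (α - 1)` on `(0, 1]`, `u ^ (-1 - α)` on `(1, ∞)`. -/
noncomputable def rho (α u : ℝ) : ℝ := if u ≤ 1 then u ^ (α - 1) else u ^ (-1 - α)

variable {α γ : ℝ}

theorem rho_nonneg {u : ℝ} (hu : 0 ≤ u) : 0 ≤ rho α u := by
  rw [rho]; split_ifs <;> exact Real.rpow_nonneg hu _

theorem integrableOn_rho (hα : 0 < α) : IntegrableOn (rho α) (Ioi 0) := by
  rw [← Ioc_union_Ioi_eq_Ioi (zero_le_one (α := ℝ))]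
  refine IntegrableOn.union ?_ ?_
  · have h := (intervalIntegral.intervalIntegrable_rpow' (a := 0) (b := 1) (r := α - 1)
      (by linarith)).1
    refine h.congr_fun (fun u hu => ?_) measurableSet_Ioc
    simp [rho, hu.2]
  · refine (integrableOn_Ioi_rpow_of_lt (a := -1 - α) (by linarith) one_pos).congr_fun
      (fun u hu => ?_) measurableSet_Ioi
    have hu' : ¬ u ≤ 1 := not_le.2 hu
    simp [rho, hu']

theorem integrableOn_rho_div (hα : 0 < α) {c : ℝ} (hc : 0 < c) :
    IntegrableOn (fun s => rho α (s / c)) (Ioi 0) := by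
  have := (integrableOn_Ioi_comp_mul_left_iff (rho α) 0 (inv_pos.2 hc)).2
    (by simpa using integrableOn_rho hα)
  simpa only [div_eq_inv_mul] using this

/-- The substitution s = c u. The factor c is the source of every O(x) estimate at zero. -/
theorem integral_rho_div (φ : ℝ → ℝ) {c : ℝ} (hc : 0 < c) :
    ∫ s in Ioi (0 : ℝ), rho α (s / c) * φ s = c * ∫ u in Ioi (0 : ℝ), rho α u * φ (c * u) := by
  have := integral_comp_mul_left_Ioi (fun s => rho α (s / c) * φ s) 0 hc
  rw [mul_zero] at this
  simp only [mul_div_cancel_left₀ _ hc.ne'] at this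
  rw [this, smul_eq_mul, mul_inv_cancel_left₀ hc.ne']

/-- Together with the next lemma, this merges the two rates of the dichotomy at zero into one
function of s/x. -/
theorem rpow_one_sub_eq_rho {x s : ℝ} (hs : 0 < s) (hsx : s ≤ x) :
    (x / s) ^ (1 - α) = rho α (s / x) := by
  have hx := hs.trans_le hsx
  rw [rho, if_pos ((div_le_one hx).2 hsx), ← inv_div x s, Real.inv_rpow (div_pos hx hs).le,
    ← Real.rpow_neg (div_pos hx hs).le]
  congr 1; ring

theorem rpow_one_add_eq_rho {x s : ℝ} (hx : 0 < x) (hsx : x < s) :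
    (x / s) ^ (1 + α) = rho α (s / x) := by
  have hs := hx.trans hsx
  rw [rho, if_neg (not_le.2 ((one_lt_div hx).2 hsx)), ← inv_div x s,
    Real.inv_rpow (div_pos hx hs).le, ← Real.rpow_neg (div_pos hx hs).le]
  congr 1; ring

theorem integrable_exp_neg_abs (hγ : 0 < γ) : Integrable fun u : ℝ => Real.exp (-γ * |u|) := by
  rw [← integrableOn_univ, ← Iic_union_Ioi (a := (0 : ℝ))]
  refine IntegrableOn.union ?_ ?_
  · refine (integrableOn_exp_mul_Iic hγ 0).congr_fun (fun u hu => ?_) measurableSet_Iic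
    simp [abs_of_nonpos (mem_Iic.1 hu)]
  · refine (integrableOn_exp_mul_Ioi (neg_lt_zero.2 hγ) 0).congr_fun (fun u hu => ?_)
      measurableSet_Ioi
    simp [abs_of_pos (mem_Ioi.1 hu)]

theorem integrable_exp_neg_abs_sub (hγ : 0 < γ) (x : ℝ) :
    Integrable fun s : ℝ => Real.exp (-γ * |s - x|) :=
  (integrable_exp_neg_abs hγ).comp_sub_right x

theorem integral_exp_neg_abs_sub_le (hγ : 0 < γ) (x : ℝ) :
    ∫ s in Ioi (0 : ℝ), Real.exp (-γ * |s - x|) ≤ ∫ u : ℝ, Real.exp (-γ * |u|) := by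
  rw [← integral_sub_right_eq_self (fun u => Real.exp (-γ * |u|)) x]
  exact setIntegral_le_integral (integrable_exp_neg_abs_sub hγ x)
    (ae_of_all _ fun s => (Real.exp_pos _).le)

/-- Averages against `rho α (s / x) ds / x` of a bounded function vanishing at zero vanish in the
limit. -/
theorem tendsto_integral_rho (hα : 0 < α) {φ : ℝ → ℝ}
    (hm : ∀ x, 0 < x → AEStronglyMeasurable (fun u => φ (x * u)) (volume.restrict (Ioi 0)))
    {M : ℝ} (hM : ∀ s, 0 < s → ‖φ s‖ ≤ M) (h0 : Tendsto φ (𝓝[>] 0) (𝓝 0)) :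
    Tendsto (fun x => (∫ s in Ioi (0 : ℝ), rho α (s / x) * φ s) / x) (𝓝[>] 0) (𝓝 0) := by
  have hmain : Tendsto (fun x => ∫ u in Ioi (0 : ℝ), rho α u * φ (x * u)) (𝓝[>] 0)
      (𝓝 (∫ u in Ioi (0 : ℝ), (0 : ℝ))) := by
    refine tendsto_integral_filter_of_dominated_convergence (fun u => rho α u * M) ?_ ?_
      ((integrableOn_rho hα).mul_const M) ?_
    · filter_upwards [self_mem_nhdsWithin] with x hx
      exact (integrableOn_rho hα).aestronglyMeasurable.mul (hm x hx)
    · filter_upwards [self_mem_nhdsWithin] with x hx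
      refine (ae_restrict_iff' measurableSet_Ioi).2 (ae_of_all _ fun u hu => ?_)
      rw [norm_mul, Real.norm_of_nonneg (rho_nonneg (le_of_lt hu))]
      exact mul_le_mul_of_nonneg_left (hM _ (mul_pos hx hu)) (rho_nonneg (le_of_lt hu))
    · refine (ae_restrict_iff' measurableSet_Ioi).2 (ae_of_all _ fun u hu => ?_)
      have h1 : Tendsto (fun x : ℝ => x * u) (𝓝[>] 0) (𝓝[>] 0) := by
        refine tendsto_nhdsWithin_iff.2 ⟨?_, ?_⟩
        · have : Tendsto (fun x : ℝ => x * u) (𝓝 0) (𝓝 (0 * u)) :=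
            (continuous_id.mul continuous_const).tendsto 0
          rw [zero_mul] at this
          exact this.mono_left nhdsWithin_le_nhds
        · filter_upwards [self_mem_nhdsWithin] with x hx using mul_pos (mem_Ioi.1 hx) (mem_Ioi.1 hu)
      simpa using (h0.comp h1).const_mul (rho α u)
  rw [integral_zero] at hmain
  refine hmain.congr' ?_
  filter_upwards [self_mem_nhdsWithin] with x hx
  rw [integral_rho_div φ hx, mul_div_cancel_left₀ _ (ne_of_gt hx)]

/-- Exponential averages of a bounded function vanishing at infinity vanish in the limit. -/
theorem tendsto_integral_exp_neg_abs (hγ : 0 < γ) {φ : ℝ → ℝ}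
    (hm : AEStronglyMeasurable φ (volume.restrict (Ioi 0)))
    {M : ℝ} (hM : ∀ s, 0 < s → ‖φ s‖ ≤ M) (h0 : Tendsto φ atTop (𝓝 0)) :
    Tendsto (fun x => ∫ s in Ioi (0 : ℝ), Real.exp (-γ * |s - x|) * φ s) atTop (𝓝 0) := by
  -- Extension by zero permits the translation s = u + x, after which dominated convergence applies
  -- with a fixed weight.
  set ψ : ℝ → ℝ := (Ioi (0 : ℝ)).indicator φ with hψ
  have hψm : AEStronglyMeasurable ψ volume := (aestronglyMeasurable_indicator_iff measurableSet_Ioi).2 hm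
  have hM0 : 0 ≤ M := (norm_nonneg _).trans (hM 1 one_pos)
  have hψM : ∀ s, ‖ψ s‖ ≤ M := fun s => by
    by_cases hs : s ∈ Ioi (0 : ℝ)
    · rw [hψ, indicator_of_mem hs]; exact hM s hs
    · rw [hψ, indicator_of_notMem hs]; simpa using hM0
  have hψ0 : Tendsto ψ atTop (𝓝 0) := by
    refine h0.congr' ?_
    filter_upwards [eventually_gt_atTop (0 : ℝ)] with s hs
    rw [hψ, indicator_of_mem (show s ∈ Ioi (0 : ℝ) from hs)]
  have heq : ∀ x, ∫ s in Ioi (0 : ℝ), Real.exp (-γ * |s - x|) * φ s =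
      ∫ u : ℝ, Real.exp (-γ * |u|) * ψ (u + x) := by
    intro x
    rw [← integral_indicator measurableSet_Ioi,
      ← integral_add_right_eq_self (fun s => (Ioi (0 : ℝ)).indicator
        (fun s => Real.exp (-γ * |s - x|) * φ s) s) x]
    congr 1
    funext u
    by_cases hu : u + x ∈ Ioi (0 : ℝ)
    · rw [indicator_of_mem hu, hψ, indicator_of_mem hu, add_sub_cancel_right]
    · rw [indicator_of_notMem hu, hψ, indicator_of_notMem hu, mul_zero]
  simp only [heq]
  have hmain : Tendsto (fun x => ∫ u : ℝ, Real.exp (-γ * |u|) * ψ (u + x)) atTop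
      (𝓝 (∫ u : ℝ, (0 : ℝ))) := by
    refine tendsto_integral_filter_of_dominated_convergence (fun u => Real.exp (-γ * |u|) * M)
      (Eventually.of_forall fun x => ?_) (Eventually.of_forall fun x => ae_of_all _ fun u => ?_)
      ((integrable_exp_neg_abs hγ).mul_const M) (ae_of_all _ fun u => ?_)
    · exact (integrable_exp_neg_abs hγ).aestronglyMeasurable.mul
        (hψm.comp_measurePreserving (measurePreserving_add_right volume x))
    · rw [norm_mul, Real.norm_of_nonneg (Real.exp_pos _).le]
      exact mul_le_mul_of_nonneg_left (hψM _) (Real.exp_pos _).le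
    · have := (hψ0.comp (tendsto_atTop_add_const_left _ u tendsto_id)).const_mul
        (Real.exp (-γ * |u|))
      simpa using this
  simpa using hmain

end Weights

/-! ### The Green kernel of a pair of projections, with its estimates at zero and infinity. -/

section Kernel

variable {V : Type*} [NormedAddCommGroup V] [InnerProductSpace ℝ V] [FiniteDimensional ℝ V]
  {A : V →L[ℝ] V} {B : ℝ → V →L[ℝ] V} {x₀ α γ K : ℝ} {P Q : V →L[ℝ] V}

/-- The part of the kernel that does not depend on the position of `x`. -/
noncomputable def kbase (A : V →L[ℝ] V) (B : ℝ → V →L[ℝ] V) (x₀ : ℝ) (P Q : V →L[ℝ] V) (s : ℝ) :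
    V →L[ℝ] V :=
  if s < x₀ then Q * (1 - P) * evolInv A B x₀ s else -((1 - Q) * evolInv A B x₀ s)

/-- The density of the oriented interval from `x₀` to `x`. -/
noncomputable def kstep (x₀ x s : ℝ) : ℝ := (if s ≤ x then 1 else 0) - if s < x₀ then 1 else 0

/-- The kernel built from two commuting projections. -/
noncomputable def kern (A : V →L[ℝ] V) (B : ℝ → V →L[ℝ] V) (x₀ : ℝ) (P Q : V →L[ℝ] V) (x s : ℝ) :
    V →L[ℝ] V :=
  evol A B x₀ x * (kbase A B x₀ P Q s + kstep x₀ x s • evolInv A B x₀ s)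

/-- The kernel corrected by `Y(x) (1 - Q) (1 - P) Y⁻¹(s)`, which is small at `x = 0`. -/
noncomputable def kern₀ (A : V →L[ℝ] V) (B : ℝ → V →L[ℝ] V) (x₀ : ℝ) (P Q : V →L[ℝ] V)
    (x s : ℝ) : V →L[ℝ] V :=
  kern A B x₀ P Q x s + evol A B x₀ x * ((1 - Q) * (1 - P) * evolInv A B x₀ s)

/-- A dichotomy at zero with projection `P`, and a commuting operator `Q` such that
`(1 - Q) Y⁻¹` decays at infinity. -/
structure LeftSided (A : V →L[ℝ] V) (B : ℝ → V →L[ℝ] V) (x₀ α γ K : ℝ) (P Q : V →L[ℝ] V) :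
    Prop where
  cont : ContinuousOn B (Ici 0)
  pos : 0 < x₀
  alpha_pos : 0 < α
  gamma_pos : 0 < γ
  comm : P * Q = Q * P
  zero : ZeroDichotomy (evol A B x₀) (evolInv A B x₀) x₀ α K P
  right : ∀ s, x₀ ≤ s → ‖(1 - Q) * evolInv A B x₀ s‖ ≤ K * Real.exp (-γ * (s - x₀))

theorem TwoSided.leftSided (h : TwoSided A B x₀ α γ K P Q) : LeftSided A B x₀ α γ K P Q :=
  ⟨h.cont, h.pos, h.alpha_pos, h.gamma_pos, h.comm, h.zero,
    fun _ hs => h.infty.norm_evolInv_le h.cont hs⟩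

/-- With Q = 1 the decay requirement at infinity is empty and the defect vanishes. This gives a
particular solution near zero from the dichotomy at zero alone, as needed for regularity. -/
theorem ZeroDichotomy.leftSided_one (hB : ContinuousOn B (Ici 0)) (hx₀ : 0 < x₀) (hα : 0 < α)
    (h : ZeroDichotomy (evol A B x₀) (evolInv A B x₀) x₀ α K P) :
    LeftSided A B x₀ α 1 K P 1 :=
  ⟨hB, hx₀, hα, one_pos, by rw [mul_one, one_mul], h, fun s _ => by
    rw [sub_self, zero_mul, norm_zero]
    exact mul_nonneg (h.nonneg hx₀) (Real.exp_pos _).le⟩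

theorem aestronglyMeasurable_evolInv (hB : ContinuousOn B (Ici 0)) (hx₀ : 0 < x₀) :
    AEStronglyMeasurable (evolInv A B x₀) (volume.restrict (Ioi 0)) :=
  (continuousOn_evolInv hB hx₀).aestronglyMeasurable measurableSet_Ioi

theorem aestronglyMeasurable_evol (hB : ContinuousOn B (Ici 0)) :
    AEStronglyMeasurable (evol A B x₀) (volume.restrict (Ioi 0)) :=
  (continuousOn_evol hB).aestronglyMeasurable measurableSet_Ioi

theorem aestronglyMeasurable_kbase (hB : ContinuousOn B (Ici 0)) (hx₀ : 0 < x₀) :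
    AEStronglyMeasurable (kbase A B x₀ P Q) (volume.restrict (Ioi 0)) := by
  have e : kbase A B x₀ P Q = (Iio x₀).indicator (fun s => Q * (1 - P) * evolInv A B x₀ s) +
      (Ici x₀).indicator (fun s => -((1 - Q) * evolInv A B x₀ s)) := by
    funext s
    by_cases hs : s < x₀
    · simp [kbase, hs]
    · simp [kbase, hs, not_lt.1 hs]
  rw [e]
  exact (((aestronglyMeasurable_const.mul (aestronglyMeasurable_evolInv hB hx₀))).indicator
    measurableSet_Iio).add
    ((aestronglyMeasurable_const.mul (aestronglyMeasurable_evolInv hB hx₀)).neg.indicator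
    measurableSet_Ici)

section Integrals

variable {E : Type*} [NormedAddCommGroup E] [NormedSpace ℝ E]

theorem kstep_smul_integral {φ : ℝ → E} (hφ : ContinuousOn φ (Ioi 0)) (hx₀ : 0 < x₀) {x : ℝ}
    (hx : 0 < x) : IntegrableOn (fun s => kstep x₀ x s • φ s) (Ioi 0) ∧
      ∫ s in Ioi (0 : ℝ), kstep x₀ x s • φ s = ∫ s in x₀..x, φ s := by
  rcases le_or_gt x₀ x with h | h
  · have e : (fun s => kstep x₀ x s • φ s) = (Icc x₀ x).indicator φ := by
      funext s
      by_cases h1 : x₀ ≤ s <;> by_cases h2 : s ≤ x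
      · simp [kstep, h1, h2, not_lt.2 h1]
      · simp [kstep, h1, h2, not_lt.2 h1]
      · simp [kstep, h1, h2, not_le.1 h1]
      · exact absurd ((not_le.1 h1).le.trans h) h2
    have hsub : Icc x₀ x ⊆ Ioi 0 := fun s hs => hx₀.trans_le hs.1
    have hInt : IntegrableOn φ (Icc x₀ x) := (hφ.mono hsub).integrableOn_Icc
    rw [e]
    refine ⟨((integrable_indicator_iff measurableSet_Icc).2 hInt).integrableOn, ?_⟩
    rw [setIntegral_indicator measurableSet_Icc, inter_eq_right.2 hsub, integral_Icc_eq_integral_Ioc,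
      intervalIntegral.integral_of_le h]
  · have e : (fun s => kstep x₀ x s • φ s) = fun s => -(Ioo x x₀).indicator φ s := by
      funext s
      by_cases h1 : s < x₀ <;> by_cases h2 : s ≤ x
      · simp [kstep, h1, h2, not_lt.2 h2]
      · simp [kstep, h1, h2, not_le.1 h2]
      · exact absurd (h2.trans_lt h) h1
      · simp [kstep, h1, h2]
    have hsub : Ioo x x₀ ⊆ Ioi 0 := fun s hs => hx.trans hs.1
    have hInt : IntegrableOn φ (Ioo x x₀) :=
      ((hφ.mono fun s (hs : s ∈ Icc x x₀) => hx.trans_le hs.1).integrableOn_Icc).mono_set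
        Ioo_subset_Icc_self
    rw [e]
    refine ⟨((integrable_indicator_iff measurableSet_Ioo).2 hInt).integrableOn.neg, ?_⟩
    rw [integral_neg, setIntegral_indicator measurableSet_Ioo, inter_eq_right.2 hsub,
      ← integral_Ioc_eq_integral_Ioo, intervalIntegral.integral_of_ge h.le]

end Integrals

namespace LeftSided

variable {W : Type*} [NormedAddCommGroup W] [NormedSpace ℝ W] {f : ℝ → W →L[ℝ] V} {M : ℝ}

theorem nonneg (h : LeftSided A B x₀ α γ K P Q) : 0 ≤ K := h.zero.nonneg h.pos

theorem norm_left_le (h : LeftSided A B x₀ α γ K P Q) {s : ℝ} (hs : 0 < s) (hsx : s ≤ x₀) :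
    ‖(1 - P) * evolInv A B x₀ s‖ ≤ K * rho α (s / x₀) := by
  rw [← rpow_one_sub_eq_rho hs hsx]
  exact h.zero.norm_evolInv_le h.cont hs hsx

theorem norm_right_le (h : LeftSided A B x₀ α γ K P Q) {s : ℝ} (hs : x₀ ≤ s) :
    ‖(1 - Q) * evolInv A B x₀ s‖ ≤ K * Real.exp (-γ * |s - x₀|) := by
  rw [abs_of_nonneg (sub_nonneg.2 hs)]
  exact h.right s hs

theorem integrableOn_weight (h : LeftSided A B x₀ α γ K P Q) (c d : ℝ) {x y : ℝ} (hx : 0 < x) :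
    IntegrableOn (fun s => c * rho α (s / x) + d * Real.exp (-γ * |s - y|)) (Ioi 0) :=
  ((integrableOn_rho_div h.alpha_pos hx).const_mul c).add
    ((integrable_exp_neg_abs_sub h.gamma_pos y).integrableOn.const_mul d)

/-- Serves both `kbase` and the defect: each factors through (1 - P)Y⁻¹ left of x₀ and through (1 -
Q)Y⁻¹ right of it, where these are integrable. -/
theorem norm_le_weight (h : LeftSided A B x₀ α γ K P Q) (T S : V →L[ℝ] V) {R : V →L[ℝ] V} {s : ℝ}
    (hs : 0 < s) (hlt : s < x₀ → R = T * ((1 - P) * evolInv A B x₀ s))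
    (hge : x₀ ≤ s → R = S * ((1 - Q) * evolInv A B x₀ s)) :
    ‖R‖ ≤ ‖T‖ * K * rho α (s / x₀) + ‖S‖ * K * Real.exp (-γ * |s - x₀|) := by
  have hK := h.nonneg
  have hρ : 0 ≤ rho α (s / x₀) := rho_nonneg (div_pos hs h.pos).le
  rcases lt_or_ge s x₀ with h1 | h1
  · rw [hlt h1]
    refine (norm_mul_le _ _).trans ?_
    have := mul_le_mul_of_nonneg_left (h.norm_left_le hs h1.le) (norm_nonneg T)
    have h2 : 0 ≤ ‖S‖ * K * Real.exp (-γ * |s - x₀|) := by positivity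
    linarith
  · rw [hge h1]
    refine (norm_mul_le _ _).trans ?_
    have := mul_le_mul_of_nonneg_left (h.norm_right_le h1) (norm_nonneg S)
    have h2 : 0 ≤ ‖T‖ * K * rho α (s / x₀) := by positivity
    linarith

theorem integrableOn_kbase (h : LeftSided A B x₀ α γ K P Q) :
    IntegrableOn (kbase A B x₀ P Q) (Ioi 0) := by
  refine Integrable.mono' (h.integrableOn_weight (‖Q‖ * K) (‖(-1 : V →L[ℝ] V)‖ * K)
    (x := x₀) (y := x₀) h.pos) (aestronglyMeasurable_kbase h.cont h.pos) ?_
  refine (ae_restrict_iff' measurableSet_Ioi).2 (ae_of_all _ fun s hs => ?_)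
  refine h.norm_le_weight Q (-1) hs (fun h1 => ?_) (fun h1 => ?_)
  · rw [kbase, if_pos h1, mul_assoc]
  · rw [kbase, if_neg (not_lt.2 h1), neg_mul, one_mul]

theorem integrableOn_defect (h : LeftSided A B x₀ α γ K P Q) :
    IntegrableOn (fun s => (1 - Q) * (1 - P) * evolInv A B x₀ s) (Ioi 0) := by
  refine Integrable.mono' (h.integrableOn_weight (‖1 - Q‖ * K) (‖1 - P‖ * K)
    (x := x₀) (y := x₀) h.pos)
    (aestronglyMeasurable_const.mul (aestronglyMeasurable_evolInv h.cont h.pos)) ?_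
  refine (ae_restrict_iff' measurableSet_Ioi).2 (ae_of_all _ fun s hs => ?_)
  refine h.norm_le_weight (1 - Q) (1 - P) hs (fun h1 => ?_) (fun h1 => ?_)
  · rw [mul_assoc]
  · rw [← mul_assoc]
    congr 1
    have := h.comm
    noncomm_ring
    rw [this]

theorem aestronglyMeasurable_of_continuousOn {E : Type*} [NormedAddCommGroup E] {f : ℝ → E}
    (hf : ContinuousOn f (Ici 0)) : AEStronglyMeasurable f (volume.restrict (Ioi 0)) :=
  (hf.mono Ioi_subset_Ici_self).aestronglyMeasurable measurableSet_Ioi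

theorem integrableOn_comp {T : ℝ → V →L[ℝ] V} (hT : IntegrableOn T (Ioi 0))
    (hf : ContinuousOn f (Ici 0)) (hM : ∀ s, 0 ≤ s → ‖f s‖ ≤ M) :
    IntegrableOn (fun s => T s ∘L f s) (Ioi 0) := by
  refine Integrable.mono' (hT.norm.mul_const M) ?_ ?_
  · exact (isBoundedBilinearMap_comp (𝕜 := ℝ) (E := W) (F := V) (G := V)).continuous
      |>.comp_aestronglyMeasurable₂ hT.aestronglyMeasurable (aestronglyMeasurable_of_continuousOn hf)
  · refine (ae_restrict_iff' measurableSet_Ioi).2 (ae_of_all _ fun s hs => ?_)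
    exact (ContinuousLinearMap.opNorm_comp_le _ _).trans
      (mul_le_mul_of_nonneg_left (hM s (le_of_lt hs)) (norm_nonneg _))

theorem continuousOn_evolInv_comp (h : LeftSided A B x₀ α γ K P Q) (hf : ContinuousOn f (Ici 0)) :
    ContinuousOn (fun s => evolInv A B x₀ s ∘L f s) (Ioi 0) :=
  (continuousOn_evolInv h.cont h.pos).clm_comp (hf.mono Ioi_subset_Ici_self)

theorem kern_comp_eq (x s : ℝ) : kern A B x₀ P Q x s ∘L f s = evol A B x₀ x ∘L
    (kbase A B x₀ P Q s ∘L f s + kstep x₀ x s • (evolInv A B x₀ s ∘L f s)) := by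
  rw [kern, ← ContinuousLinearMap.smul_comp, ← ContinuousLinearMap.add_comp]
  rfl

theorem integrableOn_kern_comp (h : LeftSided A B x₀ α γ K P Q) (hf : ContinuousOn f (Ici 0))
    (hM : ∀ s, 0 ≤ s → ‖f s‖ ≤ M) {x : ℝ} (hx : 0 < x) :
    IntegrableOn (fun s => kern A B x₀ P Q x s ∘L f s) (Ioi 0) := by
  simp only [kern_comp_eq]
  exact ((ContinuousLinearMap.compL ℝ W V V) (evol A B x₀ x)).integrable_comp
    ((integrableOn_comp h.integrableOn_kbase hf hM).add
    (kstep_smul_integral (h.continuousOn_evolInv_comp hf) h.pos hx).1)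

/-- Variation of constants formula for the kernel. -/
theorem integral_kern_comp (h : LeftSided A B x₀ α γ K P Q) (hf : ContinuousOn f (Ici 0))
    (hM : ∀ s, 0 ≤ s → ‖f s‖ ≤ M) {x : ℝ} (hx : 0 < x) :
    ∫ s in Ioi (0 : ℝ), kern A B x₀ P Q x s ∘L f s = evol A B x₀ x ∘L
      ((∫ s in Ioi (0 : ℝ), kbase A B x₀ P Q s ∘L f s) +
        ∫ s in x₀..x, evolInv A B x₀ s ∘L f s) := by
  have h1 := integrableOn_comp h.integrableOn_kbase hf hM
  have h2 := kstep_smul_integral (h.continuousOn_evolInv_comp hf) h.pos hx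
  simp only [kern_comp_eq]
  rw [← h2.2, ← integral_add h1 h2.1]
  exact ((ContinuousLinearMap.compL ℝ W V V) (evol A B x₀ x)).integral_comp_comm (h1.add h2.1)

theorem hasDerivAt_integral_kern (h : LeftSided A B x₀ α γ K P Q) (hf : ContinuousOn f (Ici 0))
    (hM : ∀ s, 0 ≤ s → ‖f s‖ ≤ M) {x : ℝ} (hx : 0 < x) :
    HasDerivAt (fun x => ∫ s in Ioi (0 : ℝ), kern A B x₀ P Q x s ∘L f s)
      (coeff A B x ∘L (∫ s in Ioi (0 : ℝ), kern A B x₀ P Q x s ∘L f s) + f x) x := by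
  have hc := h.continuousOn_evolInv_comp hf
  have hca : ContinuousAt (fun s => evolInv A B x₀ s ∘L f s) x := hc.continuousAt (Ioi_mem_nhds hx)
  have hInt : IntervalIntegrable (fun s => evolInv A B x₀ s ∘L f s) volume x₀ x :=
    (hc.mono fun s hs => (lt_min h.pos hx).trans_le hs.1).intervalIntegrable
  have d1 := (intervalIntegral.integral_hasDerivAt_right hInt
    (hc.stronglyMeasurableAtFilter isOpen_Ioi x hx) hca).const_add
    (∫ s in Ioi (0 : ℝ), kbase A B x₀ P Q s ∘L f s)
  have d2 := (hasDerivAt_evol (A := A) (x₀ := x₀) h.cont hx).clm_comp d1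
  rw [h.integral_kern_comp hf hM hx]
  refine (d2.congr_of_eventuallyEq ?_).congr_deriv ?_
  · filter_upwards [lt_mem_nhds hx] with z hz using h.integral_kern_comp hf hM hz
  · have := evol_mul_evolInv (A := A) h.cont h.pos hx
    have e : evol A B x₀ x ∘L (evolInv A B x₀ x ∘L f x) = f x := by
      change (evol A B x₀ x * evolInv A B x₀ x) ∘L f x = f x
      rw [this]; rfl
    rw [e]
    rfl

/-- Adding the defect completes Q(1 - P) to 1 - P. The next two formulas show the same effect for x
< s: what remains is the usual kernel of the dichotomy at zero, cut off by 1 - Q beyond x₀. -/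
theorem kern₀_of_le {x s : ℝ} (hx : x < x₀) (hs : s ≤ x) :
    kern₀ A B x₀ P Q x s = evol A B x₀ x * (1 - P) * evolInv A B x₀ s := by
  have h1 : s < x₀ := hs.trans_lt hx
  simp only [kern₀, kern, kbase, kstep, if_pos h1, if_pos hs, sub_self, zero_smul, add_zero]
  noncomm_ring

theorem kern₀_of_lt {x s : ℝ} (hs : x < s) (hsx : s < x₀) :
    kern₀ A B x₀ P Q x s = -(evol A B x₀ x * P * evolInv A B x₀ s) := by
  simp only [kern₀, kern, kbase, kstep, if_pos hsx, if_neg (not_le.2 hs), zero_sub, neg_smul,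
    one_smul]
  noncomm_ring

theorem kern₀_of_ge (h : LeftSided A B x₀ α γ K P Q) {x s : ℝ} (hx : x < x₀) (hs : x₀ ≤ s) :
    kern₀ A B x₀ P Q x s = -(evol A B x₀ x * P * ((1 - Q) * evolInv A B x₀ s)) := by
  have h1 : ¬ s ≤ x := not_le.2 (hx.trans_le hs)
  simp only [kern₀, kern, kbase, kstep, if_neg (not_lt.2 hs), if_neg h1, sub_self, zero_smul,
    add_zero]
  have e : (1 - Q) * (1 - P) = (1 - Q) - P * (1 - Q) := by
    have := h.comm
    noncomm_ring
    rw [this]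
  rw [e]
  noncomm_ring

theorem norm_kern₀_le (h : LeftSided A B x₀ α γ K P Q) {x s : ℝ} (hx : 0 < x) (hxx : x < x₀)
    (hs : 0 < s) : ‖kern₀ A B x₀ P Q x s‖ ≤
      K * rho α (s / x) + K * (x / x₀) ^ (1 + α) * K * Real.exp (-γ * |s - x₀|) := by
  have hK := h.nonneg
  have hx₀ := h.pos
  have hρ : 0 ≤ rho α (s / x) := rho_nonneg (div_pos hs hx).le
  have h2 : 0 ≤ K * (x / x₀) ^ (1 + α) * K * Real.exp (-γ * |s - x₀|) := by positivity
  rcases le_or_gt s x with h1 | h1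
  · rw [kern₀_of_le hxx h1]
    have := h.zero.le_right x s hs h1 hxx.le
    rw [rpow_one_sub_eq_rho hs h1] at this
    linarith
  rcases lt_or_ge s x₀ with h3 | h3
  · rw [kern₀_of_lt h1 h3, norm_neg]
    have := h.zero.le_left x s hx h1.le h3.le
    rw [rpow_one_add_eq_rho hx h1] at this
    linarith
  · rw [h.kern₀_of_ge hxx h3, norm_neg]
    have e1 := h.zero.norm_evol_le h.cont h.pos hx hxx.le
    have e2 := h.norm_right_le h3
    have := (norm_mul_le (evol A B x₀ x * P) ((1 - Q) * evolInv A B x₀ s)).trans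
      (mul_le_mul e1 e2 (norm_nonneg _) ((norm_nonneg _).trans e1))
    have h4 : 0 ≤ K * rho α (s / x) := by positivity
    linarith

theorem integrableOn_kern (h : LeftSided A B x₀ α γ K P Q) {x : ℝ} (hx : 0 < x) :
    IntegrableOn (kern A B x₀ P Q x) (Ioi 0) := by
  have := h.integrableOn_kern_comp (f := fun _ => (1 : V →L[ℝ] V)) (M := ‖(1 : V →L[ℝ] V)‖)
    continuousOn_const (fun _ _ => le_rfl) hx
  exact this

theorem integrableOn_kern₀ (h : LeftSided A B x₀ α γ K P Q) {x : ℝ} (hx : 0 < x) :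
    IntegrableOn (kern₀ A B x₀ P Q x) (Ioi 0) := by
  have h1 : Integrable (kern A B x₀ P Q x) (volume.restrict (Ioi 0)) := h.integrableOn_kern hx
  have h2 : Integrable (fun s => evol A B x₀ x * ((1 - Q) * (1 - P) * evolInv A B x₀ s))
    (volume.restrict (Ioi 0)) := Integrable.const_mul h.integrableOn_defect _
  exact Integrable.add (f := kern A B x₀ P Q x) h1 h2

/-- If `f` is orthogonal to the defect, the two kernels act on `f` in the same way up to the
defect. -/
theorem integral_kern₀_comp (h : LeftSided A B x₀ α γ K P Q) (hf : ContinuousOn f (Ici 0))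
    (hM : ∀ s, 0 ≤ s → ‖f s‖ ≤ M) {x : ℝ} (hx : 0 < x) :
    ∫ s in Ioi (0 : ℝ), kern₀ A B x₀ P Q x s ∘L f s =
      (∫ s in Ioi (0 : ℝ), kern A B x₀ P Q x s ∘L f s) + evol A B x₀ x ∘L
        ∫ s in Ioi (0 : ℝ), ((1 - Q) * (1 - P) * evolInv A B x₀ s) ∘L f s := by
  have h1 := integrableOn_comp h.integrableOn_defect hf hM
  have e := ((ContinuousLinearMap.compL ℝ W V V) (evol A B x₀ x)).integral_comp_comm h1
  change _ = (∫ s in Ioi (0 : ℝ), kern A B x₀ P Q x s ∘L f s) +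
    (ContinuousLinearMap.compL ℝ W V V) (evol A B x₀ x) _
  rw [← e, ← integral_add (h.integrableOn_kern_comp hf hM hx)
    (((ContinuousLinearMap.compL ℝ W V V) (evol A B x₀ x)).integrable_comp h1)]
  congr 1

theorem rpow_le_div (h : LeftSided A B x₀ α γ K P Q) {x : ℝ} (hx : 0 < x) (hxx : x < x₀) :
    (x / x₀) ^ (1 + α) ≤ x / x₀ := by
  conv_rhs => rw [← Real.rpow_one (x / x₀)]
  exact Real.rpow_le_rpow_of_exponent_ge (div_pos hx h.pos) ((div_le_one h.pos).2 hxx.le)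
    (by linarith [h.alpha_pos])

/-- The weight ρ(s/x) contributes a multiple of x by scaling; the tail carries (x/x₀)^(1+α) ≤ x/x₀.
-/
theorem exists_integral_norm_kern₀_le (h : LeftSided A B x₀ α γ K P Q) :
    ∃ C, 0 ≤ C ∧ ∀ x, 0 < x → x < x₀ → ∫ s in Ioi (0 : ℝ), ‖kern₀ A B x₀ P Q x s‖ ≤ C * x := by
  have hK := h.nonneg
  have hx₀ := h.pos
  set R := ∫ u in Ioi (0 : ℝ), rho α u with hR
  set E := ∫ u : ℝ, Real.exp (-γ * |u|) with hE
  have hR0 : 0 ≤ R := setIntegral_nonneg measurableSet_Ioi fun u hu => rho_nonneg (le_of_lt hu)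
  have hE0 : 0 ≤ E := integral_nonneg fun u => (Real.exp_pos _).le
  refine ⟨K * R + K * K * E / x₀, by positivity, fun x hx hxx => ?_⟩
  have hρ : ∫ s in Ioi (0 : ℝ), rho α (s / x) = x * R := by
    simpa using integral_rho_div (α := α) (fun _ => 1) hx
  calc _ ≤ ∫ s in Ioi (0 : ℝ), (K * rho α (s / x) +
        K * (x / x₀) ^ (1 + α) * K * Real.exp (-γ * |s - x₀|)) :=
        setIntegral_mono_on (h.integrableOn_kern₀ hx).norm (h.integrableOn_weight _ _ hx)
          measurableSet_Ioi fun s hs => h.norm_kern₀_le hx hxx hs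
    _ = K * (x * R) + K * (x / x₀) ^ (1 + α) * K *
        ∫ s in Ioi (0 : ℝ), Real.exp (-γ * |s - x₀|) := by
        rw [integral_add ((integrableOn_rho_div h.alpha_pos hx).const_mul K)
          ((integrable_exp_neg_abs_sub h.gamma_pos x₀).integrableOn.const_mul _),
          integral_const_mul, integral_const_mul, hρ]
    _ ≤ K * (x * R) + K * (x / x₀) * K * E := by
        gcongr
        · exact h.rpow_le_div hx hxx
        · exact integral_exp_neg_abs_sub_le h.gamma_pos x₀
    _ = _ := by ring

theorem norm_integral_comp_le {T : ℝ → V →L[ℝ] V} (hT : IntegrableOn T (Ioi 0))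
    (hM : ∀ s, 0 ≤ s → ‖f s‖ ≤ M) :
    ‖∫ s in Ioi (0 : ℝ), T s ∘L f s‖ ≤ M * ∫ s in Ioi (0 : ℝ), ‖T s‖ := by
  rw [← integral_const_mul]
  refine norm_integral_le_of_norm_le (hT.norm.const_mul M) ?_
  refine (ae_restrict_iff' measurableSet_Ioi).2 (ae_of_all _ fun s hs => ?_)
  refine (ContinuousLinearMap.opNorm_comp_le _ _).trans ?_
  rw [mul_comm]
  exact mul_le_mul_of_nonneg_right (hM s (le_of_lt hs)) (norm_nonneg _)

/-- The integral operator maps functions vanishing at zero to functions that are `o(x)`. -/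
theorem isLittleO_integral_kern₀ (h : LeftSided A B x₀ α γ K P Q) (hf : ContinuousOn f (Ici 0))
    (hM : ∀ s, 0 ≤ s → ‖f s‖ ≤ M) (hf0 : f 0 = 0) :
    Tendsto (fun x => ‖∫ s in Ioi (0 : ℝ), kern₀ A B x₀ P Q x s ∘L f s‖ / x) (𝓝[>] 0) (𝓝 0) := by
  have hK := h.nonneg
  have hx₀ := h.pos
  have hM0 : 0 ≤ M := (norm_nonneg _).trans (hM 0 le_rfl)
  set E := ∫ u : ℝ, Real.exp (-γ * |u|) with hE
  have hE0 : 0 ≤ E := integral_nonneg fun u => (Real.exp_pos _).le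
  have hlim0 : Tendsto (fun s => ‖f s‖) (𝓝[>] 0) (𝓝 0) := by
    have := (hf 0 self_mem_Ici).norm.tendsto
    rw [hf0, norm_zero] at this
    exact this.mono_left (nhdsWithin_mono _ Ioi_subset_Ici_self)
  have hmeas : ∀ x, 0 < x →
      AEStronglyMeasurable (fun u => ‖f (x * u)‖) (volume.restrict (Ioi 0)) := by
    intro x hx
    refine aestronglyMeasurable_of_continuousOn (ContinuousOn.norm (hf.comp (by fun_prop) ?_))
    intro u hu
    exact mul_nonneg hx.le hu
  -- Divided by x, the main part is a scaled average of ‖f‖ near zero and tends to f(0) = 0; the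
  -- tail is O(x^α).
  have t1 := (tendsto_integral_rho h.alpha_pos hmeas (M := M)
    (fun s hs => by simpa using hM s hs.le) hlim0).const_mul K
  have t2 : Tendsto (fun x : ℝ => K * K * M * E / x₀ * (x / x₀) ^ α) (𝓝[>] 0) (𝓝 0) := by
    have : Tendsto (fun x : ℝ => (x / x₀) ^ α) (𝓝[>] 0) (𝓝 ((0 / x₀) ^ α)) :=
      (((continuous_id.div_const x₀).tendsto 0).mono_left nhdsWithin_le_nhds).rpow_const
        (Or.inr h.alpha_pos.le)
    rw [zero_div, Real.zero_rpow h.alpha_pos.ne'] at this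
    simpa using this.const_mul (K * K * M * E / x₀)
  have t3 := t1.add t2
  rw [mul_zero, add_zero] at t3
  refine squeeze_zero' ?_ ?_ t3
  · filter_upwards [self_mem_nhdsWithin] with x hx
    exact div_nonneg (norm_nonneg _) (le_of_lt hx)
  filter_upwards [Ioo_mem_nhdsGT hx₀] with x hx
  have hi1 : IntegrableOn (fun s => rho α (s / x) * ‖f s‖) (Ioi 0) := by
    refine Integrable.mono' ((integrableOn_rho_div h.alpha_pos hx.1).mul_const M)
      ((integrableOn_rho_div h.alpha_pos hx.1).aestronglyMeasurable.mul
        (aestronglyMeasurable_of_continuousOn hf).norm) ?_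
    refine (ae_restrict_iff' measurableSet_Ioi).2 (ae_of_all _ fun s hs => ?_)
    have hρ : 0 ≤ rho α (s / x) := rho_nonneg (div_pos hs hx.1).le
    rw [norm_mul, norm_norm, Real.norm_of_nonneg hρ]
    exact mul_le_mul_of_nonneg_left (hM s (le_of_lt hs)) hρ
  have hi2 := ((integrable_exp_neg_abs_sub h.gamma_pos x₀).integrableOn (s := Ioi 0))
  have key : ‖∫ s in Ioi (0 : ℝ), kern₀ A B x₀ P Q x s ∘L f s‖ ≤
      K * (∫ s in Ioi (0 : ℝ), rho α (s / x) * ‖f s‖) + K * (x / x₀) ^ (1 + α) * K * M * E := by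
    calc _ ≤ ∫ s in Ioi (0 : ℝ), (K * (rho α (s / x) * ‖f s‖) +
          K * (x / x₀) ^ (1 + α) * K * M * Real.exp (-γ * |s - x₀|)) := by
          refine norm_integral_le_of_norm_le ((hi1.const_mul K).add (hi2.const_mul _)) ?_
          refine (ae_restrict_iff' measurableSet_Ioi).2 (ae_of_all _ fun s hs => ?_)
          refine (ContinuousLinearMap.opNorm_comp_le _ _).trans ?_
          have hfs := hM s (le_of_lt hs)
          have e1 := mul_le_mul_of_nonneg_right (h.norm_kern₀_le hx.1 hx.2 hs) (norm_nonneg (f s))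
          have hc : 0 ≤ K * (x / x₀) ^ (1 + α) * K * Real.exp (-γ * |s - x₀|) := by
            have := (div_pos hx.1 hx₀).le
            positivity
          have e2 := mul_le_mul_of_nonneg_left hfs hc
          calc _ ≤ _ := e1
            _ = K * (rho α (s / x) * ‖f s‖) +
              K * (x / x₀) ^ (1 + α) * K * Real.exp (-γ * |s - x₀|) * ‖f s‖ := by ring
            _ ≤ _ := by linarith
      _ = K * (∫ s in Ioi (0 : ℝ), rho α (s / x) * ‖f s‖) + K * (x / x₀) ^ (1 + α) * K * M *
          ∫ s in Ioi (0 : ℝ), Real.exp (-γ * |s - x₀|) := by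
          rw [integral_add (hi1.const_mul K) (hi2.const_mul _), integral_const_mul,
            integral_const_mul]
      _ ≤ _ := by
          have := (div_pos hx.1 hx₀).le
          gcongr
          exact integral_exp_neg_abs_sub_le h.gamma_pos x₀
  rw [div_le_iff₀ hx.1]
  refine key.trans (le_of_eq ?_)
  have hx0 := hx.1.ne'
  rw [Real.rpow_add (div_pos hx.1 hx₀), Real.rpow_one]
  field_simp

end LeftSided

namespace TwoSided

variable {W : Type*} [NormedAddCommGroup W] [NormedSpace ℝ W] {f : ℝ → W →L[ℝ] V} {M : ℝ}

/-- For s < x₀ the kernel is (Y(x)Q)((1-P)Y⁻¹(s)), decay at infinity times an integrable singularity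
at zero; for s ≥ x₀ it is the usual kernel of the dichotomy at infinity. -/
theorem norm_kern_le (h : TwoSided A B x₀ α γ K P Q) {x s : ℝ} (hx : x₀ ≤ x) (hs : 0 < s) :
    ‖kern A B x₀ P Q x s‖ ≤
      K * Real.exp (-γ * (x - x₀)) * K * rho α (s / x₀) + K * Real.exp (-γ * |s - x|) := by
  have hK := h.leftSided.nonneg
  have hρ : 0 ≤ rho α (s / x₀) := rho_nonneg (div_pos hs h.pos).le
  have h2 : 0 ≤ K * Real.exp (-γ * (x - x₀)) * K * rho α (s / x₀) := by positivity
  rcases lt_or_ge s x₀ with h1 | h1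
  · have e : kern A B x₀ P Q x s = (evol A B x₀ x * Q) * ((1 - P) * evolInv A B x₀ s) := by
      simp only [kern, kbase, kstep, if_pos h1, if_pos (h1.le.trans hx), sub_self, zero_smul,
        add_zero]
      noncomm_ring
    rw [e]
    have e1 := h.infty.norm_evol_le h.cont h.pos hx
    have := (norm_mul_le (evol A B x₀ x * Q) ((1 - P) * evolInv A B x₀ s)).trans
      (mul_le_mul e1 (h.leftSided.norm_left_le hs h1.le) (norm_nonneg _)
        ((norm_nonneg _).trans e1))
    have h3 : 0 ≤ K * Real.exp (-γ * |s - x|) := by positivity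
    linarith
  rcases le_or_gt s x with h3 | h3
  · have e : kern A B x₀ P Q x s = evol A B x₀ x * Q * evolInv A B x₀ s := by
      simp only [kern, kbase, kstep, if_neg (not_lt.2 h1), if_pos h3, sub_zero, one_smul]
      noncomm_ring
    rw [e, abs_sub_comm, abs_of_nonneg (sub_nonneg.2 h3)]
    have := h.infty.le_left x s h1 h3
    linarith
  · have e : kern A B x₀ P Q x s = -(evol A B x₀ x * (1 - Q) * evolInv A B x₀ s) := by
      simp only [kern, kbase, kstep, if_neg (not_lt.2 h1), if_neg (not_le.2 h3), sub_zero,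
        zero_smul, add_zero]
      noncomm_ring
    rw [e, norm_neg, abs_of_nonneg (sub_nonneg.2 h3.le)]
    have := h.infty.le_right x s hx h3.le
    linarith

theorem exists_integral_norm_kern_le (h : TwoSided A B x₀ α γ K P Q) :
    ∃ C, 0 ≤ C ∧ ∀ x, x₀ ≤ x → ∫ s in Ioi (0 : ℝ), ‖kern A B x₀ P Q x s‖ ≤ C := by
  have hK := h.leftSided.nonneg
  have hx₀ := h.pos
  set R := ∫ u in Ioi (0 : ℝ), rho α u with hR
  set E := ∫ u : ℝ, Real.exp (-γ * |u|) with hE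
  have hR0 : 0 ≤ R := setIntegral_nonneg measurableSet_Ioi fun u hu => rho_nonneg (le_of_lt hu)
  have hE0 : 0 ≤ E := integral_nonneg fun u => (Real.exp_pos _).le
  refine ⟨K * 1 * K * (x₀ * R) + K * E, by positivity, fun x hx => ?_⟩
  have hρ : ∫ s in Ioi (0 : ℝ), rho α (s / x₀) = x₀ * R := by
    simpa using integral_rho_div (α := α) (fun _ => 1) hx₀
  calc _ ≤ ∫ s in Ioi (0 : ℝ), (K * Real.exp (-γ * (x - x₀)) * K * rho α (s / x₀) +
        K * Real.exp (-γ * |s - x|)) :=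
        setIntegral_mono_on (h.leftSided.integrableOn_kern (hx₀.trans_le hx)).norm
          (h.leftSided.integrableOn_weight _ _ hx₀)
          measurableSet_Ioi fun s hs => h.norm_kern_le hx hs
    _ = K * Real.exp (-γ * (x - x₀)) * K * (x₀ * R) +
        K * ∫ s in Ioi (0 : ℝ), Real.exp (-γ * |s - x|) := by
        rw [integral_add ((integrableOn_rho_div h.alpha_pos hx₀).const_mul _)
          ((integrable_exp_neg_abs_sub h.gamma_pos x).integrableOn.const_mul _),
          integral_const_mul, integral_const_mul, hρ]
    _ ≤ _ := by
        gcongr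
        · rw [Real.exp_le_one_iff]
          nlinarith [h.gamma_pos]
        · exact integral_exp_neg_abs_sub_le h.gamma_pos x

theorem tendsto_exp_atTop (h : TwoSided A B x₀ α γ K P Q) :
    Tendsto (fun x => Real.exp (-γ * (x - x₀))) atTop (𝓝 0) :=
  Real.tendsto_exp_atBot.comp
    ((tendsto_atTop_add_const_right _ (-x₀) tendsto_id).const_mul_atTop_of_neg
      (neg_lt_zero.2 h.gamma_pos))

/-- The integral operator preserves functions vanishing at infinity. -/
theorem tendsto_integral_kern (h : TwoSided A B x₀ α γ K P Q) (hf : ContinuousOn f (Ici 0))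
    (hM : ∀ s, 0 ≤ s → ‖f s‖ ≤ M) (hf0 : Tendsto f atTop (𝓝 0)) :
    Tendsto (fun x => ∫ s in Ioi (0 : ℝ), kern A B x₀ P Q x s ∘L f s) atTop (𝓝 0) := by
  have hK := h.leftSided.nonneg
  have hx₀ := h.pos
  have hM0 : 0 ≤ M := (norm_nonneg _).trans (hM 0 le_rfl)
  set R := ∫ s in Ioi (0 : ℝ), rho α (s / x₀) with hR
  have t1 := (tendsto_integral_exp_neg_abs h.gamma_pos (M := M)
    (LeftSided.aestronglyMeasurable_of_continuousOn hf).norm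
    (fun s hs => by simpa using hM s hs.le) (by simpa using hf0.norm)).const_mul K
  have t2 := h.tendsto_exp_atTop.const_mul (K * K * M * R)
  have t3 := t2.add t1
  rw [mul_zero, mul_zero, add_zero] at t3
  refine squeeze_zero_norm' ?_ t3
  filter_upwards [eventually_ge_atTop x₀] with x hx
  have hi1 := integrableOn_rho_div h.alpha_pos hx₀
  have hi2 : IntegrableOn (fun s => Real.exp (-γ * |s - x|) * ‖f s‖) (Ioi 0) := by
    refine Integrable.mono' (((integrable_exp_neg_abs_sub h.gamma_pos x).integrableOn).mul_const M)
      ((integrable_exp_neg_abs_sub h.gamma_pos x).aestronglyMeasurable.restrict.mul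
        (LeftSided.aestronglyMeasurable_of_continuousOn hf).norm) ?_
    refine (ae_restrict_iff' measurableSet_Ioi).2 (ae_of_all _ fun s hs => ?_)
    rw [norm_mul, norm_norm, Real.norm_of_nonneg (Real.exp_pos _).le]
    exact mul_le_mul_of_nonneg_left (hM s (le_of_lt hs)) (Real.exp_pos _).le
  calc _ ≤ ∫ s in Ioi (0 : ℝ), (K * K * M * Real.exp (-γ * (x - x₀)) * rho α (s / x₀) +
        K * (Real.exp (-γ * |s - x|) * ‖f s‖)) := by
        refine norm_integral_le_of_norm_le ((hi1.const_mul _).add (hi2.const_mul _)) ?_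
        refine (ae_restrict_iff' measurableSet_Ioi).2 (ae_of_all _ fun s hs => ?_)
        refine (ContinuousLinearMap.opNorm_comp_le _ _).trans ?_
        have hfs := hM s (le_of_lt hs)
        have e1 := mul_le_mul_of_nonneg_right (h.norm_kern_le hx hs) (norm_nonneg (f s))
        have hρ : 0 ≤ rho α (s / x₀) := rho_nonneg (div_pos hs h.pos).le
        have hc : 0 ≤ K * Real.exp (-γ * (x - x₀)) * K * rho α (s / x₀) := by positivity
        have e2 := mul_le_mul_of_nonneg_left hfs hc
        calc _ ≤ _ := e1
          _ = K * Real.exp (-γ * (x - x₀)) * K * rho α (s / x₀) * ‖f s‖ +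
            K * (Real.exp (-γ * |s - x|) * ‖f s‖) := by ring
          _ ≤ _ := by linarith
    _ = _ := by
        rw [integral_add (hi1.const_mul _) (hi2.const_mul _), integral_const_mul,
          integral_const_mul]
        ring

end TwoSided

end Kernel

/-! ### Solutions of order O(x) at zero are C¹ up to zero. -/

section Regularity

variable {V : Type*} [NormedAddCommGroup V] [InnerProductSpace ℝ V] [FiniteDimensional ℝ V]
  {A : V →L[ℝ] V} {B : ℝ → V →L[ℝ] V} {x₀ α γ K : ℝ} {P Q : V →L[ℝ] V}

/-- The number 1 is not an eigenvalue. The vector w is the future y'(0): inserting y ≈ xw into the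
equation at zero forces w = Aw + g(0). -/
theorem exists_sub_apply_eq (hA : ∀ z : ℂ, IsCharRoot A z → z.re ≠ 1) (u : V) :
    ∃ w, w - A w = u := by
  have hne : ¬ Module.End.HasEigenvalue (A : V →ₗ[ℝ] V) 1 := by
    rw [Module.End.hasEigenvalue_iff_isRoot_charpoly]
    intro h
    refine hA 1 (isCharRoot_iff.2 ?_) rfl
    have := Polynomial.aeval_algebraMap_apply ℂ (1 : ℝ) (A : V →ₗ[ℝ] V).charpoly
    rw [map_one] at this
    rw [this, Polynomial.coe_aeval_eq_eval, h.eq_zero, map_zero]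
  have hinj : Function.Injective ((1 - A : V →L[ℝ] V) : V →ₗ[ℝ] V) := by
    rw [← LinearMap.ker_eq_bot, LinearMap.ker_eq_bot']
    intro v hv
    by_contra hv0
    refine hne (Module.End.hasEigenvalue_of_hasEigenvector (x := v) ⟨?_, hv0⟩)
    rw [Module.End.mem_eigenspace_iff, one_smul]
    have hv' : v - A v = 0 := hv
    exact (sub_eq_zero.1 hv').symm
  obtain ⟨w, hw⟩ := LinearMap.injective_iff_surjective.1 hinj u
  exact ⟨w, hw⟩

theorem continuousOn_coeff (hB : ContinuousOn B (Ici 0)) : ContinuousOn (coeff A B) (Ioi 0) :=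
  ((continuousOn_id.inv₀ fun _ hx => ne_of_gt hx).smul continuousOn_const).add
    (hB.mono Ioi_subset_Ici_self)

theorem kern₀_one (x s : ℝ) : kern₀ A B x₀ P 1 x s = kern A B x₀ P 1 x s := by
  simp [kern₀]

theorem tendsto_rpow_zero (hα : 0 < α) :
    Tendsto (fun x : ℝ => (x / x₀) ^ α / x₀) (𝓝[>] 0) (𝓝 0) := by
  have : Tendsto (fun x : ℝ => (x / x₀) ^ α) (𝓝[>] 0) (𝓝 ((0 / x₀) ^ α)) :=
    (((continuous_id.div_const x₀).tendsto 0).mono_left nhdsWithin_le_nhds).rpow_const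
      (Or.inr hα.le)
  rw [zero_div, Real.zero_rpow hα.ne'] at this
  simpa using this.div_const x₀

theorem ZeroDichotomy.tendsto_norm_evol_div (hB : ContinuousOn B (Ici 0)) (hx₀ : 0 < x₀)
    (hα : 0 < α) (h : ZeroDichotomy (evol A B x₀) (evolInv A B x₀) x₀ α K P) :
    Tendsto (fun x => ‖evol A B x₀ x * P‖ / x) (𝓝[>] 0) (𝓝 0) := by
  have t := (tendsto_rpow_zero (x₀ := x₀) hα).const_mul K
  rw [mul_zero] at t
  refine squeeze_zero' ?_ ?_ t
  · filter_upwards [self_mem_nhdsWithin] with x hx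
    exact div_nonneg (norm_nonneg _) (le_of_lt hx)
  · filter_upwards [Ioo_mem_nhdsGT hx₀] with x hx
    rw [div_le_iff₀ hx.1]
    refine (h.norm_evol_le hB hx₀ hx.1 hx.2.le).trans (le_of_eq ?_)
    rw [Real.rpow_add (div_pos hx.1 hx₀), Real.rpow_one]
    ring

theorem isBigO_of_tendsto_div {E : Type*} [NormedAddCommGroup E] {z : ℝ → E} {l : ℝ}
    (h : Tendsto (fun x => ‖z x‖ / x) (𝓝[>] 0) (𝓝 l)) : z =O[𝓝[>] 0] fun x => x := by
  refine Asymptotics.IsBigO.of_bound (l + 1) ?_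
  filter_upwards [h.eventually (gt_mem_nhds (lt_add_one l)), self_mem_nhdsWithin] with x hx hx0
  rw [Real.norm_of_nonneg (le_of_lt hx0)]
  exact ((div_lt_iff₀ hx0).1 hx).le

/-- A solution on `(0, x₀)` that is `O(x)`, with inhomogeneity vanishing at zero, is `o(x)`. -/
theorem ZeroDichotomy.tendsto_solution_div (hB : ContinuousOn B (Ici 0)) (hx₀ : 0 < x₀)
    (hα : 0 < α) (h : ZeroDichotomy (evol A B x₀) (evolInv A B x₀) x₀ α K P) {g z : ℝ → V}
    (hg : ContinuousOn g (Ici 0)) (hg0 : g 0 = 0) (hz : IsSolution A B g z)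
    (hzO : z =O[𝓝[>] 0] fun x => x) : Tendsto (fun x => ‖z x‖ / x) (𝓝[>] 0) (𝓝 0) := by
  have hL := h.leftSided_one hB hx₀ hα
  -- Freezing g beyond x₀ makes it bounded; only the interval (0, x₀) matters here.
  set f : ℝ → ℝ →L[ℝ] V := fun s => ContinuousLinearMap.toSpanSingleton ℝ (g (min s x₀)) with hf
  have hgc : ContinuousOn (fun s => g (min s x₀)) (Ici 0) :=
    hg.comp (by fun_prop) fun s hs => le_min hs hx₀.le
  have hfc : ContinuousOn f (Ici 0) :=
    (ContinuousLinearMap.toSpanSingletonCLE (𝕜 := ℝ) (E := V)).continuous.comp_continuousOn hgc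
  obtain ⟨M, hM⟩ := isCompact_Icc.exists_bound_of_continuousOn
    (hg.mono fun s (hs : s ∈ Icc 0 x₀) => hs.1)
  have hfM : ∀ s, 0 ≤ s → ‖f s‖ ≤ M := fun s hs => by
    rw [hf, ContinuousLinearMap.norm_toSpanSingleton]
    exact hM _ ⟨le_min hs hx₀.le, min_le_right _ _⟩
  have hf0 : f 0 = 0 := by
    rw [hf]
    simp only [min_eq_left hx₀.le, hg0]
    ext; simp
  -- A particular solution on (0, x₀) that is o(x), from the kernel with Q = 1; the rest of z is
  -- homogeneous.
  set p : ℝ → V := fun x => (∫ s in Ioi (0 : ℝ), kern A B x₀ P 1 x s ∘L f s) 1 with hp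
  have hpd : ∀ x, 0 < x → HasDerivAt p (coeff A B x (p x) + g (min x x₀)) x := by
    intro x hx
    have := (hL.hasDerivAt_integral_kern hfc hfM hx).clm_apply (hasDerivAt_const x (1 : ℝ))
    refine this.congr_deriv ?_
    simp [hf, hp]
  have hpdiv : Tendsto (fun x => ‖p x‖ / x) (𝓝[>] 0) (𝓝 0) := by
    have t := hL.isLittleO_integral_kern₀ hfc hfM hf0
    simp only [kern₀_one] at t
    refine squeeze_zero' ?_ ?_ t
    · filter_upwards [self_mem_nhdsWithin] with x hx
      exact div_nonneg (norm_nonneg _) (le_of_lt hx)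
    · filter_upwards [self_mem_nhdsWithin] with x hx
      have hx' : (0 : ℝ) < x := hx
      gcongr
      simpa using (∫ s in Ioi (0 : ℝ), kern A B x₀ P 1 x s ∘L f s).le_opNorm 1
  have hd : ∀ x, 0 < x → x < x₀ →
      HasDerivAt (fun x => evolInv A B x₀ x (z x - p x)) 0 x := by
    intro x hx hxx
    have hzx := hz x hx
    have hpx := hpd x hx
    rw [min_eq_left hxx.le] at hpx
    refine ((hasDerivAt_evolInv hB hx₀ hx).clm_apply (hzx.sub hpx)).congr_deriv ?_
    simp
  set v := evolInv A B x₀ (x₀ / 2) (z (x₀ / 2) - p (x₀ / 2)) with hv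
  have hform : ∀ x, 0 < x → x < x₀ → z x = p x + evol A B x₀ x v := by
    intro x hx hxx
    have h1 := eq_of_hasDerivAt_zero hd hx hxx (half_pos hx₀) (half_lt_self hx₀)
    have h2 : evol A B x₀ x (evolInv A B x₀ x (z x - p x)) = z x - p x :=
      congrArg (fun T : V →L[ℝ] V => T (z x - p x)) (evol_mul_evolInv (A := A) hB hx₀ hx)
    rw [hv, ← h1, h2]
    abel
  have hsmall : ∀ᶠ x in 𝓝[>] (0 : ℝ), 0 < x ∧ x < x₀ := Ioo_mem_nhdsGT hx₀
  have hvO : (fun x => evol A B x₀ x v) =O[𝓝[>] 0] fun x => x := by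
    refine (hzO.sub (isBigO_of_tendsto_div hpdiv)).congr' ?_ EventuallyEq.rfl
    filter_upwards [hsmall] with x hx
    rw [hform x hx.1 hx.2, add_sub_cancel_left]
  -- The homogeneous part is O(x), so it starts in the range of P and is in fact o(x).
  have hPv := h.apply_eq_self hB hx₀ hα hvO
  have t := hpdiv.add ((h.tendsto_norm_evol_div hB hx₀ hα).mul_const ‖v‖)
  rw [zero_mul, add_zero] at t
  refine squeeze_zero' ?_ ?_ t
  · filter_upwards [self_mem_nhdsWithin] with x hx
    exact div_nonneg (norm_nonneg _) (le_of_lt hx)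
  · filter_upwards [hsmall] with x hx
    have h1 : ‖evol A B x₀ x v‖ ≤ ‖evol A B x₀ x * P‖ * ‖v‖ := by
      conv_lhs => rw [← hPv]
      exact (evol A B x₀ x * P).le_opNorm v
    rw [hform x hx.1 hx.2, div_mul_eq_mul_div, ← add_div]
    have := hx.1
    gcongr
    exact (norm_add_le _ _).trans (by gcongr)

/-- Description of the solutions of the boundary value problem by their growth at zero. -/
theorem ZeroDichotomy.contDiffOn_solution (hB : ContinuousOn B (Ici 0)) (hx₀ : 0 < x₀)
    (hα : 0 < α) (h : ZeroDichotomy (evol A B x₀) (evolInv A B x₀) x₀ α K P)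
    (hA : ∀ z : ℂ, IsCharRoot A z → z.re ≠ 1) {g y : ℝ → V}
    (hg : ContinuousOn g (Ici 0)) (hy : IsSolution A B g y) (hy0 : y 0 = 0)
    (hyO : y =O[𝓝[>] 0] fun x => x) : ContDiffOn ℝ 1 y (Ici 0) := by
  obtain ⟨w, hw⟩ := exists_sub_apply_eq hA (g 0)
  have hidO : Tendsto (fun x : ℝ => x) (𝓝[>] 0) (𝓝 0) := nhdsWithin_le_nhds
  have hylim : Tendsto y (𝓝[>] 0) (𝓝 0) := hyO.trans_tendsto hidO
  have hgt : ContinuousOn (fun x => (g x - g 0) + x • B x w) (Ici 0) :=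
    (hg.sub continuousOn_const).add (continuousOn_id.smul (hB.clm_apply continuousOn_const))
  -- Subtracting xw removes g(0): the remaining inhomogeneity vanishes at zero, so y - xw is o(x)
  -- and y/x → w.
  have hz : IsSolution A B (fun x => (g x - g 0) + x • B x w) fun x => y x - x • w := by
    intro x hx
    refine ((hy x hx).sub ((hasDerivAt_id x).smul_const w)).congr_deriv ?_
    have : coeff A B x (x • w) = A w + x • B x w := by
      rw [coeff]
      simp [smul_smul, mul_inv_cancel₀ hx.ne']
    rw [map_sub, this, one_smul, ← hw]
    beta_reduce
    generalize x • B x w = u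
    abel
  have hwO : (fun x : ℝ => x • w) =O[𝓝[>] 0] fun x => x := by
    refine Asymptotics.IsBigO.of_bound ‖w‖ (Eventually.of_forall fun x => ?_)
    rw [norm_smul, mul_comm]
  have hzdiv := h.tendsto_solution_div hB hx₀ hα hgt (by simp) hz (hyO.sub hwO)
  have hylim' : Tendsto (fun x => x⁻¹ • y x) (𝓝[>] 0) (𝓝 w) := by
    rw [tendsto_iff_norm_sub_tendsto_zero]
    refine hzdiv.congr' ?_
    filter_upwards [self_mem_nhdsWithin] with x hx
    have hx' : (0 : ℝ) < x := hx
    have : x⁻¹ • y x - w = x⁻¹ • (y x - x • w) := by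
      rw [smul_sub, inv_smul_smul₀ hx'.ne']
    rw [this, norm_smul, norm_inv, Real.norm_of_nonneg hx'.le, inv_mul_eq_div]
  -- The limit of y' is Aw + g(0) = w. A derivative with a limit at the endpoint extends to it.
  have hder : Tendsto (fun x => coeff A B x (y x) + g x) (𝓝[>] 0) (𝓝 w) := by
    have hB0 : Tendsto B (𝓝[>] 0) (𝓝 (B 0)) :=
      (hB 0 self_mem_Ici).tendsto.mono_left (nhdsWithin_mono _ Ioi_subset_Ici_self)
    have hg0 : Tendsto g (𝓝[>] 0) (𝓝 (g 0)) :=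
      (hg 0 self_mem_Ici).tendsto.mono_left (nhdsWithin_mono _ Ioi_subset_Ici_self)
    have t1 := ((A.continuous.tendsto w).comp hylim').add ((isBoundedBilinearMap_apply (𝕜 := ℝ)
      (E := V) (F := V)).continuous.tendsto (B 0, 0) |>.comp (hB0.prodMk_nhds hylim))
    have t2 := t1.add hg0
    rw [map_zero, add_zero, ← hw, add_sub_cancel] at t2
    refine t2.congr fun x => ?_
    simp [coeff]
  have hderiv : ∀ x, 0 < x → deriv y x = coeff A B x (y x) + g x := fun x hx => (hy x hx).deriv
  have hdiff : DifferentiableOn ℝ y (Ioi 0) := fun x hx =>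
    (hy x hx).differentiableAt.differentiableWithinAt
  have h0 : HasDerivWithinAt y w (Ici 0) 0 := by
    refine hasDerivWithinAt_Ici_of_tendsto_deriv hdiff ?_ self_mem_nhdsWithin ?_
    · rw [ContinuousWithinAt, hy0]; exact hylim
    · refine hder.congr' ?_
      filter_upwards [self_mem_nhdsWithin] with x hx using (hderiv x hx).symm
  have hdw : ∀ x, 0 < x → derivWithin y (Ici 0) x = coeff A B x (y x) + g x := fun x hx =>
    (hy x hx).hasDerivWithinAt.derivWithin (uniqueDiffOn_Ici 0 x (le_of_lt hx))
  have hdw0 : derivWithin y (Ici 0) 0 = w := h0.derivWithin (uniqueDiffOn_Ici 0 0 self_mem_Ici)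
  rw [contDiffOn_one_iff_derivWithin (uniqueDiffOn_Ici 0)]
  constructor
  · intro x hx
    rcases eq_or_lt_of_le (show (0 : ℝ) ≤ x from hx) with h1 | h1
    · rw [← h1]; exact h0.differentiableWithinAt
    · exact (hy x h1).differentiableAt.differentiableWithinAt
  · intro x hx
    rcases eq_or_lt_of_le (show (0 : ℝ) ≤ x from hx) with h1 | h1
    · rw [← h1, ← continuousWithinAt_Ioi_iff_Ici, ContinuousWithinAt, hdw0]
      refine hder.congr' ?_
      filter_upwards [self_mem_nhdsWithin] with x hx using (hdw x hx).symm
    · have hc : ContinuousAt (fun x => coeff A B x (y x) + g x) x := by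
        have hnhds := Ioi_mem_nhds h1
        exact (((continuousOn_coeff hB).continuousAt hnhds).clm_apply
          (hy x h1).continuousAt).add ((hg.mono Ioi_subset_Ici_self).continuousAt hnhds)
      refine (hc.congr ?_).continuousWithinAt
      filter_upwards [lt_mem_nhds h1] with z hz using (hdw z hz).symm

theorem isBigO_of_contDiffOn {y : ℝ → V} (hy : ContDiffOn ℝ 1 y (Ici 0)) (hy0 : y 0 = 0) :
    y =O[𝓝[>] 0] fun x => x := by
  have hd := (hy.differentiableOn one_ne_zero 0 self_mem_Ici).hasDerivWithinAt
  have := hd.hasFDerivWithinAt.isBigO_sub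
  simp only [hy0, sub_zero] at this
  exact this.mono (nhdsWithin_mono _ Ioi_subset_Ici_self)

theorem IsBVPSolution.apply_zero {g y : ℝ → V} (hy : IsBVPSolution A B g y) : y 0 = 0 := by
  have h1 : Tendsto y (𝓝[>] 0) (𝓝 (y 0)) :=
    (hy.contDiffOn.continuousOn 0 self_mem_Ici).tendsto.mono_left
      (nhdsWithin_mono _ Ioi_subset_Ici_self)
  exact tendsto_nhds_unique h1 hy.tendsto_zero

theorem IsBVPSolution.isBigO {g y : ℝ → V} (hy : IsBVPSolution A B g y) :
    y =O[𝓝[>] 0] fun x => x := isBigO_of_contDiffOn hy.contDiffOn hy.apply_zero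

namespace TwoSided

variable {g : ℝ → V}

theorem isBVPSolution (h : TwoSided A B x₀ α γ K P Q)
    (hA : ∀ z : ℂ, IsCharRoot A z → z.re ≠ 1)
    (hg : ContinuousOn g (Ici 0)) {y : ℝ → V} (hy : IsSolution A B g y) (hy0 : y 0 = 0) (hyO : y =O[𝓝[>] 0] fun x => x)
    (hyt : Tendsto y atTop (𝓝 0)) : IsBVPSolution A B g y :=
  ⟨h.zero.contDiffOn_solution h.cont h.pos h.alpha_pos hA hg hy hy0 hyO, hy,
    hyO.trans_tendsto nhdsWithin_le_nhds, hyt⟩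

end TwoSided

end Regularity

/-! ### Solving the boundary value problem with the kernel. -/

section Solvability

variable {V : Type*} [NormedAddCommGroup V] [InnerProductSpace ℝ V] [FiniteDimensional ℝ V]
  {A : V →L[ℝ] V} {B : ℝ → V →L[ℝ] V} {x₀ α γ K M : ℝ} {P Q : V →L[ℝ] V} {g : ℝ → V}

/-- A vector function as an operator function on the line. -/
noncomputable def asOp (g : ℝ → V) (s : ℝ) : ℝ →L[ℝ] V :=
  ContinuousLinearMap.toSpanSingleton ℝ (g s)

theorem continuousOn_asOp (hg : ContinuousOn g (Ici 0)) : ContinuousOn (asOp g) (Ici 0) :=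
  (ContinuousLinearMap.toSpanSingletonCLE (𝕜 := ℝ) (E := V)).continuous.comp_continuousOn hg

theorem norm_asOp (s : ℝ) : ‖asOp g s‖ = ‖g s‖ := ContinuousLinearMap.norm_toSpanSingleton ..

theorem tendsto_asOp (hg : Tendsto g atTop (𝓝 0)) : Tendsto (asOp g) atTop (𝓝 0) := by
  rw [tendsto_zero_iff_norm_tendsto_zero] at hg ⊢
  simpa only [norm_asOp] using hg

theorem comp_asOp_one (T : V →L[ℝ] V) (s : ℝ) : (T ∘L asOp g s) 1 = T (g s) := by
  simp [asOp]

/-- Kernel estimates were proved for operator-valued inhomogeneities, to cover the weight F too; a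
vector function is treated as an operator on ℝ evaluated at 1. -/
theorem integrableOn_apply {T : ℝ → V →L[ℝ] V} (hT : IntegrableOn T (Ioi 0))
    (hg : ContinuousOn g (Ici 0)) (hM : ∀ s, 0 ≤ s → ‖g s‖ ≤ M) :
    IntegrableOn (fun s => T s (g s)) (Ioi 0) := by
  have h := LeftSided.integrableOn_comp hT (continuousOn_asOp hg) (M := M)
    (fun s hs => (norm_asOp s).trans_le (hM s hs))
  exact (ContinuousLinearMap.integrable_comp (ContinuousLinearMap.apply ℝ V (1 : ℝ)) h).congr
    (ae_of_all _ fun s => comp_asOp_one (T s) s)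

theorem integral_apply_eq {T : ℝ → V →L[ℝ] V} (hT : IntegrableOn T (Ioi 0))
    (hg : ContinuousOn g (Ici 0)) (hM : ∀ s, 0 ≤ s → ‖g s‖ ≤ M) :
    ∫ s in Ioi (0 : ℝ), T s (g s) = (∫ s in Ioi (0 : ℝ), T s ∘L asOp g s) 1 := by
  rw [ContinuousLinearMap.integral_apply (LeftSided.integrableOn_comp hT (continuousOn_asOp hg)
    (fun s hs => (norm_asOp s).trans_le (hM s hs)))]
  simp only [comp_asOp_one]

theorem norm_integral_apply_le {T : ℝ → V →L[ℝ] V} (hT : IntegrableOn T (Ioi 0))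
    (hM : ∀ s, 0 ≤ s → ‖g s‖ ≤ M) :
    ‖∫ s in Ioi (0 : ℝ), T s (g s)‖ ≤ M * ∫ s in Ioi (0 : ℝ), ‖T s‖ := by
  rw [← integral_const_mul]
  refine norm_integral_le_of_norm_le (hT.norm.const_mul M) ?_
  refine (ae_restrict_iff' measurableSet_Ioi).2 (ae_of_all _ fun s hs => ?_)
  refine (ContinuousLinearMap.le_opNorm _ _).trans ?_
  rw [mul_comm]
  exact mul_le_mul_of_nonneg_right (hM s (le_of_lt hs)) (norm_nonneg _)

theorem ZeroDichotomy.isBigO_evol_apply (hB : ContinuousOn B (Ici 0)) (hx₀ : 0 < x₀)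
    (hα : 0 < α) (h : ZeroDichotomy (evol A B x₀) (evolInv A B x₀) x₀ α K P) {v : V}
    (hv : P v = v) : (fun x => evol A B x₀ x v) =O[𝓝[>] 0] fun x => x := by
  have h1 := isBigO_of_tendsto_div (h.tendsto_norm_evol_div hB hx₀ hα)
  refine (Asymptotics.IsBigO.of_bound ‖v‖ (Eventually.of_forall fun x => ?_)).trans h1
  conv_lhs => rw [← hv]
  rw [mul_comm]
  exact (evol A B x₀ x * P).le_opNorm v

namespace LeftSided

theorem isSolution_integral_kern (h : LeftSided A B x₀ α γ K P Q) (hg : ContinuousOn g (Ici 0))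
    (hM : ∀ s, 0 ≤ s → ‖g s‖ ≤ M) :
    IsSolution A B g fun x => ∫ s in Ioi (0 : ℝ), kern A B x₀ P Q x s (g s) := by
  intro x hx
  have hM' : ∀ s, 0 ≤ s → ‖asOp g s‖ ≤ M := fun s hs => (norm_asOp s).trans_le (hM s hs)
  have := (h.hasDerivAt_integral_kern (continuousOn_asOp hg) hM' hx).clm_apply
    (hasDerivAt_const x (1 : ℝ))
  beta_reduce
  rw [integral_apply_eq (h.integrableOn_kern hx) hg hM]
  refine (this.congr_of_eventuallyEq ?_).congr_deriv ?_
  · filter_upwards [lt_mem_nhds hx] with z hz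
    exact integral_apply_eq (h.integrableOn_kern hz) hg hM
  · simp [asOp]

/-- When g annihilates the defect, `kern` and `kern₀` act on it identically, and the latter is O(x).
-/
theorem isBigO_integral_kern (h : LeftSided A B x₀ α γ K P Q) (hg : ContinuousOn g (Ici 0))
    (hM : ∀ s, 0 ≤ s → ‖g s‖ ≤ M)
    (hdef : ∫ s in Ioi (0 : ℝ), ((1 - Q) * (1 - P) * evolInv A B x₀ s) (g s) = 0) :
    (fun x => ∫ s in Ioi (0 : ℝ), kern A B x₀ P Q x s (g s)) =O[𝓝[>] 0] fun x => x := by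
  obtain ⟨C, hC, hCx⟩ := h.exists_integral_norm_kern₀_le
  have hM0 : 0 ≤ M := (norm_nonneg _).trans (hM 0 le_rfl)
  refine Asymptotics.IsBigO.of_bound (M * C) ?_
  filter_upwards [Ioo_mem_nhdsGT h.pos] with x hx
  have e : ∫ s in Ioi (0 : ℝ), kern₀ A B x₀ P Q x s (g s) =
      ∫ s in Ioi (0 : ℝ), kern A B x₀ P Q x s (g s) := by
    have h1 := integrableOn_apply (h.integrableOn_kern hx.1) hg hM
    have h2 := integrableOn_apply h.integrableOn_defect hg hM
    have h3 := (evol A B x₀ x).integral_comp_comm h2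
    rw [hdef, map_zero] at h3
    have h4 := integral_add h1 ((evol A B x₀ x).integrable_comp h2)
    rw [h3, add_zero] at h4
    exact h4
  rw [← e, Real.norm_of_nonneg hx.1.le, mul_assoc]
  exact (norm_integral_apply_le (h.integrableOn_kern₀ hx.1) hM).trans
    (mul_le_mul_of_nonneg_left (hCx x hx.1 hx.2) hM0)

end LeftSided

namespace TwoSided

theorem tendsto_integral_kern_apply (h : TwoSided A B x₀ α γ K P Q) (hg : ContinuousOn g (Ici 0))
    (hM : ∀ s, 0 ≤ s → ‖g s‖ ≤ M) (hg0 : Tendsto g atTop (𝓝 0)) :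
    Tendsto (fun x => ∫ s in Ioi (0 : ℝ), kern A B x₀ P Q x s (g s)) atTop (𝓝 0) := by
  have hM' : ∀ s, 0 ≤ s → ‖asOp g s‖ ≤ M := fun s hs => (norm_asOp s).trans_le (hM s hs)
  have t := h.tendsto_integral_kern (continuousOn_asOp hg) hM' (tendsto_asOp hg0)
  have t' := ((ContinuousLinearMap.apply ℝ V (1 : ℝ)).continuous.tendsto _).comp t
  rw [map_zero] at t'
  refine t'.congr' ?_
  filter_upwards [eventually_gt_atTop 0] with x hx
  exact (integral_apply_eq (h.leftSided.integrableOn_kern hx) hg hM).symm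

theorem tendsto_evol_mul_atTop (h : TwoSided A B x₀ α γ K P Q) :
    Tendsto (fun x => evol A B x₀ x * Q) atTop (𝓝 0) := by
  have t := h.tendsto_exp_atTop.const_mul K
  rw [mul_zero] at t
  refine squeeze_zero_norm' ?_ t
  filter_upwards [eventually_ge_atTop x₀] with x hx
  exact h.infty.norm_evol_le h.cont h.pos hx

theorem tendsto_evol_apply_atTop (h : TwoSided A B x₀ α γ K P Q) {v : V} (hv : Q v = v) :
    Tendsto (fun x => evol A B x₀ x v) atTop (𝓝 0) := by
  have t := ((ContinuousLinearMap.apply ℝ V v).continuous.tendsto _).comp h.tendsto_evol_mul_atTop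
  rw [map_zero] at t
  refine t.congr fun x => ?_
  change evol A B x₀ x (Q v) = _
  rw [hv]

/-- The solutions of the boundary value problem form an affine space over `rg (P * Q)`. -/
theorem isBVPSolution_iff (h : TwoSided A B x₀ α γ K P Q)
    (hA : ∀ z : ℂ, IsCharRoot A z → z.re ≠ 1) (hg : ContinuousOn g (Ici 0)) {y z : ℝ → V}
    (hz : IsSolution A B g z) (hzO : z =O[𝓝[>] 0] fun x => x) (hzt : Tendsto z atTop (𝓝 0)) :
    IsBVPSolution A B g y ↔ y 0 = 0 ∧ ∃ v, P v = v ∧ Q v = v ∧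
      ∀ x, 0 < x → y x = evol A B x₀ x v + z x := by
  constructor
  · intro hy
    -- The difference of two solutions is homogeneous. Being O(x) at zero puts its initial value in
    -- the range of P, boundedness at infinity in the range of Q.
    refine ⟨hy.apply_zero, y x₀ - z x₀, ?_⟩
    have hsub : IsSolution A B 0 fun x => y x - z x := fun x hx => by
      refine ((hy.isSolution x hx).sub (hz x hx)).congr_deriv ?_
      simp
    have hform : ∀ x, 0 < x → y x - z x = evol A B x₀ x (y x₀ - z x₀) :=
      fun x hx => hsub.eq_evol_apply h.cont h.pos hx
    refine ⟨?_, ?_, fun x hx => by rw [← hform x hx]; abel⟩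
    · refine h.zero.apply_eq_self h.cont h.pos h.alpha_pos ?_
      refine (hy.isBigO.sub hzO).congr' ?_ EventuallyEq.rfl
      filter_upwards [self_mem_nhdsWithin] with x hx using hform x hx
    · have t := (hy.tendsto_atTop.sub hzt).norm
      rw [sub_zero, norm_zero] at t
      refine h.infty.apply_eq_self h.cont h.pos h.gamma_pos (c := 1) ?_
      filter_upwards [t.eventually (gt_mem_nhds one_pos), eventually_gt_atTop 0] with x hx hx0
      rw [← hform x hx0]
      exact hx.le
  · rintro ⟨hy0, v, hPv, hQv, hy⟩
    have he : ∀ x, 0 < x → HasDerivAt (fun x => evol A B x₀ x v + z x)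
        (coeff A B x (evol A B x₀ x v + z x) + g x) x := fun x hx => by
      refine ((isSolution_evol_apply h.cont v x hx).add (hz x hx)).congr_deriv ?_
      simp [add_assoc]
    refine h.isBVPSolution hA hg (fun x hx => ?_) hy0 ?_ ?_
    · rw [hy x hx]
      refine (he x hx).congr_of_eventuallyEq ?_
      filter_upwards [lt_mem_nhds hx] with t ht using hy t ht
    · refine ((h.zero.isBigO_evol_apply h.cont h.pos h.alpha_pos hPv).add hzO).congr' ?_
        EventuallyEq.rfl
      filter_upwards [self_mem_nhdsWithin] with x hx using (hy x hx).symm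
    · have t := (h.tendsto_evol_apply_atTop hQv).add hzt
      rw [add_zero] at t
      refine t.congr' ?_
      filter_upwards [eventually_gt_atTop 0] with x hx using (hy x hx).symm

end TwoSided

/-! ### Adjoint solutions and the solvability criterion. -/

section Adjoint

variable [CompleteSpace V]

open ContinuousLinearMap (adjoint)

theorem isAdjointSolution_adjoint_evolInv (hB : ContinuousOn B (Ici 0)) (hx₀ : 0 < x₀) (c : V) :
    IsAdjointSolution A B fun x => adjoint (evolInv A B x₀ x) c := by
  intro x hx
  have h1 : HasDerivAt (fun x => adjoint (evolInv A B x₀ x))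
      (star (-(evolInv A B x₀ x * coeff A B x))) x := (hasDerivAt_evolInv hB hx₀ hx).star
  refine (h1.clm_apply (hasDerivAt_const x c)).congr_deriv ?_
  rw [map_zero, add_zero, star_neg, star_mul, neg_apply]
  have : star (coeff A B x) = x⁻¹ • adjoint A + adjoint (B x) := by
    rw [coeff, star_add, star_smul, star_trivial]
    rfl
  rw [this]
  rfl

theorem integrableOn_adjoint {T : ℝ → V →L[ℝ] V} {t : Set ℝ} (hT : IntegrableOn T t) :
    IntegrableOn (fun s => adjoint (T s)) t := by
  refine Integrable.mono hT
    ((ContinuousLinearMap.adjoint (𝕜 := ℝ) (E := V) (F := V)).continuous.comp_aestronglyMeasurable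
      hT.aestronglyMeasurable) (ae_of_all _ fun s => ?_)
  rw [LinearIsometryEquiv.norm_map]

/-- Orthogonality to the integrable adjoint solutions, tested on those given by an operator. -/
theorem integral_eq_zero_of_orthogonal (hB : ContinuousOn B (Ici 0)) (hx₀ : 0 < x₀)
    {T : V →L[ℝ] V} (hT : IntegrableOn (fun s => T * evolInv A B x₀ s) (Ioi 0))
    (hg : ContinuousOn g (Ici 0)) (hM : ∀ s, 0 ≤ s → ‖g s‖ ≤ M)
    (horth : ∀ η : ℝ → V, IsAdjointSolution A B η → IntegrableOn η (Ioi 0) →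
      ∫ x in Ioi (0 : ℝ), ⟪g x, η x⟫_ℝ = 0) :
    ∫ s in Ioi (0 : ℝ), (T * evolInv A B x₀ s) (g s) = 0 := by
  -- Tested against c, the integrand is ⟨g, (Y⁻¹)* T* c⟩, and (Y⁻¹)* T* c is an integrable adjoint
  -- solution.
  refine ext_inner_left ℝ fun c => ?_
  rw [inner_zero_right, ← integral_inner (integrableOn_apply hT hg hM)]
  have e : ∀ s, adjoint (T * evolInv A B x₀ s) c = adjoint (evolInv A B x₀ s) (adjoint T c) :=
    fun s => by
      rw [ContinuousLinearMap.mul_def, ContinuousLinearMap.adjoint_comp]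
      rfl
  have h1 := horth _ (isAdjointSolution_adjoint_evolInv hB hx₀ (adjoint T c)) <|
    (ContinuousLinearMap.integrable_comp (ContinuousLinearMap.apply ℝ V c)
      (integrableOn_adjoint hT)).congr (ae_of_all _ e)
  refine Eq.trans ?_ h1
  congr 1
  funext s
  rw [← e, ContinuousLinearMap.adjoint_inner_right, real_inner_comm]

/-- Lagrange identity: the coefficient terms cancel against their adjoints. -/
theorem hasDerivAt_inner_adjointSolution {y η : ℝ → V} (hy : IsSolution A B g y)
    (hη : IsAdjointSolution A B η) {x : ℝ} (hx : 0 < x) :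
    HasDerivAt (fun x => ⟪y x, η x⟫_ℝ) ⟪g x, η x⟫_ℝ x := by
  refine ((hy x hx).inner ℝ (hη x hx)).congr_deriv ?_
  rw [inner_neg_right, inner_add_left, coeff, add_apply,
    add_apply, smul_apply, smul_apply,
    inner_add_left, inner_add_right, inner_smul_left, inner_smul_right,
    ContinuousLinearMap.adjoint_inner_right, ContinuousLinearMap.adjoint_inner_right]
  simp only [conj_trivial]
  ring

/-- If l ≠ 0, then near zero 1/x would be at most a multiple of ψ, hence integrable. This settles
the boundary term at zero, where η is known only to be integrable. -/
theorem eq_zero_of_tendsto_of_le_mul {φ ψ : ℝ → ℝ} {l C : ℝ} (hψ : IntegrableOn ψ (Ioi 0))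
    (hφ : Tendsto φ (𝓝[>] 0) (𝓝 l)) (hle : ∀ᶠ x in 𝓝[>] (0 : ℝ), |φ x| ≤ C * x * ψ x) :
    l = 0 := by
  by_contra hl
  have hl' : 0 < |l| / 2 := half_pos (abs_pos.2 hl)
  have h1 : ∀ᶠ x in 𝓝[>] (0 : ℝ), |l| / 2 < |φ x| :=
    hφ.abs.eventually (lt_mem_nhds (half_lt_self (abs_pos.2 hl)))
  obtain ⟨δ, hδ, hsub⟩ := mem_nhdsGT_iff_exists_Ioo_subset.1 (h1.and hle)
  have hδ' : (0 : ℝ) < δ := hδ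
  have hInt : IntegrableOn (fun x : ℝ => x⁻¹) (Ioo 0 δ) := by
    refine Integrable.mono' ((hψ.mono_set (fun x hx => hx.1)).const_mul (C / (|l| / 2)))
      measurable_inv.aestronglyMeasurable ?_
    refine (ae_restrict_iff' measurableSet_Ioo).2 (ae_of_all _ fun x hx => ?_)
    obtain ⟨h2, h3⟩ := hsub hx
    have hx0 : 0 < x := hx.1
    rw [Real.norm_of_nonneg (inv_pos.2 hx0).le, inv_le_iff_one_le_mul₀ hx0, div_mul_eq_mul_div,
      div_mul_eq_mul_div, le_div_iff₀ hl']
    linarith [show C * ψ x * x = C * x * ψ x by ring]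
  have := (intervalIntegrable_iff_integrableOn_Ioo_of_le hδ'.le).2 hInt
  rw [intervalIntegrable_inv_iff] at this
  rcases this with h | h
  · exact hδ'.ne h
  · exact h (left_mem_uIcc)

theorem tendsto_integral_Ioi_nhdsGT {f : ℝ → ℝ} (hf : IntegrableOn f (Ioi 0)) :
    Tendsto (fun x => ∫ t in Ioi x, f t) (𝓝[>] 0) (𝓝 (∫ t in Ioi (0 : ℝ), f t)) := by
  have h1 : IntegrableOn f (uIcc 0 1) := by
    rw [uIcc_of_le zero_le_one, integrableOn_Icc_iff_integrableOn_Ioc]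
    exact hf.mono_set fun x hx => hx.1
  have h2 := (intervalIntegral.continuousOn_primitive_interval h1) 0 left_mem_uIcc
  have h3 : Tendsto (fun x => ∫ t in (0 : ℝ)..x, f t) (𝓝[>] 0) (𝓝 0) := by
    have h4 := h2.tendsto
    rw [intervalIntegral.integral_same] at h4
    refine h4.mono_left ?_
    rw [uIcc_of_le zero_le_one]
    exact nhdsWithin_le_of_mem (mem_of_superset (Ioo_mem_nhdsGT one_pos) Ioo_subset_Icc_self)
  have h5 := h3.const_sub (∫ t in Ioi (0 : ℝ), f t)
  rw [sub_zero] at h5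
  refine h5.congr' ?_
  filter_upwards [self_mem_nhdsWithin] with x hx
  have hx' : (0 : ℝ) < x := hx
  rw [intervalIntegral.integral_of_le hx'.le, ← Ioc_union_Ioi_eq_Ioi hx'.le,
    setIntegral_union (Ioc_disjoint_Ioi le_rfl) measurableSet_Ioi
      (hf.mono_set fun t ht => ht.1) (hf.mono_set fun t ht => hx'.trans ht), add_sub_cancel_left]

/-- ⟨y, η⟩ is an integrable primitive of the integrable function ⟨g, η⟩, so it vanishes at infinity.
Its value at x is thus minus the tail integral, with a limit as x → 0, and that limit is zero since
y = O(x). -/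
theorem IsBVPSolution.integral_inner_eq_zero {y η : ℝ → V} (hy : IsBVPSolution A B g y)
    (hg : ContinuousOn g (Ici 0)) (hM : ∀ s, 0 ≤ s → ‖g s‖ ≤ M) (hη : IsAdjointSolution A B η)
    (hηi : IntegrableOn η (Ioi 0)) : ∫ x in Ioi (0 : ℝ), ⟪g x, η x⟫_ℝ = 0 := by
  have inner_int : ∀ {u : ℝ → V} {C : ℝ}, ContinuousOn u (Ici 0) → (∀ s, 0 ≤ s → ‖u s‖ ≤ C) →
      IntegrableOn (fun x => ⟪u x, η x⟫_ℝ) (Ioi 0) := by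
    intro u C hu hC
    refine Integrable.mono' (hηi.norm.const_mul C)
      ((LeftSided.aestronglyMeasurable_of_continuousOn hu).inner
        hηi.aestronglyMeasurable) ?_
    refine (ae_restrict_iff' measurableSet_Ioi).2 (ae_of_all _ fun s hs => ?_)
    exact (norm_inner_le_norm _ _).trans
      (mul_le_mul_of_nonneg_right (hC s (le_of_lt hs)) (norm_nonneg _))
  have hd : ∀ x ∈ Ioi (0 : ℝ), HasDerivAt (fun x => ⟪y x, η x⟫_ℝ) ⟪g x, η x⟫_ℝ x :=
    fun x hx => hasDerivAt_inner_adjointSolution hy.isSolution hη hx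
  obtain ⟨C, hC⟩ := exists_bound_Ici hy.contDiffOn.continuousOn hy.tendsto_atTop
  have hgi := inner_int hg hM
  have htop := tendsto_zero_of_hasDerivAt_of_integrableOn_Ioi hd hgi
    (inner_int hy.contDiffOn.continuousOn hC)
  have hform : ∀ x, 0 < x → ∫ t in Ioi x, ⟪g t, η t⟫_ℝ = -⟪y x, η x⟫_ℝ := fun x hx => by
    rw [integral_Ioi_of_hasDerivAt_of_tendsto' (fun t (ht : x ≤ t) => hd t (hx.trans_le ht))
      (hgi.mono_set fun t ht => hx.trans ht) htop, zero_sub]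
  obtain ⟨c, hc⟩ := hy.isBigO.bound
  refine eq_zero_of_tendsto_of_le_mul (C := c) hηi.norm (tendsto_integral_Ioi_nhdsGT hgi) ?_
  filter_upwards [hc, self_mem_nhdsWithin] with x hx hx0
  rw [hform x hx0, abs_neg]
  rw [Real.norm_of_nonneg (le_of_lt hx0)] at hx
  exact (abs_real_inner_le_norm _ _).trans (mul_le_mul_of_nonneg_right hx (norm_nonneg _))

theorem exists_isBVPSolution_iff (hB : ContinuousOn B (Ici 0))
    (hBb : ∃ C : ℝ, ∀ x : ℝ, 0 ≤ x → ‖B x‖ ≤ C) (hA : ∀ z : ℂ, IsCharRoot A z → z.re ≠ 1)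
    (hD : ∃ a : ℝ, 0 < a ∧ IsExpDichotomic A B a) (hg : ContinuousOn g (Ici 0))
    (hg0 : Tendsto g atTop (𝓝 0)) :
    (∃ y : ℝ → V, IsBVPSolution A B g y) ↔
      ∀ η : ℝ → V, IsAdjointSolution A B η → IntegrableOn η (Ioi 0) →
        ∫ x in Ioi (0 : ℝ), ⟪g x, η x⟫_ℝ = 0 := by
  obtain ⟨M, hM⟩ := exists_bound_Ici hg hg0
  refine ⟨fun ⟨y, hy⟩ η hη hηi => hy.integral_inner_eq_zero hg hM hη hηi, fun horth => ?_⟩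
  -- The base point is arbitrary here, and 1 is taken.
  obtain ⟨P, Q, hP, hQ, hPQ, hPr, hQr⟩ :=
    exists_commuting_projections (Uminus A B 1) (Vplus A B 1)
  obtain ⟨α, γ, K, h⟩ := exists_twoSided hB hBb hA hD one_pos hP hQ hPQ hPr hQr
  have hdef := integral_eq_zero_of_orthogonal hB one_pos h.leftSided.integrableOn_defect hg hM horth
  set z : ℝ → V := fun x => ∫ s in Ioi (0 : ℝ), kern A B 1 P Q x s (g s) with hz
  refine ⟨fun x => if 0 < x then z x else 0, (h.isBVPSolution_iff hA hg
    (h.leftSided.isSolution_integral_kern hg hM) (h.leftSided.isBigO_integral_kern hg hM hdef)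
    (h.tendsto_integral_kern_apply hg hM hg0)).2
    ⟨if_neg (lt_irrefl _), 0, map_zero _, map_zero _, fun x hx => ?_⟩⟩
  rw [if_pos hx, map_zero, zero_add]

end Adjoint

end Solvability

/-! ### The six projectors and the identification of G with the abstract kernel. -/

section SplittingAlgebra

variable {V : Type*} [NormedAddCommGroup V] [InnerProductSpace ℝ V] [FiniteDimensional ℝ V]
  [CompleteSpace V] {A : V →L[ℝ] V} {B : ℝ → V →L[ℝ] V} {x₀ : ℝ}

theorem rg_add {S T : V →L[ℝ] V} (hS : S * S = S) (hT : T * T = T) (hST : S * T = 0)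
    (hTS : T * S = 0) : rg (S + T) = rg S ⊔ rg T := by
  refine le_antisymm ?_ (sup_le ?_ ?_)
  · rintro _ ⟨v, rfl⟩
    exact Submodule.add_mem_sup ⟨v, rfl⟩ ⟨v, rfl⟩
  · rintro _ ⟨v, rfl⟩
    refine ⟨S v, ?_⟩
    change ((S + T) * S) v = S v
    rw [add_mul, hS, hTS, add_zero]
  · rintro _ ⟨v, rfl⟩
    refine ⟨T v, ?_⟩
    change ((S + T) * T) v = T v
    rw [add_mul, hT, hST, zero_add]

namespace Splitting

variable (D : Splitting A B x₀)

/-- The projector onto the solutions that are small at zero. -/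
noncomputable def Pp : V →L[ℝ] V := D.P 0 + D.P 3

/-- The projector onto the solutions that decay at infinity. -/
noncomputable def Pm : V →L[ℝ] V := D.P 0 + D.P 1 + D.P 2

theorem P_mul_P (i j : Fin 6) : D.P i * D.P j = if i = j then D.P i else 0 := by
  split_ifs with h
  · rw [← h]; exact D.idem i
  · exact D.disj i j h

theorem one_eq : (1 : V →L[ℝ] V) = D.P 0 + D.P 1 + D.P 2 + D.P 3 + D.P 4 + D.P 5 := by
  rw [← D.sum_eq, Fin.sum_univ_six]

theorem Pp_mul_Pp : D.Pp * D.Pp = D.Pp := by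
  simp [Pp, mul_add, add_mul, P_mul_P]

theorem Pm_mul_Pm : D.Pm * D.Pm = D.Pm := by
  simp [Pm, mul_add, add_mul, P_mul_P]

theorem Pp_mul_Pm : D.Pp * D.Pm = D.P 0 := by
  simp [Pp, Pm, mul_add, add_mul, P_mul_P]

theorem Pm_mul_Pp : D.Pm * D.Pp = D.P 0 := by
  simp [Pp, Pm, mul_add, add_mul, P_mul_P]

theorem one_sub_Pp : 1 - D.Pp = D.P 1 + D.P 2 + D.P 4 + D.P 5 := by
  rw [D.one_eq, Pp]; abel

theorem one_sub_Pm : 1 - D.Pm = D.P 3 + D.P 4 + D.P 5 := by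
  rw [D.one_eq, Pm]; abel

theorem Pm_mul_one_sub_Pp : D.Pm * (1 - D.Pp) = D.P 1 + D.P 2 := by
  rw [one_sub_Pp]
  simp [Pm, mul_add, add_mul, P_mul_P]

/-- Identifies the defect of the kernel: Π is exactly what is lost between the two dichotomies. -/
theorem one_sub_Pm_mul_one_sub_Pp : (1 - D.Pm) * (1 - D.Pp) = D.Pi56 := by
  rw [one_sub_Pp, one_sub_Pm]
  simp [Pi56, mul_add, add_mul, P_mul_P]

theorem Pi56_mul_Pi56 : D.Pi56 * D.Pi56 = D.Pi56 := by
  simp [Pi56, mul_add, add_mul, P_mul_P]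

theorem rg_Pp : rg D.Pp = Vplus A B x₀ := by
  rw [← D.L14_eq]
  exact rg_add (D.idem 0) (D.idem 3) (D.disj 0 3 (by decide)) (D.disj 3 0 (by decide))

theorem rg_Pm : rg D.Pm = Uminus A B x₀ := by
  have h1 : (D.P 0 + D.P 1) * (D.P 0 + D.P 1) = D.P 0 + D.P 1 := by
    simp [mul_add, add_mul, P_mul_P]
  have h2 : (D.P 0 + D.P 1) * D.P 2 = 0 := by simp [add_mul, P_mul_P]
  have h3 : D.P 2 * (D.P 0 + D.P 1) = 0 := by simp [mul_add, P_mul_P]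
  rw [← D.L123_eq, ← rg_add (D.idem 0) (D.idem 1) (D.disj 0 1 (by decide))
    (D.disj 1 0 (by decide)), ← rg_add h1 (D.idem 2) h2 h3]
  rfl

theorem exists_twoSided (hB : ContinuousOn B (Ici 0))
    (hBb : ∃ C : ℝ, ∀ x : ℝ, 0 ≤ x → ‖B x‖ ≤ C) (hA : ∀ z : ℂ, IsCharRoot A z → z.re ≠ 1)
    (hD : ∃ a : ℝ, 0 < a ∧ IsExpDichotomic A B a) (hx₀ : 0 < x₀) :
    ∃ α γ K, TwoSided A B x₀ α γ K D.Pp D.Pm :=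
  SingularODE.exists_twoSided hB hBb hA hD hx₀ D.Pp_mul_Pp D.Pm_mul_Pm
    (D.Pp_mul_Pm.trans D.Pm_mul_Pp.symm) D.rg_Pp D.rg_Pm

/-- Four cases according to the order of s, x₀ and of s, x, using 1 = P₁ + ⋯ + P₆. Through this
identity all kernel estimates apply to G. -/
theorem G_eq_kern (x s : ℝ) : D.G x s = kern A B x₀ D.Pp D.Pm x s := by
  have e : ∀ T, D.conj T x s = evol A B x₀ x * (T * evolInv A B x₀ s) := fun _ => rfl
  have e1 : evol A B x₀ x * evolInv A B x₀ s = evol A B x₀ x *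
      ((D.P 0 + D.P 1 + D.P 2 + D.P 3 + D.P 4 + D.P 5) * evolInv A B x₀ s) := by
    rw [← D.one_eq, one_mul]
  simp only [G, G₁, G₂, kern, kbase, kstep, e, Pm_mul_one_sub_Pp, one_sub_Pm]
  by_cases h1 : s < x₀ <;> by_cases h2 : s ≤ x
  · simp [h1, h2, not_le.2 h1, not_lt.2 h2]
  · rw [if_neg (fun h => h2 h.2), if_pos ⟨not_le.1 h2, h1⟩, if_neg h2, if_pos h1, if_neg h2,
      if_pos h1, zero_sub, neg_smul, one_smul, mul_add, mul_neg _ (evolInv A B x₀ s), e1]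
    noncomm_ring
  · rw [if_pos ⟨not_lt.1 h1, h2⟩, if_pos h2, if_neg h1, if_pos h2, if_neg h1, sub_zero, one_smul,
      mul_add _ _ (evolInv A B x₀ s), e1]
    noncomm_ring
  · simp [h1, h2]

end Splitting

end SplittingAlgebra

/-! ### Admissibility of the explicit weight. -/

section Weights

variable {V : Type*} [NormedAddCommGroup V] [InnerProductSpace ℝ V] [FiniteDimensional ℝ V]
  [CompleteSpace V] {A : V →L[ℝ] V} {B : ℝ → V →L[ℝ] V} {x₀ : ℝ}

/-- Groups x^β with Y(x), since it is this product that tends to 0 at zero under the root condition.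
-/
theorem Splitting.expWeight_eq (D : Splitting A B x₀) (κ β x : ℝ) : D.expWeight κ β x =
    (κ ^ (1 + β) / Real.Gamma (1 + β) * Real.exp (-(κ * x))) •
      ((x ^ β • evol A B x₀ x) * D.Pi56) := by
  rw [smul_mul_assoc, smul_smul, expWeight, Real.exp_neg]
  congr 1
  field_simp

theorem integral_weight {κ β : ℝ} (hκ : 0 < κ) (hβ : 0 < β) :
    ∫ x in Ioi (0 : ℝ), κ ^ (1 + β) * x ^ β / (Real.Gamma (1 + β) * Real.exp (κ * x)) = 1 := by
  have h := Real.integral_rpow_mul_exp_neg_mul_Ioi (a := 1 + β) (r := κ) (by linarith) hκ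
  have e : ∀ x : ℝ, κ ^ (1 + β) * x ^ β / (Real.Gamma (1 + β) * Real.exp (κ * x)) =
      κ ^ (1 + β) / Real.Gamma (1 + β) * (x ^ (1 + β - 1) * Real.exp (-(κ * x))) := fun x => by
    rw [add_sub_cancel_left, Real.exp_neg]
    field_simp
  simp only [e]
  rw [integral_const_mul, h, one_div, Real.inv_rpow hκ.le]
  have h1 : Real.Gamma (1 + β) ≠ 0 := (Real.Gamma_pos_of_pos (by linarith)).ne'
  have h2 : κ ^ (1 + β) ≠ 0 := (Real.rpow_pos_of_pos hκ _).ne'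
  field_simp

theorem Splitting.exists_isAdmissible_expWeight (D : Splitting A B x₀) (hB : ContinuousOn B (Ici 0))
    (hBb : ∃ C : ℝ, ∀ x : ℝ, 0 ≤ x → ‖B x‖ ≤ C) (hx₀ : 0 < x₀) :
    ∃ κ₀ : ℝ, ∀ κ β : ℝ, κ₀ < κ → 0 < β → (∀ z : ℂ, IsCharRoot A z → -β < z.re) →
      D.IsAdmissible (D.expWeight κ β) := by
  obtain ⟨k, hk0, hk⟩ := exists_evol_le_exp (A := A) hB hBb hx₀
  -- κ₀ is the exponential growth rate of Y, so that e^(-κx) Y(x) still decays; it does not depend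
  -- on β.
  refine ⟨k, fun κ β hκ hβ hroot => ?_⟩
  have hκ0 : 0 < κ := hk0.trans_lt hκ
  set c := κ ^ (1 + β) / Real.Gamma (1 + β) with hc
  have hc0 : 0 ≤ c := div_nonneg (Real.rpow_nonneg hκ0.le _)
    (Real.Gamma_pos_of_pos (by linarith)).le
  have hcont : ContinuousOn (D.expWeight κ β) (Ici 0) := by
    intro x hx
    rcases eq_or_lt_of_le (show (0 : ℝ) ≤ x from hx) with h1 | h1
    · rw [← h1, ← continuousWithinAt_Ioi_iff_Ici, ContinuousWithinAt]
      have e0 : D.expWeight κ β 0 = 0 := by simp [expWeight, Real.zero_rpow hβ.ne']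
      rw [e0]
      have t1 := (tendsto_rpow_smul_evol hB hBb hx₀ hroot).mul_const D.Pi56
      have t2 : Tendsto (fun x => c * Real.exp (-(κ * x))) (𝓝[>] 0)
          (𝓝 (c * Real.exp (-(κ * 0)))) :=
        (Continuous.tendsto (by fun_prop) 0).mono_left nhdsWithin_le_nhds
      have t3 := t2.smul t1
      rw [zero_mul, smul_zero] at t3
      exact t3.congr fun x => (D.expWeight_eq κ β x).symm
    · have h2 : ContinuousAt (evol A B x₀) x :=
        (continuousOn_evol hB).continuousAt (Ioi_mem_nhds h1)
      have h3 : ContinuousAt (fun x : ℝ => x ^ β) x :=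
        Real.continuousAt_rpow_const _ _ (Or.inl h1.ne')
      have h4 : ContinuousAt (fun x => c * Real.exp (-(κ * x))) x :=
        Continuous.continuousAt (by fun_prop)
      have h5 := h4.smul ((h3.smul h2).mul (continuousAt_const (y := D.Pi56)))
      refine (h5.congr (Eventually.of_forall fun x => ?_)).continuousWithinAt
      exact (D.expWeight_eq κ β x).symm
  have htop : Tendsto (D.expWeight κ β) atTop (𝓝 0) := by
    have t := (tendsto_rpow_mul_exp_neg_mul_atTop_nhds_zero β (κ - k) (sub_pos.2 hκ)).const_mul
      (c * Real.exp (-(k * x₀)) * ‖D.Pi56‖)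
    rw [mul_zero] at t
    refine squeeze_zero_norm' ?_ t
    filter_upwards [eventually_ge_atTop x₀] with x hx
    have hx0 : 0 < x := hx₀.trans_le hx
    have hxb : 0 ≤ x ^ β := Real.rpow_nonneg hx0.le _
    rw [expWeight_eq, norm_smul, Real.norm_of_nonneg (mul_nonneg hc0 (Real.exp_pos _).le)]
    have h1 : ‖(x ^ β • evol A B x₀ x) * D.Pi56‖ ≤
        x ^ β * Real.exp (k * (x - x₀)) * ‖D.Pi56‖ := by
      refine (norm_mul_le _ _).trans ?_
      rw [norm_smul, Real.norm_of_nonneg hxb]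
      gcongr
      exact hk x hx
    refine (mul_le_mul_of_nonneg_left h1 (mul_nonneg hc0 (Real.exp_pos _).le)).trans (le_of_eq ?_)
    have e : Real.exp (-(κ * x)) * Real.exp (k * (x - x₀)) =
        Real.exp (-(k * x₀)) * Real.exp (-(κ - k) * x) := by
      rw [← Real.exp_add, ← Real.exp_add]
      ring_nf
    linear_combination c * x ^ β * ‖D.Pi56‖ * e
  refine ⟨hcont, exists_bound_Ici hcont htop, htop, ?_⟩
  have e : ∀ x ∈ Ioi (0 : ℝ), D.Pi56 ∘L evolInv A B x₀ x ∘L D.expWeight κ β x =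
      (κ ^ (1 + β) * x ^ β / (Real.Gamma (1 + β) * Real.exp (κ * x))) • D.Pi56 := by
    intro x hx
    have h1 := evolInv_mul_evol (A := A) hB hx₀ hx
    change D.Pi56 * (evolInv A B x₀ x * (_ • (evol A B x₀ x * D.Pi56))) = _
    rw [mul_smul_comm, mul_smul_comm, ← mul_assoc (evolInv A B x₀ x), h1, one_mul, Pi56_mul_Pi56]
  rw [setIntegral_congr_fun measurableSet_Ioi e, integral_smul_const, integral_weight hκ0 hβ,
    one_smul]

end Weights

/-! ### The kernel as a function of x on either side of s, and integrability of products. -/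

section KernelPieces

variable {V : Type*} [NormedAddCommGroup V] [InnerProductSpace ℝ V] [FiniteDimensional ℝ V]
  {A : V →L[ℝ] V} {B : ℝ → V →L[ℝ] V} {x₀ α γ K : ℝ} {P Q : V →L[ℝ] V}

/-- The coefficient of `Y(x)` in the kernel for `x < s`. -/
noncomputable def kleft (A : V →L[ℝ] V) (B : ℝ → V →L[ℝ] V) (x₀ : ℝ) (P Q : V →L[ℝ] V) (s : ℝ) :
    V →L[ℝ] V :=
  kbase A B x₀ P Q s - (if s < x₀ then (1 : ℝ) else 0) • evolInv A B x₀ s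

theorem kern_eq_kleft (x s : ℝ) : kern A B x₀ P Q x s =
    evol A B x₀ x * (kleft A B x₀ P Q s + (if s ≤ x then (1 : ℝ) else 0) • evolInv A B x₀ s) := by
  rw [kern, kleft, kstep, sub_smul]
  congr 1
  abel

theorem kern_of_lt {x s : ℝ} (hs : x < s) :
    kern A B x₀ P Q x s = evol A B x₀ x * kleft A B x₀ P Q s := by
  rw [kern_eq_kleft, if_neg (not_le.2 hs), zero_smul, add_zero]

theorem kern_of_le {x s : ℝ} (hs : s ≤ x) : kern A B x₀ P Q x s =
    evol A B x₀ x * (kleft A B x₀ P Q s + evolInv A B x₀ s) := by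
  rw [kern_eq_kleft, if_pos hs, one_smul]

/-- For x < s the corrected coefficient lies in the range of P, so this side of the kernel vanishes
as x → 0. -/
theorem mul_kleft_add (hP : P * P = P) (hPQ : P * Q = Q * P) (s : ℝ) :
    P * (kleft A B x₀ P Q s + (1 - Q) * (1 - P) * evolInv A B x₀ s) =
      kleft A B x₀ P Q s + (1 - Q) * (1 - P) * evolInv A B x₀ s := by
  by_cases hs : s < x₀
  · have e : kleft A B x₀ P Q s + (1 - Q) * (1 - P) * evolInv A B x₀ s =
        -(P * evolInv A B x₀ s) := by
      rw [kleft, kbase, if_pos hs, if_pos hs, one_smul]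
      noncomm_ring
    rw [e, mul_neg, ← mul_assoc, hP]
  · have e : kleft A B x₀ P Q s + (1 - Q) * (1 - P) * evolInv A B x₀ s =
        -(P * ((1 - Q) * evolInv A B x₀ s)) := by
      rw [kleft, kbase, if_neg hs, if_neg hs, zero_smul, ← mul_assoc P, mul_sub P, hPQ]
      noncomm_ring
    rw [e, mul_neg, ← mul_assoc, hP]

/-- For x ≥ s the coefficient lies in the range of Q, so this side decays as x → ∞. -/
theorem mul_kleft_add_evolInv (hQ : Q * Q = Q) (s : ℝ) :
    Q * (kleft A B x₀ P Q s + evolInv A B x₀ s) = kleft A B x₀ P Q s + evolInv A B x₀ s := by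
  by_cases hs : s < x₀
  · have e : kleft A B x₀ P Q s + evolInv A B x₀ s = Q * ((1 - P) * evolInv A B x₀ s) := by
      rw [kleft, kbase, if_pos hs, if_pos hs, one_smul]
      noncomm_ring
    rw [e, ← mul_assoc, hQ]
  · have e : kleft A B x₀ P Q s + evolInv A B x₀ s = Q * evolInv A B x₀ s := by
      rw [kleft, kbase, if_neg hs, if_neg hs, zero_smul]
      noncomm_ring
    rw [e, ← mul_assoc, hQ]

theorem aestronglyMeasurable_kleft (hB : ContinuousOn B (Ici 0)) (hx₀ : 0 < x₀) :
    AEStronglyMeasurable (kleft A B x₀ P Q) (volume.restrict (Ioi 0)) := by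
  have hm : AEStronglyMeasurable (fun s : ℝ => if s < x₀ then (1 : ℝ) else 0)
      (volume.restrict (Ioi 0)) :=
    (Measurable.ite measurableSet_Iio measurable_const measurable_const).aestronglyMeasurable
  exact (aestronglyMeasurable_kbase hB hx₀).sub
    (AEStronglyMeasurable.smul (f := fun s : ℝ => if s < x₀ then (1 : ℝ) else 0) hm
      (aestronglyMeasurable_evolInv hB hx₀))

theorem aestronglyMeasurable_kern (hB : ContinuousOn B (Ici 0)) (hx₀ : 0 < x₀) :
    AEStronglyMeasurable (fun p : ℝ × ℝ => kern A B x₀ P Q p.1 p.2)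
      ((volume.restrict (Ioi 0)).prod (volume.restrict (Ioi 0))) := by
  simp only [kern_eq_kleft]
  have hm : AEStronglyMeasurable (fun p : ℝ × ℝ => if p.2 ≤ p.1 then (1 : ℝ) else 0)
      ((volume.restrict (Ioi 0)).prod (volume.restrict (Ioi 0))) :=
    (Measurable.ite (measurableSet_le measurable_snd measurable_fst) measurable_const
      measurable_const).aestronglyMeasurable
  exact (aestronglyMeasurable_evol hB).comp_fst.mul
    ((aestronglyMeasurable_kleft hB hx₀).comp_snd.add
      (AEStronglyMeasurable.smul (f := fun p : ℝ × ℝ => if p.2 ≤ p.1 then (1 : ℝ) else 0) hm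
        (aestronglyMeasurable_evolInv hB hx₀).comp_snd))

theorem ZeroDichotomy.tendsto_evol_mul (hB : ContinuousOn B (Ici 0)) (hx₀ : 0 < x₀)
    (hα : 0 < α) (h : ZeroDichotomy (evol A B x₀) (evolInv A B x₀) x₀ α K P) :
    Tendsto (fun x => evol A B x₀ x * P) (𝓝[>] 0) (𝓝 0) :=
  (isBigO_of_tendsto_div (h.tendsto_norm_evol_div hB hx₀ hα)).norm_left.of_norm_left.trans_tendsto
    nhdsWithin_le_nhds

/-- A bound for the solutions that are small both at zero and at infinity. -/
theorem TwoSided.norm_evol_mul_le (h : TwoSided A B x₀ α γ K P Q) {x : ℝ} (hx : 0 < x) :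
    ‖evol A B x₀ x * (P * Q)‖ ≤ K * (‖P‖ + ‖Q‖) * Real.exp (-γ * (x - x₀)) := by
  have hK := h.leftSided.nonneg
  rcases le_or_gt x x₀ with h1 | h1
  · have e1 := h.zero.norm_evol_le h.cont h.pos hx h1
    have e2 : (x / x₀) ^ (1 + α) ≤ 1 := Real.rpow_le_one (div_pos hx h.pos).le
      ((div_le_one h.pos).2 h1) (by linarith [h.alpha_pos])
    have e3 : 1 ≤ Real.exp (-γ * (x - x₀)) := Real.one_le_exp (by nlinarith [h.gamma_pos])
    rw [← mul_assoc]
    calc _ ≤ ‖evol A B x₀ x * P‖ * ‖Q‖ := norm_mul_le _ _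
      _ ≤ K * 1 * (‖P‖ + ‖Q‖) := by
          gcongr
          · exact e1.trans (by gcongr)
          · linarith [norm_nonneg P]
      _ ≤ K * Real.exp (-γ * (x - x₀)) * (‖P‖ + ‖Q‖) := by gcongr
      _ = _ := by ring
  · have e1 := h.infty.norm_evol_le h.cont h.pos h1.le
    rw [h.comm, ← mul_assoc]
    calc _ ≤ ‖evol A B x₀ x * Q‖ * ‖P‖ := norm_mul_le _ _
      _ ≤ K * Real.exp (-γ * (x - x₀)) * (‖P‖ + ‖Q‖) := by
          gcongr
          linarith [norm_nonneg Q]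
      _ = _ := by ring

theorem TwoSided.integrableOn_evol_mul (h : TwoSided A B x₀ α γ K P Q) :
    IntegrableOn (fun x => evol A B x₀ x * (P * Q)) (Ioi 0) := by
  have hi : IntegrableOn (fun x => K * (‖P‖ + ‖Q‖) * Real.exp (-γ * (x - x₀))) (Ioi 0) := by
    have e : (fun x => K * (‖P‖ + ‖Q‖) * Real.exp (-γ * (x - x₀))) =
        fun x => K * (‖P‖ + ‖Q‖) * Real.exp (γ * x₀) * Real.exp (-γ * x) := by
      funext x
      rw [mul_assoc _ (Real.exp _), ← Real.exp_add]
      ring_nf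
    rw [e]
    exact (exp_neg_integrableOn_Ioi 0 h.gamma_pos).const_mul _
  refine Integrable.mono' hi ((aestronglyMeasurable_evol h.cont).mul aestronglyMeasurable_const) ?_
  exact (ae_restrict_iff' measurableSet_Ioi).2 (ae_of_all _ fun x hx => h.norm_evol_mul_le hx)

theorem TwoSided.exists_norm_evol_mul_le (h : TwoSided A B x₀ α γ K P Q) :
    ∃ C, 0 ≤ C ∧ ∀ x, 0 < x → ‖evol A B x₀ x * (P * Q)‖ ≤ C := by
  have hK := h.leftSided.nonneg
  refine ⟨K * (‖P‖ + ‖Q‖) * Real.exp (γ * x₀), by positivity, fun x hx =>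
    (h.norm_evol_mul_le hx).trans ?_⟩
  have : -γ * (x - x₀) ≤ γ * x₀ := by nlinarith [h.gamma_pos]
  gcongr

/-- Fubini-type criterion for products `T(x) L(x, s)`. -/
theorem integrable_mul_prod {T : ℝ → V →L[ℝ] V} {L : ℝ → ℝ → V →L[ℝ] V} {C : ℝ}
    (hT : IntegrableOn T (Ioi 0))
    (hLm : AEStronglyMeasurable (fun p : ℝ × ℝ => L p.1 p.2)
      ((volume.restrict (Ioi 0)).prod (volume.restrict (Ioi 0))))
    (hL : ∀ x, 0 < x → IntegrableOn (L x) (Ioi 0))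
    (hC : ∀ x, 0 < x → ∫ s in Ioi (0 : ℝ), ‖L x s‖ ≤ C) :
    Integrable (fun p : ℝ × ℝ => T p.1 * L p.1 p.2)
      ((volume.restrict (Ioi 0)).prod (volume.restrict (Ioi 0))) := by
  have hm := hT.aestronglyMeasurable.comp_fst (ν := volume.restrict (Ioi (0 : ℝ))) |>.mul hLm
  refine (integrable_prod_iff hm).2 ⟨?_, ?_⟩
  · refine (ae_restrict_iff' measurableSet_Ioi).2 (ae_of_all _ fun x hx => ?_)
    exact Integrable.const_mul (hL x hx) (T x)
  · refine Integrable.mono' (hT.norm.mul_const C) hm.norm.integral_prod_right' ?_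
    refine (ae_restrict_iff' measurableSet_Ioi).2 (ae_of_all _ fun x hx => ?_)
    rw [Real.norm_of_nonneg (integral_nonneg fun s => norm_nonneg _)]
    calc _ ≤ ∫ s in Ioi (0 : ℝ), ‖T x‖ * ‖L x s‖ :=
          integral_mono (Integrable.const_mul (hL x hx) (T x)).norm
            ((hL x hx).norm.const_mul _) fun s => norm_mul_le _ _
      _ = ‖T x‖ * ∫ s in Ioi (0 : ℝ), ‖L x s‖ := integral_const_mul _ _
      _ ≤ _ := mul_le_mul_of_nonneg_left (hC x hx) (norm_nonneg _)

end KernelPieces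

/-! ### The terms N and M and the Gram operator. -/

section Green

variable {V : Type*} [NormedAddCommGroup V] [InnerProductSpace ℝ V] [FiniteDimensional ℝ V]
  [CompleteSpace V] {A : V →L[ℝ] V} {B : ℝ → V →L[ℝ] V} {x₀ α γ K : ℝ}

namespace Splitting

open ContinuousLinearMap (adjoint)

variable {D : Splitting A B x₀} {F : ℝ → V →L[ℝ] V}

theorem integrableOn_Pi56_mul (h : TwoSided A B x₀ α γ K D.Pp D.Pm) :
    IntegrableOn (fun s => D.Pi56 * evolInv A B x₀ s) (Ioi 0) := by
  have := h.leftSided.integrableOn_defect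
  rwa [one_sub_Pm_mul_one_sub_Pp] at this

theorem N_eq (x : ℝ) : D.N F x = -∫ t in Ioi (0 : ℝ), kern A B x₀ D.Pp D.Pm x t ∘L F t := by
  simp only [N, G_eq_kern]

theorem hasDerivAt_N (h : TwoSided A B x₀ α γ K D.Pp D.Pm) (hF : D.IsAdmissible F) {x : ℝ}
    (hx : 0 < x) : HasDerivAt (D.N F) (coeff A B x * D.N F x - F x) x := by
  obtain ⟨C, hC⟩ := hF.bounded
  have h1 := (h.leftSided.hasDerivAt_integral_kern hF.continuousOn hC hx).neg
  have e : D.N F = fun x => -∫ t in Ioi (0 : ℝ), kern A B x₀ D.Pp D.Pm x t ∘L F t :=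
    funext N_eq
  rw [e]
  refine h1.congr_deriv ?_
  rw [mul_neg, neg_add, sub_eq_add_neg]
  rfl

theorem continuousOn_N (h : TwoSided A B x₀ α γ K D.Pp D.Pm) (hF : D.IsAdmissible F) :
    ContinuousOn (D.N F) (Ioi 0) :=
  fun _ hx => (hasDerivAt_N h hF hx).continuousAt.continuousWithinAt

theorem tendsto_N_atTop (h : TwoSided A B x₀ α γ K D.Pp D.Pm) (hF : D.IsAdmissible F) :
    Tendsto (D.N F) atTop (𝓝 0) := by
  obtain ⟨C, hC⟩ := hF.bounded
  have t := (h.tendsto_integral_kern hF.continuousOn hC hF.tendsto_atTop).neg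
  rw [neg_zero] at t
  exact t.congr fun x => (N_eq x).symm

/-- By biorthonormality the defect term of ∫ kern₀ F is exactly YΠ. Hence N - YΠ = -∫ kern₀ F, which
is O(x). -/
theorem exists_norm_N_sub_le (h : TwoSided A B x₀ α γ K D.Pp D.Pm) (hF : D.IsAdmissible F) :
    ∃ C, 0 ≤ C ∧ ∀ x, 0 < x → x < x₀ → ‖D.N F x - evol A B x₀ x * D.Pi56‖ ≤ C * x := by
  obtain ⟨C, hC⟩ := hF.bounded
  have hC0 : 0 ≤ C := (norm_nonneg _).trans (hC 0 le_rfl)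
  obtain ⟨c, hc0, hc⟩ := h.leftSided.exists_integral_norm_kern₀_le
  refine ⟨C * c, mul_nonneg hC0 hc0, fun x hx hxx => ?_⟩
  have e := h.leftSided.integral_kern₀_comp hF.continuousOn hC hx
  have e2 : ∫ s in Ioi (0 : ℝ), ((1 - D.Pm) * (1 - D.Pp) * evolInv A B x₀ s) ∘L F s = D.Pi56 := by
    rw [one_sub_Pm_mul_one_sub_Pp]
    exact hF.biorth
  rw [e2] at e
  have e3 : D.N F x - evol A B x₀ x * D.Pi56 =
      -∫ s in Ioi (0 : ℝ), kern₀ A B x₀ D.Pp D.Pm x s ∘L F s := by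
    rw [e, N_eq, neg_add, sub_eq_add_neg]
    rfl
  rw [e3, norm_neg, mul_assoc]
  exact (LeftSided.norm_integral_comp_le (h.leftSided.integrableOn_kern₀ hx) hC).trans
    (mul_le_mul_of_nonneg_left (hc x hx hxx) hC0)

/-- The kernel before the correction that makes it orthogonal to the homogeneous solutions. -/
noncomputable def preGreen (D : Splitting A B x₀) (F : ℝ → V →L[ℝ] V) (x s : ℝ) : V →L[ℝ] V :=
  D.G x s + D.N F x ∘L D.Pi56 ∘L evolInv A B x₀ s

theorem green_eq (x s : ℝ) :
    D.green F x s = D.preGreen F x s + evol A B x₀ x * D.P 0 * D.M F s := by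
  rw [green, preGreen]
  change _ + evol A B x₀ x * (D.P 0 * D.M F s) + _ = _
  rw [mul_assoc]
  abel

theorem preGreen_eq_kern (x s : ℝ) : D.preGreen F x s =
    kern A B x₀ D.Pp D.Pm x s + D.N F x * (D.Pi56 * evolInv A B x₀ s) := by
  rw [preGreen, G_eq_kern]
  rfl

/-- The form to use near zero: since Π² = Π, the defect can be moved from N to the kernel, and both
resulting terms are small. -/
theorem preGreen_eq_kern₀ (x s : ℝ) : D.preGreen F x s =
    kern₀ A B x₀ D.Pp D.Pm x s +
      (D.N F x - evol A B x₀ x * D.Pi56) * (D.Pi56 * evolInv A B x₀ s) := by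
  rw [preGreen_eq_kern, kern₀, one_sub_Pm_mul_one_sub_Pp, sub_mul,
    mul_assoc (evol A B x₀ x) D.Pi56, ← mul_assoc D.Pi56 D.Pi56, Pi56_mul_Pi56]
  abel

theorem preGreen_of_lt {x s : ℝ} (hs : x < s) : D.preGreen F x s =
    evol A B x₀ x * kleft A B x₀ D.Pp D.Pm s + D.N F x * (D.Pi56 * evolInv A B x₀ s) := by
  rw [preGreen_eq_kern, kern_of_lt hs]

theorem preGreen_of_le {x s : ℝ} (hs : s ≤ x) : D.preGreen F x s =
    evol A B x₀ x * (kleft A B x₀ D.Pp D.Pm s + evolInv A B x₀ s) +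
      D.N F x * (D.Pi56 * evolInv A B x₀ s) := by
  rw [preGreen_eq_kern, kern_of_le hs]

theorem integrableOn_preGreen (h : TwoSided A B x₀ α γ K D.Pp D.Pm) {x : ℝ} (hx : 0 < x) :
    IntegrableOn (D.preGreen F x) (Ioi 0) := by
  have h1 : Integrable (kern A B x₀ D.Pp D.Pm x) (volume.restrict (Ioi 0)) :=
    h.leftSided.integrableOn_kern hx
  have h2 : Integrable (fun s => D.N F x * (D.Pi56 * evolInv A B x₀ s))
    (volume.restrict (Ioi 0)) := Integrable.const_mul (integrableOn_Pi56_mul h) _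
  exact (Integrable.add (f := kern A B x₀ D.Pp D.Pm x) h1 h2).congr
    (ae_of_all _ fun s => (preGreen_eq_kern x s).symm)

/-- For x < x₀ the form with `kern₀` and N - YΠ is estimated; for x ≥ x₀ the form with `kern` and N,
the latter bounded because it vanishes at infinity. -/
theorem exists_integral_norm_preGreen_le (h : TwoSided A B x₀ α γ K D.Pp D.Pm)
    (hF : D.IsAdmissible F) :
    ∃ C, 0 ≤ C ∧ ∀ x, 0 < x → ∫ s in Ioi (0 : ℝ), ‖D.preGreen F x s‖ ≤ C := by
  obtain ⟨a, ha0, ha⟩ := h.leftSided.exists_integral_norm_kern₀_le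
  obtain ⟨b, hb0, hb⟩ := exists_norm_N_sub_le h hF
  obtain ⟨c, hc0, hc⟩ := h.exists_integral_norm_kern_le
  obtain ⟨d, hd⟩ := exists_bound_Ici ((continuousOn_N h hF).mono fun x (hx : x₀ ≤ x) =>
    h.pos.trans_le hx) (tendsto_N_atTop h hF)
  have hd0 : 0 ≤ d := (norm_nonneg _).trans (hd x₀ le_rfl)
  have hi := integrableOn_Pi56_mul h
  set I := ∫ s in Ioi (0 : ℝ), ‖D.Pi56 * evolInv A B x₀ s‖ with hI
  have hI0 : 0 ≤ I := integral_nonneg fun s => norm_nonneg _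
  have hx₀ := h.pos
  have key : ∀ {x : ℝ} (k : ℝ → V →L[ℝ] V) (S : V →L[ℝ] V), 0 < x → IntegrableOn k (Ioi 0) →
      (∀ s, D.preGreen F x s = k s + S * (D.Pi56 * evolInv A B x₀ s)) →
      ∫ s in Ioi (0 : ℝ), ‖D.preGreen F x s‖ ≤ (∫ s in Ioi (0 : ℝ), ‖k s‖) + ‖S‖ * I := by
    intro x k S hx hk he
    rw [hI, ← integral_const_mul, ← integral_add hk.norm (hi.norm.const_mul _)]
    refine integral_mono (integrableOn_preGreen h hx).norm (hk.norm.add (hi.norm.const_mul _))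
      fun s => ?_
    beta_reduce
    rw [he]
    exact (norm_add_le _ _).trans (add_le_add le_rfl (norm_mul_le _ _))
  refine ⟨a * x₀ + b * x₀ * I + (c + d * I), by positivity, fun x hx => ?_⟩
  have hp1 : 0 ≤ a * x₀ + b * x₀ * I := by positivity
  have hp2 : 0 ≤ c + d * I := by positivity
  rcases lt_or_ge x x₀ with h1 | h1
  · refine (key _ _ hx (h.leftSided.integrableOn_kern₀ hx) fun s => preGreen_eq_kern₀ x s).trans ?_
    have e1 : ∫ s in Ioi (0 : ℝ), ‖kern₀ A B x₀ D.Pp D.Pm x s‖ ≤ a * x₀ :=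
      (ha x hx h1).trans (by gcongr)
    have e2 : ‖D.N F x - evol A B x₀ x * D.Pi56‖ * I ≤ b * x₀ * I :=
      mul_le_mul_of_nonneg_right ((hb x hx h1).trans (by gcongr)) hI0
    linarith
  · refine (key _ _ hx (h.leftSided.integrableOn_kern hx) fun s => preGreen_eq_kern x s).trans ?_
    have e2 : ‖D.N F x‖ * I ≤ d * I := mul_le_mul_of_nonneg_right (hd x h1) hI0
    linarith [hc x h1]

theorem tendsto_N_sub (h : TwoSided A B x₀ α γ K D.Pp D.Pm) (hF : D.IsAdmissible F) :
    Tendsto (fun x => D.N F x - evol A B x₀ x * D.Pi56) (𝓝[>] 0) (𝓝 0) := by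
  obtain ⟨C, hC0, hC⟩ := exists_norm_N_sub_le h hF
  have t : Tendsto (fun x : ℝ => C * x) (𝓝[>] 0) (𝓝 (C * 0)) :=
    (Continuous.tendsto (by fun_prop) 0).mono_left nhdsWithin_le_nhds
  rw [mul_zero] at t
  refine squeeze_zero_norm' ?_ t
  filter_upwards [Ioo_mem_nhdsGT h.pos] with x hx using hC x hx.1 hx.2

/-- Moving YΠ from N to the first term leaves Y(x) acting on the range of `D.Pp`, plus N - YΠ; both
vanish at zero. -/
theorem tendsto_left_piece (h : TwoSided A B x₀ α γ K D.Pp D.Pm) (hF : D.IsAdmissible F) (s : ℝ) :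
    Tendsto (fun x => evol A B x₀ x * kleft A B x₀ D.Pp D.Pm s +
      D.N F x * (D.Pi56 * evolInv A B x₀ s)) (𝓝[>] 0) (𝓝 0) := by
  have e0 := mul_kleft_add (A := A) (B := B) (x₀ := x₀) h.zero.idem h.comm s
  rw [one_sub_Pm_mul_one_sub_Pp] at e0
  have t := ((h.zero.tendsto_evol_mul h.cont h.pos h.alpha_pos).mul_const
    (kleft A B x₀ D.Pp D.Pm s + D.Pi56 * evolInv A B x₀ s)).add
    ((tendsto_N_sub h hF).mul_const (D.Pi56 * evolInv A B x₀ s))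
  rw [zero_mul, zero_mul, add_zero] at t
  refine t.congr fun x => ?_
  rw [mul_assoc, e0, sub_mul, mul_assoc (evol A B x₀ x) D.Pi56, ← mul_assoc D.Pi56 D.Pi56,
    Pi56_mul_Pi56, mul_add]
  abel

theorem tendsto_right_piece (h : TwoSided A B x₀ α γ K D.Pp D.Pm) (hF : D.IsAdmissible F) (s : ℝ) :
    Tendsto (fun x => evol A B x₀ x * (kleft A B x₀ D.Pp D.Pm s + evolInv A B x₀ s) +
      D.N F x * (D.Pi56 * evolInv A B x₀ s)) atTop (𝓝 0) := by
  have e0 := mul_kleft_add_evolInv (A := A) (B := B) (x₀ := x₀) (P := D.Pp) h.infty.idem s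
  have t := (h.tendsto_evol_mul_atTop.mul_const
    (kleft A B x₀ D.Pp D.Pm s + evolInv A B x₀ s)).add
    ((tendsto_N_atTop h hF).mul_const (D.Pi56 * evolInv A B x₀ s))
  rw [zero_mul, zero_mul, add_zero] at t
  refine t.congr fun x => ?_
  rw [mul_assoc, e0]

theorem tendsto_preGreen_zero (h : TwoSided A B x₀ α γ K D.Pp D.Pm) (hF : D.IsAdmissible F)
    {s : ℝ} (hs : 0 < s) : Tendsto (fun x => D.preGreen F x s) (𝓝[>] 0) (𝓝 0) := by
  refine (tendsto_left_piece h hF s).congr' ?_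
  filter_upwards [Ioo_mem_nhdsGT hs] with x hx using (preGreen_of_lt hx.2).symm

theorem tendsto_preGreen_atTop (h : TwoSided A B x₀ α γ K D.Pp D.Pm) (hF : D.IsAdmissible F)
    (s : ℝ) : Tendsto (fun x => D.preGreen F x s) atTop (𝓝 0) := by
  refine (tendsto_right_piece h hF s).congr' ?_
  filter_upwards [eventually_ge_atTop s] with x hx using (preGreen_of_le hx).symm

theorem continuousOn_piece (h : TwoSided A B x₀ α γ K D.Pp D.Pm) (hF : D.IsAdmissible F)
    (S T : V →L[ℝ] V) : ContinuousOn (fun x => evol A B x₀ x * S + D.N F x * T) (Ioi 0) :=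
  ((continuousOn_evol h.cont).mul continuousOn_const).add
    ((continuousOn_N h hF).mul continuousOn_const)

theorem exists_norm_preGreen_le (h : TwoSided A B x₀ α γ K D.Pp D.Pm) (hF : D.IsAdmissible F)
    {s : ℝ} (hs : 0 < s) : ∃ C, ∀ x, 0 < x → ‖D.preGreen F x s‖ ≤ C := by
  obtain ⟨a, ha⟩ := exists_bound_Ioc (continuousOn_piece h hF _ _) (tendsto_left_piece h hF s) s
  obtain ⟨b, hb⟩ := exists_bound_Ici ((continuousOn_piece h hF _ _).mono
    fun x (hx : s ≤ x) => hs.trans_le hx) (tendsto_right_piece h hF s)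
  refine ⟨max a b, fun x hx => ?_⟩
  rcases lt_or_ge x s with h1 | h1
  · rw [preGreen_of_lt h1]
    exact (ha x hx h1.le).trans (le_max_left _ _)
  · rw [preGreen_of_le h1]
    exact (hb x h1).trans (le_max_right _ _)

theorem aestronglyMeasurable_preGreen (h : TwoSided A B x₀ α γ K D.Pp D.Pm)
    (hF : D.IsAdmissible F) :
    AEStronglyMeasurable (fun p : ℝ × ℝ => D.preGreen F p.1 p.2)
      ((volume.restrict (Ioi 0)).prod (volume.restrict (Ioi 0))) := by
  simp only [preGreen_eq_kern]
  exact (aestronglyMeasurable_kern h.cont h.pos).add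
    (((continuousOn_N h hF).aestronglyMeasurable measurableSet_Ioi).comp_fst.mul
      (integrableOn_Pi56_mul h).aestronglyMeasurable.comp_snd)

/-- Joint measurability would yield this only for almost every s; the orthogonality relation is
needed for each s. -/
theorem aestronglyMeasurable_preGreen_left (h : TwoSided A B x₀ α γ K D.Pp D.Pm)
    (hF : D.IsAdmissible F) (s : ℝ) :
    AEStronglyMeasurable (fun x => D.preGreen F x s) (volume.restrict (Ioi 0)) := by
  have e : (fun x => D.preGreen F x s) = fun x =>
      ((Ici s).indicator (fun _ => (1 : ℝ)) x) • (evol A B x₀ x * evolInv A B x₀ s) +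
      (evol A B x₀ x * kleft A B x₀ D.Pp D.Pm s + D.N F x * (D.Pi56 * evolInv A B x₀ s)) := by
    funext x
    rcases lt_or_ge x s with h1 | h1
    · rw [preGreen_of_lt h1, indicator_of_notMem (by simpa using h1), zero_smul, zero_add]
    · rw [preGreen_of_le h1, indicator_of_mem (by simpa using h1), one_smul, mul_add]
      abel
  rw [e]
  refine AEStronglyMeasurable.add (f := fun x => ((Ici s).indicator (fun _ => (1 : ℝ)) x) •
    (evol A B x₀ x * evolInv A B x₀ s)) ?_
    ((continuousOn_piece h hF _ _).aestronglyMeasurable measurableSet_Ioi)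
  exact AEStronglyMeasurable.smul (f := (Ici s).indicator (fun _ => (1 : ℝ)))
    (aestronglyMeasurable_const.indicator measurableSet_Ici)
    ((aestronglyMeasurable_evol h.cont).mul aestronglyMeasurable_const)

/-- Here the choice of the scalar product enters: P₁ = P₁* lets P₁Y* be read as (Y P₁)*. -/
theorem P_comp_adjoint (T : V →L[ℝ] V) : D.P 0 ∘L adjoint T = adjoint (T * D.P 0) := by
  rw [ContinuousLinearMap.mul_def, ContinuousLinearMap.adjoint_comp]
  congr 1
  exact (D.selfAdj 0).symm

theorem integrableOn_evol_P (h : TwoSided A B x₀ α γ K D.Pp D.Pm) :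
    IntegrableOn (fun x => evol A B x₀ x * D.P 0) (Ioi 0) := by
  have := h.integrableOn_evol_mul
  rwa [Pp_mul_Pm] at this

theorem exists_norm_evol_P_le (h : TwoSided A B x₀ α γ K D.Pp D.Pm) :
    ∃ C, 0 ≤ C ∧ ∀ x, 0 < x → ‖evol A B x₀ x * D.P 0‖ ≤ C := by
  have := h.exists_norm_evol_mul_le
  rwa [Pp_mul_Pm] at this

theorem integrableOn_adjoint_mul (h : TwoSided A B x₀ α γ K D.Pp D.Pm) {L : ℝ → V →L[ℝ] V} {C : ℝ}
    (hLm : AEStronglyMeasurable L (volume.restrict (Ioi 0))) (hL : ∀ x, 0 < x → ‖L x‖ ≤ C) :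
    IntegrableOn (fun x => adjoint (evol A B x₀ x * D.P 0) * L x) (Ioi 0) := by
  have hi := integrableOn_adjoint (integrableOn_evol_P h)
  refine Integrable.mono' (hi.norm.mul_const C) (hi.aestronglyMeasurable.mul hLm) ?_
  refine (ae_restrict_iff' measurableSet_Ioi).2 (ae_of_all _ fun x hx => ?_)
  exact (norm_mul_le _ _).trans (mul_le_mul_of_nonneg_left (hL x hx) (norm_nonneg _))

theorem gram_eq : D.gram = ∫ x in Ioi (0 : ℝ),
    adjoint (evol A B x₀ x * D.P 0) * (evol A B x₀ x * D.P 0) := by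
  rw [gram]
  simp only [← P_comp_adjoint]
  rfl

theorem integrableOn_gram (h : TwoSided A B x₀ α γ K D.Pp D.Pm) : IntegrableOn
    (fun x => adjoint (evol A B x₀ x * D.P 0) * (evol A B x₀ x * D.P 0)) (Ioi 0) := by
  obtain ⟨C, -, hC⟩ := exists_norm_evol_P_le h
  exact integrableOn_adjoint_mul h (integrableOn_evol_P h).aestronglyMeasurable hC

theorem P_mul_integral {L : ℝ → V →L[ℝ] V}
    (hL : IntegrableOn (fun x => adjoint (evol A B x₀ x * D.P 0) * L x) (Ioi 0)) :
    D.P 0 * ∫ x in Ioi (0 : ℝ), adjoint (evol A B x₀ x * D.P 0) * L x =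
      ∫ x in Ioi (0 : ℝ), adjoint (evol A B x₀ x * D.P 0) * L x := by
  rw [← integral_const_mul_of_integrable hL]
  congr 1
  funext x
  rw [← P_comp_adjoint, ← mul_assoc]
  congr 1
  change D.P 0 ∘L D.P 0 ∘L _ = _
  rw [← ContinuousLinearMap.comp_assoc, D.idem]

/-- The quadratic form of the Gram operator is the squared L² norm of a homogeneous solution. It
vanishes only if that solution does, Y(x) being invertible. -/
theorem integral_inner_gram (h : TwoSided A B x₀ α γ K D.Pp D.Pm) (v : V) :
    ⟪v, D.gram v⟫_ℝ = ∫ x in Ioi (0 : ℝ), ‖evol A B x₀ x (D.P 0 v)‖ ^ 2 := by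
  have hi := integrableOn_gram h
  have hiv : Integrable (fun x =>
      (adjoint (evol A B x₀ x * D.P 0) * (evol A B x₀ x * D.P 0)) v) (volume.restrict (Ioi 0)) :=
    ContinuousLinearMap.integrable_comp (ContinuousLinearMap.apply ℝ V v) hi
  rw [gram_eq, ContinuousLinearMap.integral_apply hi, ← integral_inner hiv]
  congr 1
  funext x
  rw [← real_inner_self_eq_norm_sq]
  exact ContinuousLinearMap.adjoint_inner_right (evol A B x₀ x * D.P 0) v _

theorem P_apply_eq_zero_of_gram (h : TwoSided A B x₀ α γ K D.Pp D.Pm) {v : V}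
    (hv : D.gram v = 0) : D.P 0 v = 0 := by
  have e := integral_inner_gram h v
  rw [hv, inner_zero_right] at e
  have hi : IntegrableOn (fun x => ‖evol A B x₀ x (D.P 0 v)‖ ^ 2) (Ioi 0) := by
    refine (Integrable.const_inner (𝕜 := ℝ) v (ContinuousLinearMap.integrable_comp
      (ContinuousLinearMap.apply ℝ V v) (integrableOn_gram h))).congr (ae_of_all _ fun x => ?_)
    beta_reduce
    rw [← real_inner_self_eq_norm_sq]
    exact ContinuousLinearMap.adjoint_inner_right (evol A B x₀ x * D.P 0) v _
  have h0 := (integral_eq_zero_iff_of_nonneg (fun x => sq_nonneg _) hi).1 e.symm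
  have hne : NeBot (ae (volume.restrict (Ioi (0 : ℝ)))) := by
    rw [ae_neBot, Ne, Measure.restrict_eq_zero]
    simp
  obtain ⟨x, hx, hx0⟩ := (h0.and (ae_restrict_mem measurableSet_Ioi)).exists
  have h1 : evol A B x₀ x (D.P 0 v) = 0 := by simpa using hx
  have h2 := congrArg (fun T : V →L[ℝ] V => T (D.P 0 v)) (evolInv_mul_evol (A := A) h.cont h.pos hx0)
  change evolInv A B x₀ x (evol A B x₀ x (D.P 0 v)) = D.P 0 v at h2
  rw [← h2, h1, map_zero]

theorem P_mul_gram (h : TwoSided A B x₀ α γ K D.Pp D.Pm) : D.P 0 * D.gram = D.gram := by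
  rw [gram_eq]
  exact P_mul_integral (integrableOn_gram h)

/-- If gram v + (v - P₁v) = 0, applying P₁ gives gram v = 0, hence P₁v = 0 by positivity, and then v
= 0. -/
theorem isUnit_gram (h : TwoSided A B x₀ α γ K D.Pp D.Pm) : IsUnit (D.gram + (1 - D.P 0)) := by
  rw [ContinuousLinearMap.isUnit_iff_bijective]
  have hinj : Function.Injective ((D.gram + (1 - D.P 0) : V →L[ℝ] V) : V →ₗ[ℝ] V) := by
    rw [← LinearMap.ker_eq_bot, LinearMap.ker_eq_bot']
    intro v hv
    have hv' : (D.gram + (1 - D.P 0)) v = 0 := hv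
    have e : D.P 0 * (D.gram + (1 - D.P 0)) = D.gram := by
      rw [mul_add, P_mul_gram h, mul_sub, mul_one, show D.P 0 * D.P 0 = D.P 0 from D.idem 0,
        sub_self, add_zero]
    have hg : D.gram v = 0 := by
      rw [← e]
      change D.P 0 ((D.gram + (1 - D.P 0)) v) = 0
      rw [hv', map_zero]
    have hP := P_apply_eq_zero_of_gram h hg
    have h2 : D.gram v + (v - D.P 0 v) = 0 := hv'
    rwa [hg, hP, sub_zero, zero_add] at h2
  exact ⟨hinj, LinearMap.injective_iff_surjective.1 hinj⟩

theorem M_eq (s : ℝ) : D.M F s = -(Ring.inverse (D.gram + (1 - D.P 0)) *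
    ∫ x in Ioi (0 : ℝ), adjoint (evol A B x₀ x * D.P 0) * D.preGreen F x s) := by
  rw [M]
  simp only [← P_comp_adjoint]
  rfl

theorem integrableOn_adjoint_preGreen (h : TwoSided A B x₀ α γ K D.Pp D.Pm)
    (hF : D.IsAdmissible F) {s : ℝ} (hs : 0 < s) :
    IntegrableOn (fun x => adjoint (evol A B x₀ x * D.P 0) * D.preGreen F x s) (Ioi 0) := by
  obtain ⟨C, hC⟩ := exists_norm_preGreen_le h hF hs
  exact integrableOn_adjoint_mul h (aestronglyMeasurable_preGreen_left h hF s) hC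

/-- The normal equation behind M. The integral takes values in 𝕃₁, where the added E - P₁ has no
effect. -/
theorem gram_mul_M (h : TwoSided A B x₀ α γ K D.Pp D.Pm)
    (hF : D.IsAdmissible F) {s : ℝ} (hs : 0 < s) : D.gram * D.M F s =
      -∫ x in Ioi (0 : ℝ), adjoint (evol A B x₀ x * D.P 0) * D.preGreen F x s := by
  set I := ∫ x in Ioi (0 : ℝ), adjoint (evol A B x₀ x * D.P 0) * D.preGreen F x s with hI
  have hPI : D.P 0 * I = I := P_mul_integral (integrableOn_adjoint_preGreen h hF hs)
  have hT : (D.gram + (1 - D.P 0)) * D.M F s = -I := by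
    rw [M_eq, mul_neg, ← mul_assoc, Ring.mul_inverse_cancel _ (isUnit_gram h), one_mul]
  have hPP : D.P 0 * D.P 0 = D.P 0 := D.idem 0
  have e : D.P 0 * (D.gram + (1 - D.P 0)) = D.gram := by
    rw [mul_add, P_mul_gram h, mul_sub, mul_one, hPP, sub_self, add_zero]
  rw [← e, mul_assoc, hT, mul_neg, hPI]

/-- Fubini: Y P₁ is integrable in x and `preGreen` is bounded in L¹(ds) uniformly in x, so the
double integral converges. -/
theorem integrableOn_M (h : TwoSided A B x₀ α γ K D.Pp D.Pm) (hF : D.IsAdmissible F) :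
    IntegrableOn (D.M F) (Ioi 0) := by
  obtain ⟨C, -, hC⟩ := exists_integral_norm_preGreen_le h hF
  have hi := (integrable_mul_prod (integrableOn_adjoint (integrableOn_evol_P h))
    (aestronglyMeasurable_preGreen h hF) (fun x hx => integrableOn_preGreen h hx)
    hC).integral_prod_right
  have hi2 := (Integrable.const_mul hi (Ring.inverse (D.gram + (1 - D.P 0)))).neg
  exact hi2.congr (ae_of_all _ fun s => (M_eq s).symm)

end Splitting

end Green

/-! ### Properties of the generalized Green function and the general solution. -/

section GreenProperties

variable {V : Type*} [NormedAddCommGroup V] [InnerProductSpace ℝ V] [FiniteDimensional ℝ V]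
  [CompleteSpace V] {A : V →L[ℝ] V} {B : ℝ → V →L[ℝ] V} {x₀ α γ K : ℝ}

namespace Splitting

open ContinuousLinearMap (adjoint)

variable {D : Splitting A B x₀} {F : ℝ → V →L[ℝ] V}

/-- One side of the Green function, as a function of its first argument. -/
noncomputable def greenPiece (D : Splitting A B x₀) (F : ℝ → V →L[ℝ] V) (S : V →L[ℝ] V) (s x : ℝ) :
    V →L[ℝ] V :=
  evol A B x₀ x * S + D.N F x * (D.Pi56 * evolInv A B x₀ s) + evol A B x₀ x * D.P 0 * D.M F s

theorem green_of_lt {x s : ℝ} (hs : x < s) :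
    D.green F x s = D.greenPiece F (kleft A B x₀ D.Pp D.Pm s) s x := by
  rw [green_eq, preGreen_of_lt hs, greenPiece]

theorem green_of_le {x s : ℝ} (hs : s ≤ x) :
    D.green F x s = D.greenPiece F (kleft A B x₀ D.Pp D.Pm s + evolInv A B x₀ s) s x := by
  rw [green_eq, preGreen_of_le hs, greenPiece]

theorem hasDerivAt_greenPiece (h : TwoSided A B x₀ α γ K D.Pp D.Pm) (hF : D.IsAdmissible F)
    (S : V →L[ℝ] V) (s : ℝ) {x : ℝ} (hx : 0 < x) :
    HasDerivAt (D.greenPiece F S s)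
      (coeff A B x * D.greenPiece F S s x - F x * (D.Pi56 * evolInv A B x₀ s)) x := by
  have hY := hasDerivAt_evol (A := A) (x₀ := x₀) h.cont hx
  have := ((hY.mul_const S).add ((hasDerivAt_N h hF hx).mul_const
    (D.Pi56 * evolInv A B x₀ s))).add ((hY.mul_const (D.P 0)).mul_const (D.M F s))
  refine this.congr_deriv ?_
  rw [greenPiece]
  noncomm_ring

theorem continuousAt_greenPiece (h : TwoSided A B x₀ α γ K D.Pp D.Pm) (hF : D.IsAdmissible F)
    (S : V →L[ℝ] V) (s : ℝ) {x : ℝ} (hx : 0 < x) : ContinuousAt (D.greenPiece F S s) x :=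
  (hasDerivAt_greenPiece h hF S s hx).continuousAt

theorem integrableOn_green (h : TwoSided A B x₀ α γ K D.Pp D.Pm) (hF : D.IsAdmissible F) {x : ℝ}
    (hx : 0 < x) : IntegrableOn (D.green F x) (Ioi 0) := by
  have h1 : Integrable (D.preGreen F x) (volume.restrict (Ioi 0)) := integrableOn_preGreen h hx
  have h2 : Integrable (fun s => evol A B x₀ x * D.P 0 * D.M F s)
    (volume.restrict (Ioi 0)) := Integrable.const_mul (integrableOn_M h hF) _
  exact (Integrable.add (f := D.preGreen F x) h1 h2).congr
    (ae_of_all _ fun s => (green_eq x s).symm)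

/-- Y P₁ is bounded and M is integrable, so the last correction keeps the uniform L¹(ds) bound of
`preGreen`. -/
theorem exists_integral_norm_green_le (h : TwoSided A B x₀ α γ K D.Pp D.Pm)
    (hF : D.IsAdmissible F) :
    ∃ C, 0 ≤ C ∧ ∀ x, 0 < x → ∫ s in Ioi (0 : ℝ), ‖D.green F x s‖ ≤ C := by
  obtain ⟨a, ha0, ha⟩ := exists_integral_norm_preGreen_le h hF
  obtain ⟨b, hb0, hb⟩ := exists_norm_evol_P_le h
  have hM := integrableOn_M h hF
  have hI0 : 0 ≤ ∫ s in Ioi (0 : ℝ), ‖D.M F s‖ := integral_nonneg fun s => norm_nonneg _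
  refine ⟨a + b * ∫ s in Ioi (0 : ℝ), ‖D.M F s‖, by positivity, fun x hx => ?_⟩
  calc _ ≤ ∫ s in Ioi (0 : ℝ), (‖D.preGreen F x s‖ + ‖evol A B x₀ x * D.P 0‖ * ‖D.M F s‖) := by
        refine integral_mono (integrableOn_green h hF hx).norm
          ((integrableOn_preGreen h hx).norm.add (hM.norm.const_mul _)) fun s => ?_
        beta_reduce
        rw [green_eq]
        exact (norm_add_le _ _).trans (add_le_add le_rfl (norm_mul_le _ _))
    _ = (∫ s in Ioi (0 : ℝ), ‖D.preGreen F x s‖) +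
        ‖evol A B x₀ x * D.P 0‖ * ∫ s in Ioi (0 : ℝ), ‖D.M F s‖ := by
        rw [integral_add (integrableOn_preGreen h hx).norm (hM.norm.const_mul _),
          integral_const_mul]
    _ ≤ _ := add_le_add (ha x hx) (mul_le_mul_of_nonneg_right (hb x hx) hI0)

theorem adjoint_mul_green (x s : ℝ) : adjoint (evol A B x₀ x * D.P 0) * D.green F x s =
    adjoint (evol A B x₀ x * D.P 0) * D.preGreen F x s +
      adjoint (evol A B x₀ x * D.P 0) * (evol A B x₀ x * D.P 0) * D.M F s := by
  rw [green_eq, mul_add, mul_assoc (adjoint _)]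

theorem integral_adjoint_mul_green (h : TwoSided A B x₀ α γ K D.Pp D.Pm) (hF : D.IsAdmissible F)
    {s : ℝ} (hs : 0 < s) :
    IntegrableOn (fun x => adjoint (evol A B x₀ x * D.P 0) * D.green F x s) (Ioi 0) ∧
    ∫ x in Ioi (0 : ℝ), adjoint (evol A B x₀ x * D.P 0) * D.green F x s = 0 := by
  have h1 : Integrable (fun x => adjoint (evol A B x₀ x * D.P 0) * D.preGreen F x s)
    (volume.restrict (Ioi 0)) := integrableOn_adjoint_preGreen h hF hs
  have hg := integrableOn_gram h
  have h2 : Integrable (fun x => adjoint (evol A B x₀ x * D.P 0) * (evol A B x₀ x * D.P 0) *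
    D.M F s) (volume.restrict (Ioi 0)) := Integrable.mul_const hg _
  simp only [adjoint_mul_green]
  refine ⟨Integrable.add (f := fun x => adjoint (evol A B x₀ x * D.P 0) * D.preGreen F x s) h1 h2,
    ?_⟩
  rw [integral_add h1 h2, integral_mul_const_of_integrable hg, ← gram_eq, gram_mul_M h hF hs,
    add_neg_cancel]

/-- The five characteristic properties. -/
theorem isGeneralizedGreen_green (h : TwoSided A B x₀ α γ K D.Pp D.Pm) (hF : D.IsAdmissible F) :
    D.IsGeneralizedGreen F (D.green F) where
  ode s x hs hx hxs := by
    change HasDerivAt _ (coeff A B x * D.green F x s - F x * (D.Pi56 * evolInv A B x₀ s)) x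
    rcases lt_or_gt_of_ne hxs with h1 | h1
    · rw [green_of_lt h1]
      refine (hasDerivAt_greenPiece h hF _ s hx).congr_of_eventuallyEq ?_
      filter_upwards [gt_mem_nhds h1] with t ht using green_of_lt ht
    · rw [green_of_le h1.le]
      refine (hasDerivAt_greenPiece h hF _ s hx).congr_of_eventuallyEq ?_
      filter_upwards [lt_mem_nhds h1] with t ht using green_of_le ht.le
  jump x hx := by
    refine ⟨D.greenPiece F (kleft A B x₀ D.Pp D.Pm x + evolInv A B x₀ x) x x,
      D.greenPiece F (kleft A B x₀ D.Pp D.Pm x) x x, ?_, ?_, ?_⟩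
    · refine ((continuousAt_greenPiece h hF _ x hx).tendsto.mono_left nhdsWithin_le_nhds).congr' ?_
      filter_upwards [self_mem_nhdsWithin] with t ht using (green_of_le (le_of_lt ht)).symm
    · refine ((continuousAt_greenPiece h hF _ x hx).tendsto.mono_left nhdsWithin_le_nhds).congr' ?_
      filter_upwards [self_mem_nhdsWithin] with t ht using (green_of_lt ht).symm
    · rw [← evol_mul_evolInv (A := A) (x₀ := x₀) h.cont h.pos hx, greenPiece, greenPiece, mul_add]
      abel
  orth s hs := by
    have e : ∀ x, D.P 0 ∘L adjoint (evol A B x₀ x) ∘L D.green F x s =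
        adjoint (evol A B x₀ x * D.P 0) * D.green F x s := fun x => by
      rw [← P_comp_adjoint]
      rfl
    simp only [e]
    exact integral_adjoint_mul_green h hF hs
  tendsto_zero s hs := by
    -- P₁ = `D.Pp * D.Pm` shows that Y(x)P₁ vanishes at zero; the opposite order serves at infinity.
    have t := (tendsto_preGreen_zero h hF hs).add
      ((h.zero.tendsto_evol_mul h.cont h.pos h.alpha_pos).mul_const (D.Pm * D.M F s))
    rw [zero_mul, add_zero] at t
    refine t.congr fun x => ?_
    rw [green_eq, ← D.Pp_mul_Pm]
    noncomm_ring
  tendsto_atTop s _ := by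
    have t := (tendsto_preGreen_atTop h hF s).add
      (h.tendsto_evol_mul_atTop.mul_const (D.Pp * D.M F s))
    rw [zero_mul, add_zero] at t
    refine t.congr fun x => ?_
    rw [green_eq, ← D.Pm_mul_Pp]
    noncomm_ring
  bounded g hg hg0 _ := by
    obtain ⟨M, hM⟩ := exists_bound_Ici hg hg0
    have hM0 : 0 ≤ M := (norm_nonneg _).trans (hM 0 le_rfl)
    obtain ⟨C, -, hC⟩ := exists_integral_norm_green_le h hF
    refine ⟨C * M, fun x hx => ?_⟩
    have hi := integrableOn_green h hF hx
    have hig := integrableOn_apply hi hg hM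
    refine ⟨hig, ?_⟩
    calc _ ≤ ∫ s in Ioi (0 : ℝ), ‖D.green F x s‖ * M :=
          setIntegral_mono_on hig.norm (hi.norm.mul_const M) measurableSet_Ioi fun s hs =>
            (ContinuousLinearMap.le_opNorm _ _).trans
              (mul_le_mul_of_nonneg_left (hM s (le_of_lt hs)) (norm_nonneg _))
      _ = (∫ s in Ioi (0 : ℝ), ‖D.green F x s‖) * M := integral_mul_const _ _
      _ ≤ _ := mul_le_mul_of_nonneg_right (hC x hx) hM0

section Solutions

variable {g : ℝ → V} {M : ℝ}

/-- The N-term contains ∫ ΠY⁻¹g = 0 and drops out; the M-term is a homogeneous solution starting in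
𝕃₁. So 𝔊 and G produce the same set of solutions. -/
theorem integral_green_apply (h : TwoSided A B x₀ α γ K D.Pp D.Pm) (hF : D.IsAdmissible F)
    (hg : ContinuousOn g (Ici 0)) (hM : ∀ s, 0 ≤ s → ‖g s‖ ≤ M)
    (hdef : ∫ s in Ioi (0 : ℝ), (D.Pi56 * evolInv A B x₀ s) (g s) = 0) {x : ℝ} (hx : 0 < x) :
    ∫ s in Ioi (0 : ℝ), D.green F x s (g s) =
      (∫ s in Ioi (0 : ℝ), kern A B x₀ D.Pp D.Pm x s (g s)) +
        evol A B x₀ x (D.P 0 (∫ s in Ioi (0 : ℝ), D.M F s (g s))) := by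
  have h1 := integrableOn_apply (h.leftSided.integrableOn_kern hx) hg hM
  have h2 := integrableOn_apply (integrableOn_Pi56_mul h) hg hM
  have h3 := integrableOn_apply (integrableOn_M h hF) hg hM
  have e : ∀ s, D.green F x s (g s) = kern A B x₀ D.Pp D.Pm x s (g s) +
      D.N F x ((D.Pi56 * evolInv A B x₀ s) (g s)) +
      (evol A B x₀ x * D.P 0) (D.M F s (g s)) := fun s => by
    rw [green_eq, preGreen_eq_kern]
    rfl
  simp only [e]
  have i2 := (D.N F x).integrable_comp h2
  have i3 := (evol A B x₀ x * D.P 0).integrable_comp h3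
  have i12 : Integrable (fun s => kern A B x₀ D.Pp D.Pm x s (g s) +
      D.N F x ((D.Pi56 * evolInv A B x₀ s) (g s))) (volume.restrict (Ioi 0)) := h1.add i2
  rw [integral_add i12 i3, integral_add h1 i2, (D.N F x).integral_comp_comm h2, hdef,
    map_zero, add_zero, (evol A B x₀ x * D.P 0).integral_comp_comm h3]
  rfl

theorem mem_L1_iff {v : V} : v ∈ D.L1 ↔ D.P 0 v = v := by
  refine ⟨?_, fun hv => ⟨v, hv⟩⟩
  rintro ⟨w, rfl⟩
  exact congrArg (fun T : V →L[ℝ] V => T w) (D.idem 0)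

theorem Pp_Pm_apply_eq_iff {v : V} : D.Pp v = v ∧ D.Pm v = v ↔ D.P 0 v = v := by
  have hp : D.Pp * D.P 0 = D.P 0 := by simp [Pp, add_mul, P_mul_P]
  have hm : D.Pm * D.P 0 = D.P 0 := by simp [Pm, add_mul, P_mul_P]
  constructor
  · rintro ⟨h1, h2⟩
    rw [← D.Pp_mul_Pm]
    change D.Pp (D.Pm v) = v
    rw [h2, h1]
  · intro hv
    constructor
    · conv_lhs => rw [← hv]
      exact (congrArg (fun T : V →L[ℝ] V => T v) hp).trans hv
    · conv_lhs => rw [← hv]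
      exact (congrArg (fun T : V →L[ℝ] V => T v) hm).trans hv

/-- The general solution of the boundary value problem. -/
theorem isBVPSolution_iff (h : TwoSided A B x₀ α γ K D.Pp D.Pm) (hF : D.IsAdmissible F)
    (hA : ∀ z : ℂ, IsCharRoot A z → z.re ≠ 1)
    (hg : ContinuousOn g (Ici 0)) (hg0 : Tendsto g atTop (𝓝 0))
    (hdef : ∫ s in Ioi (0 : ℝ), (D.Pi56 * evolInv A B x₀ s) (g s) = 0) (y : ℝ → V) :
    IsBVPSolution A B g y ↔ y 0 = 0 ∧ ∃ v ∈ D.L1, ∀ x : ℝ, 0 < x →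
      y x = evol A B x₀ x v + ∫ s in Ioi (0 : ℝ), D.green F x s (g s) := by
  obtain ⟨M, hM⟩ := exists_bound_Ici hg hg0
  have hdef' : ∫ s in Ioi (0 : ℝ), ((1 - D.Pm) * (1 - D.Pp) * evolInv A B x₀ s) (g s) = 0 := by
    rw [one_sub_Pm_mul_one_sub_Pp]
    exact hdef
  rw [h.isBVPSolution_iff hA hg (h.leftSided.isSolution_integral_kern hg hM)
    (h.leftSided.isBigO_integral_kern hg hM hdef') (h.tendsto_integral_kern_apply hg hM hg0)]
  set m := ∫ s in Ioi (0 : ℝ), D.M F s (g s) with hm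
  have hPm : D.P 0 (D.P 0 m) = D.P 0 m := congrArg (fun T : V →L[ℝ] V => T m) (D.idem 0)
  refine and_congr_right fun _ => ⟨?_, ?_⟩
  · rintro ⟨w, hw1, hw2, hy⟩
    -- The parameter is shifted by the initial value P₁m of the M-term, a bijection of 𝕃₁.
    refine ⟨w - D.P 0 m, mem_L1_iff.2 ?_, fun x hx => ?_⟩
    · rw [map_sub, hPm, Pp_Pm_apply_eq_iff.1 ⟨hw1, hw2⟩]
    · rw [hy x hx, integral_green_apply h hF hg hM hdef hx, map_sub]
      abel
  · rintro ⟨v, hv, hy⟩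
    have hw : D.P 0 (v + D.P 0 m) = v + D.P 0 m := by rw [map_add, hPm, mem_L1_iff.1 hv]
    refine ⟨v + D.P 0 m, (Pp_Pm_apply_eq_iff.2 hw).1, (Pp_Pm_apply_eq_iff.2 hw).2, fun x hx => ?_⟩
    rw [hy x hx, integral_green_apply h hF hg hM hdef hx, map_add]
    abel

/-- Orthogonality of the two components of the general solution. -/
theorem integral_inner_green (h : TwoSided A B x₀ α γ K D.Pp D.Pm) (hF : D.IsAdmissible F)
    (hg : ContinuousOn g (Ici 0)) (hM : ∀ s, 0 ≤ s → ‖g s‖ ≤ M) {v : V} (hv : v ∈ D.L1) :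
    IntegrableOn (fun x => ⟪evol A B x₀ x v, ∫ s in Ioi (0 : ℝ), D.green F x s (g s)⟫_ℝ) (Ioi 0) ∧
    ∫ x in Ioi (0 : ℝ), ⟪evol A B x₀ x v, ∫ s in Ioi (0 : ℝ), D.green F x s (g s)⟫_ℝ = 0 := by
  obtain ⟨C, -, hC⟩ := exists_integral_norm_green_le h hF
  have hgm : AEStronglyMeasurable (fun p : ℝ × ℝ => D.green F p.1 p.2)
      ((volume.restrict (Ioi 0)).prod (volume.restrict (Ioi 0))) := by
    simp only [green_eq]
    exact (aestronglyMeasurable_preGreen h hF).add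
      ((integrableOn_evol_P h).aestronglyMeasurable.comp_fst.mul
        (integrableOn_M h hF).aestronglyMeasurable.comp_snd)
  have hi := integrable_mul_prod (integrableOn_adjoint (integrableOn_evol_P h)) hgm
    (fun x hx => integrableOn_green h hF hx) hC
  have hgs := LeftSided.aestronglyMeasurable_of_continuousOn hg
  have hf : Integrable (fun p : ℝ × ℝ =>
      (adjoint (evol A B x₀ p.1 * D.P 0) * D.green F p.1 p.2) (g p.2))
      ((volume.restrict (Ioi 0)).prod (volume.restrict (Ioi 0))) := by
    refine Integrable.mono' (hi.norm.mul_const M)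
      ((isBoundedBilinearMap_apply (𝕜 := ℝ) (E := V) (F := V)).continuous
        |>.comp_aestronglyMeasurable₂ hi.aestronglyMeasurable hgs.comp_snd) ?_
    have hpos : ∀ᵐ p : ℝ × ℝ ∂((volume.restrict (Ioi 0)).prod (volume.restrict (Ioi 0))),
        0 < p.2 :=
      Measure.quasiMeasurePreserving_snd.ae (ae_restrict_mem measurableSet_Ioi)
    filter_upwards [hpos] with p hp
    exact (ContinuousLinearMap.le_opNorm _ _).trans
      (mul_le_mul_of_nonneg_left (hM p.2 hp.le) (norm_nonneg _))
  have hinner : ∀ x ∈ Ioi (0 : ℝ),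
      ⟪evol A B x₀ x v, ∫ s in Ioi (0 : ℝ), D.green F x s (g s)⟫_ℝ =
        ⟪v, ∫ s in Ioi (0 : ℝ), (adjoint (evol A B x₀ x * D.P 0) * D.green F x s) (g s)⟫_ℝ := by
    intro x hx
    have e := (adjoint (evol A B x₀ x * D.P 0)).integral_comp_comm
      (integrableOn_apply (integrableOn_green h hF hx) hg hM)
    have e2 := ContinuousLinearMap.adjoint_inner_right (evol A B x₀ x * D.P 0) v
      (∫ s in Ioi (0 : ℝ), D.green F x s (g s))
    rw [← e] at e2
    refine Eq.trans ?_ e2.symm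
    conv_lhs => rw [← mem_L1_iff.1 hv]
    rfl
  have hx_int := hf.integral_prod_left
  refine ⟨(Integrable.const_inner (𝕜 := ℝ) v hx_int).congr
    ((ae_restrict_iff' measurableSet_Ioi).2 (ae_of_all _ fun x hx => (hinner x hx).symm)), ?_⟩
  -- After Y(x)P₁ is moved to the other side and the integrals are exchanged, the inner integral
  -- over x vanishes for every s by the orthogonality of the kernel.
  rw [setIntegral_congr_fun measurableSet_Ioi hinner, integral_inner hx_int,
    integral_integral_swap hf]
  have hz : ∀ s ∈ Ioi (0 : ℝ), ∫ x in Ioi (0 : ℝ),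
      (adjoint (evol A B x₀ x * D.P 0) * D.green F x s) (g s) = 0 := by
    intro s hs
    obtain ⟨h1, h2⟩ := integral_adjoint_mul_green h hF hs
    rw [← ContinuousLinearMap.integral_apply h1, h2, zero_apply]
  rw [setIntegral_congr_fun measurableSet_Ioi hz, integral_zero, inner_zero_right]

end Solutions

end Splitting

end GreenProperties

end SingularODE

/-! ### The main theorem. -/

theorem mainTheorem2 {V : Type*} [NormedAddCommGroup V] [InnerProductSpace ℝ V]
    [FiniteDimensional ℝ V] [CompleteSpace V]
    (A : V →L[ℝ] V) (B : ℝ → V →L[ℝ] V)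
    (hBcont : ContinuousOn B (Ici 0)) (hBbdd : ∃ C : ℝ, ∀ x : ℝ, 0 ≤ x → ‖B x‖ ≤ C)
    (hA : ∀ z : ℂ, SingularODE.IsCharRoot A z → z.re ≠ 1)
    (hB : ∃ a : ℝ, 0 < a ∧ SingularODE.IsExpDichotomic A B a)
    (g : ℝ → V) (hg : ContinuousOn g (Ici 0)) (hg0 : Tendsto g atTop (𝓝 0)) :
    -- solvability criterion
    ((∃ y : ℝ → V, SingularODE.IsBVPSolution A B g y) ↔
      ∀ η : ℝ → V, SingularODE.IsAdjointSolution A B η → IntegrableOn η (Ioi 0) →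
        ∫ x in Ioi (0 : ℝ), ⟪g x, η x⟫_ℝ = 0) ∧
    ∀ x₀ : ℝ, 0 < x₀ → ∀ D : SingularODE.Splitting A B x₀,
      -- the explicit weights are admissible
      (∃ κ₀ : ℝ, ∀ κ β : ℝ, κ₀ < κ → 0 < β →
        (∀ z : ℂ, SingularODE.IsCharRoot A z → -β < z.re) →
        D.IsAdmissible (D.expWeight κ β)) ∧
      ∀ F : ℝ → V →L[ℝ] V, D.IsAdmissible F →
        -- the kernel is a generalized Green function
        D.IsGeneralizedGreen F (D.green F) ∧
        ((∀ η : ℝ → V, SingularODE.IsAdjointSolution A B η → IntegrableOn η (Ioi 0) →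
            ∫ x in Ioi (0 : ℝ), ⟪g x, η x⟫_ℝ = 0) →
          -- the integral converges, and the formula gives exactly all the solutions
          (∀ x : ℝ, 0 < x → IntegrableOn (fun s => D.green F x s (g s)) (Ioi 0)) ∧
          (∀ y : ℝ → V, SingularODE.IsBVPSolution A B g y ↔
            y 0 = 0 ∧ ∃ v ∈ D.L1, ∀ x : ℝ, 0 < x →
              y x = SingularODE.evol A B x₀ x v + ∫ s in Ioi (0 : ℝ), D.green F x s (g s)) ∧
          -- the two components are orthogonal
          ∀ v ∈ D.L1,
            IntegrableOn (fun x => ⟪SingularODE.evol A B x₀ x v,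
              ∫ s in Ioi (0 : ℝ), D.green F x s (g s)⟫_ℝ) (Ioi 0) ∧
            ∫ x in Ioi (0 : ℝ), ⟪SingularODE.evol A B x₀ x v,
              ∫ s in Ioi (0 : ℝ), D.green F x s (g s)⟫_ℝ = 0) := by
  refine ⟨SingularODE.exists_isBVPSolution_iff hBcont hBbdd hA hB hg hg0, fun x₀ hx₀ D =>
    ⟨D.exists_isAdmissible_expWeight hBcont hBbdd hx₀, fun F hF => ?_⟩⟩
  obtain ⟨α, γ, K, h⟩ := D.exists_twoSided hBcont hBbdd hA hB hx₀
  refine ⟨SingularODE.Splitting.isGeneralizedGreen_green h hF, fun horth => ?_⟩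
  obtain ⟨M, hM⟩ := SingularODE.exists_bound_Ici hg hg0
  have hdef := SingularODE.integral_eq_zero_of_orthogonal hBcont hx₀
    (SingularODE.Splitting.integrableOn_Pi56_mul h) hg hM horth
  exact ⟨fun x hx => SingularODE.integrableOn_apply
      (SingularODE.Splitting.integrableOn_green h hF hx) hg hM,
    SingularODE.Splitting.isBVPSolution_iff h hF hA hg hg0 hdef,
    fun v hv => SingularODE.Splitting.integral_inner_green h hF hg hM hv⟩
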